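/- Let $d\in\{2,3\}$ and let $\Omega\subset\mathbb{R}^d$ be a bounded domain (non-empty, open, connected) with Lipschitz boundary. Let $\{P_i\}_{i=1}^N$ be a polytopal partition of $\Omega$: the $P_i$ are pairwise disjoint, non-empty, open, bounded (not necessarily convex) polytopes, i.e. each $P_i$ is the interior of its closure and $\overline{P_i}$ is a finite union of convex hulls of finite sets, and $\bigcup_i\overline{P_i}=\overline\Omega$. Let $\sigma=\sum_{i=1}^N\sigma_i\chi_{P_i}$ with constants $\sigma_i\ge\lambda>0$. Let $H^{1/2}(\partial\Omega)$ be the space of traces of $H^1(\Omega)$ with the quotient norm, and let $H^{-1/2}_0(\partial\Omega)$ be the space of bounded linear functionals on $H^{1/2}(\partial\Omega)$ that vanish on constants. For $j=1,\dots,M$ let $g_j\in H^{-1/2}_0(\partial\Omega)$ and $f_j\in H^{1/2}(\partial\Omega)$. For a conductivity $\kappa\in L^\infty(\Omega)$ with positive essential infimum let $u_j[\kappa]\in H^1(\Omega)$ be the weak solution of the state problem $$-\nabla\cdot(\kappa\nabla u_j)=0\ \text{in }\Omega,\qquad \kappa\,\frac{\partial u_j}{\partial\nu}=g_j\ \text{on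 }\partial\Omega,\qquad \int_{\partial\Omega}u_j\,ds=\int_{\partial\Omega}f_j\,ds,$$ that is, $\int_\Omega\kappa\nabla u_j\cdot\nabla w\,dx=\langle g_j,w|_{\partial\Omega}\rangle$ for all $w\in H^1(\Omega)$ together with the normalization, and put $$J(\kappa)=\frac12\sum_{j=1}^M\int_{\partial\Omega}|u_j[\kappa]-f_j|^2\,ds .$$ Let $U\in W^{1,\infty}(\mathbb{R}^d;\mathbb{R}^d)$ (continuous representative), with weak Jacobian $DU$, vanish in a neighbourhood of $\partial\Omega$. Put $\Phi_t(x)=x+tU(x)$ and $\mathcal{A}=\operatorname{div}(U)\,I-(DU+DU^T)$. Then for all sufficiently small $|t|$ the map $\Phi_t:\mathbb{R}^d\to\mathbb{R}^d$ is bijective and, with $\sigma_t=\sigma\circ\Phi_t^{-1}$, the state problems with $\kappa=\sigma_t$ are uniquely solvable. With $u_j=u_j[\sigma]$, the adjoint problem $$-\nabla\cdot(\sigma\nabla z_j)=0\ \text{in }\Omega,\qquad \sigma\,\frac{\partial z_j}{\partial\nu}=f_j-u_j\ \text{on }\partial\Omega,\qquad \int_{\partial\Omega}z_j\,ds=\int_{\partial\Omega}f_j\,ds$$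 has a unique weak solution $z_j\in H^1(\Omega)$ for each $j$. Moreover $J$ is shape differentiable at the partition in the direction $U$: the function $t\mapsto J(\sigma_t)$ is differentiable at $t=0$, each integrand below is integrable, and $$\langle\nabla_{\mathcal P}J,U\rangle:=\frac{d}{dt}J(\sigma_t)\Big|_{t=0}=\sum_{j=1}^M\int_\Omega\sigma\,\mathcal{A}\nabla u_j\cdot\nabla z_j\,dx .$$ -/

import Mathlib

open MeasureTheory Set Filter Topology
open scoped ContDiff NNReal ENNReal

noncomputable section

namespace ShapeEIT

/-- The space `ℝ^d` with the Euclidean norm. -/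
abbrev E (d : ℕ) : Type := EuclideanSpace ℝ (Fin d)

variable {d : ℕ}

/-! ### Lipschitz domains and polytopal partitions -/

/-- A bounded domain (nonempty, open, connected) with Lipschitz boundary: near every boundary point
and in suitable orthonormal coordinates with last axis `ν`, the set is the strict epigraph of a
Lipschitz function of the remaining coordinates. -/
structure IsLipschitzDomain (Ω : Set (E d)) : Prop where
  isOpen : IsOpen Ω
  isConnected : IsConnected Ω
  isBounded : Bornology.IsBounded Ω
  graph : ∀ x ∈ frontier Ω, ∃ (ν : E d) (γ : (Submodule.span ℝ {ν})ᗮ → ℝ) (K : ℝ≥0) (r : ℝ),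
    ‖ν‖ = 1 ∧ LipschitzWith K γ ∧ 0 < r ∧
      ∀ y ∈ Metric.ball x r,
        (y ∈ Ω ↔ γ ((Submodule.span ℝ {ν})ᗮ.orthogonalProjectionOnto y) < inner ℝ ν y)

/-- An open bounded (not necessarily convex) polytope: a nonempty open set that is the interior of
its closure, the closure being a finite union of convex hulls of finite sets. -/
structure IsOpenPolytope (P : Set (E d)) : Prop where
  nonempty : P.Nonempty
  interior_closure : interior (closure P) = P
  closure_eq : ∃ (n : ℕ) (V : Fin n → Finset (E d)),
    closure P = ⋃ i, convexHull ℝ (V i : Set (E d))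

/-- A finite partition of `Ω` into open bounded polytopes. -/
structure IsPolytopalPartition (Ω : Set (E d)) {N : ℕ} (P : Fin N → Set (E d)) : Prop where
  polytope : ∀ i, IsOpenPolytope (P i)
  iUnion_closure : ⋃ i, closure (P i) = closure Ω
  disjoint : ∀ i k, i ≠ k → P i ∩ P k = ∅

/-- The piecewise constant function `∑ i, c i χ_{P i}`. -/
def piecewiseConst {N : ℕ} (P : Fin N → Set (E d)) (c : Fin N → ℝ) (x : E d) : ℝ :=
  ∑ i, (P i).indicator (fun _ => c i) x

/-! ### The Sobolev space `H¹(Ω)` -/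

/-- Smooth functions with compact support contained in `Ω`. -/
structure IsTestFunction (Ω : Set (E d)) (φ : E d → ℝ) : Prop where
  contDiff : ContDiff ℝ ∞ φ
  hasCompactSupport : HasCompactSupport φ
  tsupport_subset : tsupport φ ⊆ Ω

/-- `G` is the weak gradient of `u` in `Ω`. -/
def HasWeakGradient (Ω : Set (E d)) (u : E d → ℝ) (G : E d → E d) : Prop :=
  ∀ φ, IsTestFunction Ω φ → ∀ v : E d,
    ∫ x in Ω, u x * fderiv ℝ φ x v = - ∫ x in Ω, φ x * inner ℝ (G x) v

/-- The ambient Hilbert space `L²(Ω) × L²(Ω; ℝ^d)`. -/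
abbrev L2Pair (Ω : Set (E d)) : Type :=
  WithLp 2 (Lp ℝ 2 (volume.restrict Ω) × Lp (E d) 2 (volume.restrict Ω))

theorem IsTestFunction.memLp {Ω : Set (E d)} {φ : E d → ℝ} (h : IsTestFunction Ω φ) :
    MemLp φ 2 (volume.restrict Ω) :=
  h.contDiff.continuous.memLp_of_hasCompactSupport h.hasCompactSupport

theorem IsTestFunction.memLp_fderiv {Ω : Set (E d)} {φ : E d → ℝ} (h : IsTestFunction Ω φ)
    (v : E d) : MemLp (fun x => fderiv ℝ φ x v) 2 (volume.restrict Ω) := by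
  have hc : Continuous (fun x => fderiv ℝ φ x v) :=
    (h.contDiff.continuous_fderiv (by simp)).clm_apply continuous_const
  exact hc.memLp_of_hasCompactSupport (h.hasCompactSupport.fderiv_apply ℝ v)

/-- `H¹(Ω)`, realized as the space of pairs `(u, ∇u)` with `u ∈ L²(Ω)` whose weak gradient `∇u` is
in `L²(Ω; ℝ^d)`; it carries the norm `(‖u‖² + ‖∇u‖²)^{1/2}`. -/
def H1 (Ω : Set (E d)) : Submodule ℝ (L2Pair Ω) where
  carrier := {p | HasWeakGradient Ω p.fst p.snd}
  zero_mem' := by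
    intro φ hφ v
    have h1 : ∫ x in Ω, (((0 : L2Pair Ω).fst : Lp ℝ 2 (volume.restrict Ω)) : E d → ℝ) x
        * fderiv ℝ φ x v = 0 := by
      apply integral_eq_zero_of_ae
      filter_upwards [Lp.coeFn_zero ℝ 2 (volume.restrict Ω)] with x hx
      rw [WithLp.zero_fst, hx]
      simp
    have h2 : ∫ x in Ω, φ x * inner ℝ ((((0 : L2Pair Ω).snd :
        Lp (E d) 2 (volume.restrict Ω)) : E d → E d) x) v = 0 := by
      apply integral_eq_zero_of_ae
      filter_upwards [Lp.coeFn_zero (E d) 2 (volume.restrict Ω)] with x hx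
      rw [WithLp.zero_snd, hx]
      simp
    rw [h1, h2, neg_zero]
  add_mem' := by
    intro p q hp hq φ hφ v
    have i1 : ∀ r : L2Pair Ω, Integrable (fun x => (r.fst : E d → ℝ) x * fderiv ℝ φ x v)
        (volume.restrict Ω) := fun r => (Lp.memLp r.fst).integrable_mul (hφ.memLp_fderiv v)
    have i2 : ∀ r : L2Pair Ω, Integrable (fun x => φ x * inner ℝ ((r.snd : E d → E d) x) v)
        (volume.restrict Ω) := fun r =>
      hφ.memLp.integrable_mul ((Lp.memLp r.snd).inner_const v)
    have h1 : ∫ x in Ω, ((p + q).fst : E d → ℝ) x * fderiv ℝ φ x v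
        = ∫ x in Ω, ((p.fst : E d → ℝ) x * fderiv ℝ φ x v
            + (q.fst : E d → ℝ) x * fderiv ℝ φ x v) := by
      apply integral_congr_ae
      filter_upwards [Lp.coeFn_add p.fst q.fst] with x hx
      rw [WithLp.add_fst, hx, Pi.add_apply, add_mul]
    have h2 : ∫ x in Ω, φ x * inner ℝ (((p + q).snd : E d → E d) x) v
        = ∫ x in Ω, (φ x * inner ℝ ((p.snd : E d → E d) x) v
            + φ x * inner ℝ ((q.snd : E d → E d) x) v) := by
      apply integral_congr_ae
      filter_upwards [Lp.coeFn_add p.snd q.snd] with x hx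
      rw [WithLp.add_snd, hx, Pi.add_apply, inner_add_left, mul_add]
    rw [h1, h2, integral_add (i1 p) (i1 q), integral_add (i2 p) (i2 q), hp φ hφ v, hq φ hφ v,
      neg_add]
  smul_mem' := by
    intro a p hp φ hφ v
    have h1 : ∫ x in Ω, ((a • p).fst : E d → ℝ) x * fderiv ℝ φ x v
        = ∫ x in Ω, a * ((p.fst : E d → ℝ) x * fderiv ℝ φ x v) := by
      apply integral_congr_ae
      filter_upwards [Lp.coeFn_smul a p.fst] with x hx
      rw [WithLp.smul_fst, hx, Pi.smul_apply, smul_eq_mul, mul_assoc]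
    have h2 : ∫ x in Ω, φ x * inner ℝ (((a • p).snd : E d → E d) x) v
        = ∫ x in Ω, a * (φ x * inner ℝ ((p.snd : E d → E d) x) v) := by
      apply integral_congr_ae
      filter_upwards [Lp.coeFn_smul a p.snd] with x hx
      rw [WithLp.smul_snd, hx, Pi.smul_apply, real_inner_smul_left]
      ring
    rw [h1, h2, integral_const_mul, integral_const_mul, hp φ hφ v, mul_neg]

/-- The gradient of a function in `H¹(Ω)`. -/
def grad {Ω : Set (E d)} (u : H1 Ω) : E d → E d := ((u : L2Pair Ω).snd : E d → E d)

/-! ### Traces, `H^{1/2}(∂Ω)` and `H^{-1/2}_0(∂Ω)` -/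

/-- The surface measure of `∂Ω`: the `(d-1)`-dimensional Hausdorff measure (normalized to agree with
Lebesgue measure on `ℝ^{d-1}`), restricted to `∂Ω`. -/
def surface (Ω : Set (E d)) : Measure (E d) := (μHE[d - 1]).restrict (frontier Ω)

/-- The pairs `(φ|_Ω, φ|_∂Ω)` in `H¹(Ω) × L²(∂Ω)`, for `φ` smooth on `ℝ^d`. -/
def smoothTraces (Ω : Set (E d)) : Submodule ℝ (H1 Ω × Lp ℝ 2 (surface Ω)) where
  carrier := {p | ∃ φ : E d → ℝ, ContDiff ℝ ∞ φ ∧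
    (((p.1 : L2Pair Ω).fst : E d → ℝ) =ᵐ[volume.restrict Ω] φ) ∧
    (grad p.1 =ᵐ[volume.restrict Ω] gradient φ) ∧
    ((p.2 : E d → ℝ) =ᵐ[surface Ω] φ)}
  zero_mem' := by
    refine ⟨0, contDiff_const, Lp.coeFn_zero _ _ _, ?_, Lp.coeFn_zero _ _ _⟩
    filter_upwards [Lp.coeFn_zero (E d) 2 (volume.restrict Ω)] with x hx
    have : gradient (0 : E d → ℝ) x = 0 := gradient_fun_const x (0 : ℝ)
    rw [this]
    exact hx
  add_mem' := by
    rintro p q ⟨φ, hφ, h1, h2, h3⟩ ⟨ψ, hψ, k1, k2, k3⟩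
    refine ⟨φ + ψ, hφ.add hψ, (Lp.coeFn_add _ _).trans (h1.add k1), ?_,
      (Lp.coeFn_add _ _).trans (h3.add k3)⟩
    have hg : gradient (φ + ψ) = gradient φ + gradient ψ := by
      funext x
      simp only [gradient, Pi.add_apply]
      rw [fderiv_add (hφ.differentiable (by simp) x) (hψ.differentiable (by simp) x), map_add]
    rw [hg]
    exact (Lp.coeFn_add _ _).trans (h2.add k2)
  smul_mem' := by
    rintro a p ⟨φ, hφ, h1, h2, h3⟩
    refine ⟨a • φ, contDiff_const.smul hφ, (Lp.coeFn_smul _ _).trans (h1.const_smul a), ?_,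
      (Lp.coeFn_smul _ _).trans (h3.const_smul a)⟩
    have hg : gradient (a • φ) = a • gradient φ := by
      funext x
      simp only [gradient, Pi.smul_apply]
      rw [fderiv_const_smul (hφ.differentiable (by simp) x), map_smul]
    rw [hg]
    exact (Lp.coeFn_smul _ _).trans (h2.const_smul a)

/-- The graph of the trace operator: the closure in `H¹(Ω) × L²(∂Ω)` of the restrictions of smooth
functions. For a bounded Lipschitz domain it is the graph of the usual trace operator, the unique
continuous extension of `φ ↦ φ|_∂Ω` from `C^∞` to `H¹(Ω)`. -/
def traceGraph (Ω : Set (E d)) : Submodule ℝ (H1 Ω × Lp ℝ 2 (surface Ω)) :=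
  (smoothTraces Ω).topologicalClosure

/-- `H^{1/2}(∂Ω)`, the space of traces of functions in `H¹(Ω)`. -/
def HHalf (Ω : Set (E d)) : Submodule ℝ (Lp ℝ 2 (surface Ω)) :=
  (traceGraph Ω).map (LinearMap.snd ℝ (H1 Ω) (Lp ℝ 2 (surface Ω)))

/-- `T` is the trace of `u` on `∂Ω`. -/
def IsTrace {Ω : Set (E d)} (u : H1 Ω) (T : HHalf Ω) : Prop :=
  (u, (T : Lp ℝ 2 (surface Ω))) ∈ traceGraph Ω

/-- The trace on `∂Ω` of a function in `H¹(Ω)`. -/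
def trace {Ω : Set (E d)} (u : H1 Ω) : HHalf Ω := Classical.epsilon (IsTrace u)

/-- The function on `∂Ω` underlying an element of `H^{1/2}(∂Ω)`. -/
def bdryFun {Ω : Set (E d)} (T : HHalf Ω) : E d → ℝ :=
  ((T : Lp ℝ 2 (surface Ω)) : E d → ℝ)

/-- The norm of `H^{1/2}(∂Ω)`, the quotient norm of the trace operator. It is not the norm
of `L²(∂Ω)`. -/
def halfNorm {Ω : Set (E d)} (T : HHalf Ω) : ℝ := sInf {a | ∃ u : H1 Ω, IsTrace u T ∧ a = ‖u‖}

/-- `g` belongs to `H^{-1/2}_0(∂Ω)`: it is a bounded linear functional on `H^{1/2}(∂Ω)` that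
vanishes on constants. -/
structure MemHNegHalfZero {Ω : Set (E d)} (g : HHalf Ω →ₗ[ℝ] ℝ) : Prop where
  bounded : ∃ C : ℝ, ∀ T : HHalf Ω, |g T| ≤ C * halfNorm T
  const : ∀ T : HHalf Ω, bdryFun T =ᵐ[surface Ω] (fun _ => 1) → g T = 0

/-! ### State problem, adjoint problem and cost functional -/

/-- `u` is a weak solution of `-∇·(σ∇u) = 0` in `Ω`, `σ ∂u/∂ν = ℓ` on `∂Ω`. -/
def IsWeakNeumannSolution {Ω : Set (E d)} (σ : E d → ℝ) (ℓ : HHalf Ω → ℝ) (u : H1 Ω) : Prop :=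
  ∀ w : H1 Ω, ∫ x in Ω, σ x * inner ℝ (grad u x) (grad w x) = ℓ (trace w)

/-- `u` solves the state problem with conductivity `σ`, current `g`, and normalization
`∫_∂Ω u = ∫_∂Ω f`. -/
def IsState {Ω : Set (E d)} (σ : E d → ℝ) (g : HHalf Ω →ₗ[ℝ] ℝ) (f : HHalf Ω) (u : H1 Ω) : Prop :=
  IsWeakNeumannSolution σ g u ∧
    ∫ x, bdryFun (trace u) x ∂(surface Ω) = ∫ x, bdryFun f x ∂(surface Ω)

/-- `z` solves the adjoint problem: conductivity `σ`, boundary flux `f - u`, and normalization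
`∫_∂Ω z = ∫_∂Ω f`. -/
def IsAdjoint {Ω : Set (E d)} (σ : E d → ℝ) (f : HHalf Ω) (u z : H1 Ω) : Prop :=
  IsWeakNeumannSolution σ
      (fun T => ∫ x, (bdryFun f x - bdryFun (trace u) x) * bdryFun T x ∂(surface Ω)) z ∧
    ∫ x, bdryFun (trace z) x ∂(surface Ω) = ∫ x, bdryFun f x ∂(surface Ω)

/-- The solution of the state problem. -/
def state {Ω : Set (E d)} (σ : E d → ℝ) (g : HHalf Ω →ₗ[ℝ] ℝ) (f : HHalf Ω) : H1 Ω :=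
  Classical.epsilon (IsState σ g f)

/-- The least-squares functional `J(σ) = ½ ∑ j, ∫_∂Ω |u_j - f_j|² ds`. -/
def costJ {Ω : Set (E d)} {M : ℕ} (g : Fin M → HHalf Ω →ₗ[ℝ] ℝ) (f : Fin M → HHalf Ω)
    (σ : E d → ℝ) : ℝ :=
  (1 / 2) * ∑ j, ∫ x, |bdryFun (trace (state σ (g j) (f j))) x - bdryFun (f j) x| ^ 2 ∂(surface Ω)

/-! ### Velocity fields -/

/-- `U ∈ W^{1,∞}(ℝ^d; ℝ^d)` with weak Jacobian `DU`. -/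
structure IsW1Infty (U : E d → E d) (DU : E d → E d →L[ℝ] E d) : Prop where
  memLp : MemLp U ⊤ volume
  memLp_deriv : MemLp DU ⊤ volume
  weak_deriv : ∀ φ, IsTestFunction univ φ → ∀ v : E d,
    ∫ x, fderiv ℝ φ x v • U x = - ∫ x, φ x • DU x v

/-- The transformation `Φ_t(x) = x + t U(x)`. -/
def Phi (U : E d → E d) (t : ℝ) (x : E d) : E d := x + t • U x

/-- The transported conductivity `σ_t = σ ∘ Φ_t⁻¹`. -/
def transported (U : E d → E d) (σ : E d → ℝ) (t : ℝ) : E d → ℝ :=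
  σ ∘ Function.invFun (Phi U t)

/-- The matrix `𝒜 = div(U) I - (DU + DUᵀ)` formed from a Jacobian matrix `B = DU(x)`. -/
def calA (B : E d →L[ℝ] E d) : E d →L[ℝ] E d :=
  LinearMap.trace ℝ (E d) (B : E d →ₗ[ℝ] E d) • ContinuousLinearMap.id ℝ (E d)
    - (B + ContinuousLinearMap.adjoint B)

end ShapeEIT

end

open MeasureTheory Set Filter Topology
open scoped ContDiff NNReal ENNReal

noncomputable section

namespace ShapeEIT

variable {d : ℕ}

/-! ### Basic properties of `H¹(Ω)` -/

/-! Shortcut instances. -/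

-- The perturbed problem is pulled back to the reference configuration. Because `U` vanishes near
-- the boundary, `Φ_t` is for small `t` a bi-Lipschitz bijection of `Ω` onto itself that is the
-- identity near `∂Ω`. Hence `v_t = u_t ∘ Φ_t` has the same trace as the perturbed state `u_t`, and
-- the misfit can be evaluated with `v_t`. A change of variables turns the equation for `u_t` into
-- one with the same right-hand side and the coefficient `σ A(tDU)`, where `A(X) = |det(1+X)|
-- (1+X)⁻¹ (1+X)⁻ᵀ` (`setIntegral_transported`). The jumps of `σ` no longer move; only the matrix
-- depends on `t`. At `X = 0` one has `A(X) = 1 + (tr X - X - Xᵀ) + o(X)` (`pullCoeff_expansion`),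
-- and since `DU` is essentially bounded this holds uniformly in `x`: the multiplication operators
-- on `L²` satisfy `S_t = T + tD + o(t)` in operator norm, with `D` the multiplication by `σ𝒜`
-- (`exists_pulledBack_op`).
--
-- The rest is Hilbert space algebra (`abs_misfit_sub_le`). Put `R = S_t - T` and `δ = v_t - u`.
-- Expanding the square and testing the adjoint equation with `δ` gives the misfit change `-⟨T∇z,
-- ∇δ⟩ + ½‖δ|_∂Ω‖²`. Subtracting the two state equations and testing with `z` replaces the first
-- term by `⟨R∇u, ∇z⟩ + ⟨R∇δ, ∇z⟩`. Coercivity gives `δ = O(‖R‖)`, so everything except `⟨R∇u, ∇z⟩`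
-- is quadratic in `R`. The derivative of `t ↦ v_t` is never needed.
--
-- The analytic prerequisites come from two geometric facts about a Lipschitz domain, the local
-- graph description and the interior cone property: density of smooth functions (`dense_smooth`),
-- the trace inequality and the trace operator (`exists_traceOp`), and a Poincaré inequality with
-- the boundary mean (`norm_le_gradL_add_bdryMean`). The last one and the Lax–Milgram lemma yield
-- well-posedness (`existsUnique_neumann`). The field `U` is Lipschitz with classical derivative
-- `DU` almost everywhere (`ae_hasFDerivAt`), which justifies the chain rule in `H¹` and the change
-- of variables. The polytopes enter through their null boundaries: they cover `Ω` up to a null set,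
-- so `σ` is bounded and bounded below almost everywhere.

scoped instance (Ω : Set (E d)) : AddCommGroup (H1 Ω) := (H1 Ω).addCommGroup

scoped instance (Ω : Set (E d)) : Module ℝ (H1 Ω) := (H1 Ω).module

scoped instance (Ω : Set (E d)) : SMul ℝ (H1 Ω) := (H1 Ω).smul

scoped instance (Ω : Set (E d)) : NormedAddCommGroup (H1 Ω) := (H1 Ω).normedAddCommGroup

scoped instance (Ω : Set (E d)) : NormedSpace ℝ (H1 Ω) := (H1 Ω).normedSpace

scoped instance (Ω : Set (E d)) : InnerProductSpace ℝ (H1 Ω) := (H1 Ω).innerProductSpace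

/-- The function underlying an element of `H¹(Ω)`. -/
def val {Ω : Set (E d)} (u : H1 Ω) : E d → ℝ := ((u : L2Pair Ω).fst : E d → ℝ)

theorem memLp_val {Ω : Set (E d)} (u : H1 Ω) : MemLp (val u) 2 (volume.restrict Ω) :=
  Lp.memLp _

theorem memLp_grad {Ω : Set (E d)} (u : H1 Ω) : MemLp (grad u) 2 (volume.restrict Ω) :=
  Lp.memLp _

theorem hasWeakGradient {Ω : Set (E d)} (u : H1 Ω) : HasWeakGradient Ω (val u) (grad u) :=
  u.2

theorem HasWeakGradient.congr {Ω : Set (E d)} {u u' : E d → ℝ} {G G' : E d → E d}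
    (h : HasWeakGradient Ω u G) (hu : u =ᵐ[volume.restrict Ω] u')
    (hG : G =ᵐ[volume.restrict Ω] G') : HasWeakGradient Ω u' G' := by
  intro φ hφ v
  have h1 : ∫ x in Ω, u' x * fderiv ℝ φ x v = ∫ x in Ω, u x * fderiv ℝ φ x v := by
    apply integral_congr_ae
    filter_upwards [hu] with x hx
    rw [hx]
  have h2 : ∫ x in Ω, φ x * inner ℝ (G' x) v = ∫ x in Ω, φ x * inner ℝ (G x) v := by
    apply integral_congr_ae
    filter_upwards [hG] with x hx
    rw [hx]
  rw [h1, h2, h φ hφ v]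

/-- The element of `H¹(Ω)` given by a function and its weak gradient. -/
def mkH1 {Ω : Set (E d)} (u : E d → ℝ) (G : E d → E d) (hu : MemLp u 2 (volume.restrict Ω))
    (hG : MemLp G 2 (volume.restrict Ω)) (h : HasWeakGradient Ω u G) : H1 Ω :=
  ⟨WithLp.toLp 2 (hu.toLp u, hG.toLp G),
    h.congr hu.coeFn_toLp.symm hG.coeFn_toLp.symm⟩

theorem val_mkH1 {Ω : Set (E d)} {u : E d → ℝ} {G : E d → E d}
    (hu : MemLp u 2 (volume.restrict Ω))
    (hG : MemLp G 2 (volume.restrict Ω)) (h : HasWeakGradient Ω u G) :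
    val (mkH1 u G hu hG h) =ᵐ[volume.restrict Ω] u := hu.coeFn_toLp

theorem grad_mkH1 {Ω : Set (E d)} {u : E d → ℝ} {G : E d → E d}
    (hu : MemLp u 2 (volume.restrict Ω))
    (hG : MemLp G 2 (volume.restrict Ω)) (h : HasWeakGradient Ω u G) :
    grad (mkH1 u G hu hG h) =ᵐ[volume.restrict Ω] G := hG.coeFn_toLp

theorem val_add {Ω : Set (E d)} (u w : H1 Ω) :
    val (u + w) =ᵐ[volume.restrict Ω] val u + val w := Lp.coeFn_add _ _

theorem val_sub {Ω : Set (E d)} (u w : H1 Ω) :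
    val (u - w) =ᵐ[volume.restrict Ω] val u - val w := Lp.coeFn_sub _ _

theorem grad_sub {Ω : Set (E d)} (u w : H1 Ω) :
    grad (u - w) =ᵐ[volume.restrict Ω] grad u - grad w := Lp.coeFn_sub _ _

theorem norm_le_of_eLpNorm_le {Ω : Set (E d)} (u : H1 Ω) {a b : ℝ}
    (ha : eLpNorm (val u) 2 (volume.restrict Ω) ≤ ENNReal.ofReal a)
    (hb : eLpNorm (grad u) 2 (volume.restrict Ω) ≤ ENNReal.ofReal b) (ha0 : 0 ≤ a) (hb0 : 0 ≤ b) :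
    ‖u‖ ≤ a + b := by
  have h1 : ‖(u : L2Pair Ω).fst‖ ≤ a := by
    rw [Lp.norm_def]
    exact ENNReal.toReal_le_of_le_ofReal ha0 ha
  have h2 : ‖(u : L2Pair Ω).snd‖ ≤ b := by
    rw [Lp.norm_def]
    exact ENNReal.toReal_le_of_le_ofReal hb0 hb
  refine abs_le_of_sq_le_sq' ?_ (by positivity) |>.2
  change ‖(u : L2Pair Ω)‖ ^ 2 ≤ _
  rw [WithLp.prod_norm_sq_eq_of_L2]
  nlinarith [norm_nonneg (u : L2Pair Ω).fst, norm_nonneg (u : L2Pair Ω).snd]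

theorem IsTestFunction.memLp_smul_const {Ω : Set (E d)} {φ : E d → ℝ} (h : IsTestFunction Ω φ)
    (v : E d) : MemLp (fun x => φ x • v) 2 (volume.restrict Ω) :=
  (h.contDiff.continuous.smul continuous_const).memLp_of_hasCompactSupport
    h.hasCompactSupport.smul_right

/-- Each pair of a test function and a direction imposes the vanishing of one continuous linear
functional on the `L²` pair, so the space is an intersection of closed hyperplanes or the whole
space. Completeness is what Lax–Milgram and the density arguments rest on. -/
theorem isClosed_H1 (Ω : Set (E d)) : IsClosed (H1 Ω : Set (L2Pair Ω)) := by
  have : (H1 Ω : Set (L2Pair Ω)) = ⋂ (φ : {φ : E d → ℝ // IsTestFunction Ω φ}) (v : E d),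
      {p | inner ℝ ((φ.2.memLp_fderiv v).toLp _) p.fst
        + inner ℝ ((φ.2.memLp_smul_const v).toLp _) p.snd = 0} := by
    ext p
    simp only [mem_iInter, Subtype.forall, mem_ofPred_eq, SetLike.mem_coe]
    change (∀ φ, IsTestFunction Ω φ → ∀ v : E d, _) ↔ _
    refine forall_congr' fun φ => forall_congr' fun hφ => forall_congr' fun v => ?_
    have h1 : inner ℝ ((hφ.memLp_fderiv v).toLp _) p.fst
        = ∫ x in Ω, p.fst x * fderiv ℝ φ x v := by
      rw [L2.inner_def]
      apply integral_congr_ae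
      filter_upwards [(hφ.memLp_fderiv v).coeFn_toLp] with x hx
      rw [hx]
      simp
    have h2 : inner ℝ ((hφ.memLp_smul_const v).toLp _) p.snd
        = ∫ x in Ω, φ x * inner ℝ (p.snd x) v := by
      rw [L2.inner_def]
      apply integral_congr_ae
      filter_upwards [(hφ.memLp_smul_const v).coeFn_toLp] with x hx
      rw [hx, real_inner_smul_left, real_inner_comm]
    rw [h1, h2, eq_neg_iff_add_eq_zero]
  rw [this]
  refine isClosed_iInter fun φ => isClosed_iInter fun v => isClosed_eq ?_ continuous_const
  have c1 : Continuous fun p : L2Pair Ω => p.fst :=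
    (WithLp.prod_continuous_ofLp 2 _ _).fst
  have c2 : Continuous fun p : L2Pair Ω => p.snd :=
    (WithLp.prod_continuous_ofLp 2 _ _).snd
  exact (continuous_const.inner c1).add (continuous_const.inner c2)

instance completeSpace_H1 (Ω : Set (E d)) : CompleteSpace (H1 Ω) :=
  (isClosed_H1 Ω).completeSpace_coe

/-- The fundamental lemma of the calculus of variations applies to each component of `G - G'`, which
is locally integrable because it lies in `L²`. -/
theorem HasWeakGradient.ae_unique {Ω : Set (E d)} (hΩ : IsOpen Ω) {u : E d → ℝ} {G G' : E d → E d}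
    (hG : MemLp G 2 (volume.restrict Ω)) (hG' : MemLp G' 2 (volume.restrict Ω))
    (h : HasWeakGradient Ω u G) (h' : HasWeakGradient Ω u G') :
    G =ᵐ[volume.restrict Ω] G' := by
  have key : ∀ v : E d, ∀ᵐ x ∂(volume.restrict Ω), inner ℝ (G x) v = inner ℝ (G' x) v := by
    intro v
    rw [ae_restrict_iff' hΩ.measurableSet]
    have hloc : LocallyIntegrableOn (fun x => inner ℝ (G x) v - inner ℝ (G' x) v) Ω volume := by
      have hm : MemLp (fun x => inner ℝ (G x) v - inner ℝ (G' x) v) 2 (volume.restrict Ω) :=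
        (hG.inner_const v).sub (hG'.inner_const v)
      rw [locallyIntegrableOn_iff hΩ.isLocallyClosed]
      intro k hk hkc
      have : IsFiniteMeasure (volume.restrict k) := ⟨by simpa using hkc.measure_lt_top⟩
      exact (hm.mono_measure (Measure.restrict_mono hk le_rfl)).integrable (by norm_num)
    have := hΩ.ae_eq_zero_of_integral_contDiff_smul_eq_zero hloc ?_
    · filter_upwards [this] with x hx hxΩ
      exact sub_eq_zero.1 (hx hxΩ)
    intro φ h1 h2 h3
    have hφ : IsTestFunction Ω φ := ⟨h1, h2, h3⟩
    have e : ∫ x, φ x • (inner ℝ (G x) v - inner ℝ (G' x) v)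
        = ∫ x in Ω, φ x • (inner ℝ (G x) v - inner ℝ (G' x) v) := by
      symm
      apply setIntegral_eq_integral_of_forall_compl_eq_zero
      intro x hx
      rw [image_eq_zero_of_notMem_tsupport (fun hx' => hx (h3 hx')), zero_smul]
    rw [e]
    simp only [smul_eq_mul, mul_sub]
    have i1 : Integrable (fun x => φ x * inner ℝ (G x) v) (volume.restrict Ω) :=
      hφ.memLp.integrable_mul (hG.inner_const v)
    have i2 : Integrable (fun x => φ x * inner ℝ (G' x) v) (volume.restrict Ω) :=
      hφ.memLp.integrable_mul (hG'.inner_const v)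
    rw [integral_sub i1 i2]
    have a := h φ hφ v
    have b := h' φ hφ v
    linarith
  have hall : ∀ᵐ x ∂(volume.restrict Ω), ∀ i : Fin d,
      inner ℝ (G x) (EuclideanSpace.single i (1 : ℝ))
        = inner ℝ (G' x) (EuclideanSpace.single i (1 : ℝ)) := ae_all_iff.2 fun i => key _
  filter_upwards [hall] with x hx
  ext i
  simpa [EuclideanSpace.inner_single_right] using hx i

/-- Since the function determines its weak gradient, identities in `H¹` can be checked on functions
alone. -/
theorem H1.ext {Ω : Set (E d)} (hΩ : IsOpen Ω) {u w : H1 Ω}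
    (h : val u =ᵐ[volume.restrict Ω] val w) : u = w := by
  have hg : grad u =ᵐ[volume.restrict Ω] grad w :=
    HasWeakGradient.ae_unique hΩ (memLp_grad u) (memLp_grad w) (hasWeakGradient u)
      ((hasWeakGradient w).congr h.symm (ae_eq_refl _))
  apply Subtype.ext
  apply WithLp.ofLp_injective
  exact Prod.ext (Lp.ext h) (Lp.ext hg)

/-- Multiplication by a smooth compactly supported function on the level of weak gradients. -/
theorem HasWeakGradient.mul_smooth {Ω : Set (E d)} {u : E d → ℝ} {G : E d → E d}
    (hu : MemLp u 2 (volume.restrict Ω))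
    (h : HasWeakGradient Ω u G) (hG : MemLp G 2 (volume.restrict Ω)) {χ : E d → ℝ}
    (hχ : ContDiff ℝ ∞ χ) :
    HasWeakGradient Ω (fun x => χ x * u x) (fun x => χ x • G x + u x • gradient χ x) := by
  intro φ hφ v
  have hχd : Differentiable ℝ χ := hχ.differentiable (by simp)
  have hφd : Differentiable ℝ φ := hφ.contDiff.differentiable (by simp)
  have hprod : IsTestFunction Ω (fun x => χ x * φ x) :=
    ⟨hχ.mul hφ.contDiff, hφ.hasCompactSupport.mul_left,
      (closure_mono (Function.support_mul_subset_right _ _)).trans hφ.tsupport_subset⟩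
  have hd : ∀ x, fderiv ℝ (fun x => χ x * φ x) x v = χ x * fderiv ℝ φ x v
      + φ x * fderiv ℝ χ x v := by
    intro x
    rw [fderiv_fun_mul (hχd x) (hφd x)]
    simp
  -- The equation for `u` is tested with `χφ`. The product rule splits off `u φ ∂ᵥχ`, which becomes
  -- the second term of the new gradient.
  have e := h _ hprod v
  simp only [hd] at e
  have t2 : IsTestFunction Ω (fun x => fderiv ℝ χ x v * φ x) :=
    ⟨((hχ.fderiv_right (m := ∞) (by simp)).clm_apply contDiff_const).mul hφ.contDiff,
      hφ.hasCompactSupport.mul_left,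
      (closure_mono (Function.support_mul_subset_right _ _)).trans hφ.tsupport_subset⟩
  have i1 : Integrable (fun x => u x * (χ x * fderiv ℝ φ x v)) (volume.restrict Ω) := by
    refine hu.integrable_mul (p := 2) (q := 2) ?_
    have hc : Continuous (fun x => χ x * fderiv ℝ φ x v) := hχ.continuous.mul
      ((hφ.contDiff.continuous_fderiv (by simp)).clm_apply continuous_const)
    exact hc.memLp_of_hasCompactSupport ((hφ.hasCompactSupport.fderiv_apply ℝ v).mul_left)
  have i2 : Integrable (fun x => u x * (φ x * fderiv ℝ χ x v)) (volume.restrict Ω) := by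
    refine hu.integrable_mul (p := 2) (q := 2) ?_
    simpa only [mul_comm] using t2.memLp
  have i3 : Integrable (fun x => χ x * φ x * inner ℝ (G x) v) (volume.restrict Ω) :=
    hprod.memLp.integrable_mul (hG.inner_const v)
  have e1 : ∫ x in Ω, u x * (χ x * fderiv ℝ φ x v + φ x * fderiv ℝ χ x v)
      = (∫ x in Ω, u x * (χ x * fderiv ℝ φ x v)) + ∫ x in Ω, u x * (φ x * fderiv ℝ χ x v) := by
    rw [← integral_add i1 i2]
    simp only [mul_add]
  have hgr : ∀ x, inner ℝ (gradient χ x) v = fderiv ℝ χ x v := by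
    intro x
    simp [gradient]
  have e2 : ∫ x in Ω, φ x * inner ℝ (χ x • G x + u x • gradient χ x) v
      = (∫ x in Ω, χ x * φ x * inner ℝ (G x) v) + ∫ x in Ω, u x * (φ x * fderiv ℝ χ x v) := by
    rw [← integral_add i3 i2]
    congr 1
    funext x
    rw [inner_add_left, real_inner_smul_left, real_inner_smul_left, hgr]
    ring
  have e3 : ∫ x in Ω, χ x * u x * fderiv ℝ φ x v = ∫ x in Ω, u x * (χ x * fderiv ℝ φ x v) := by
    congr 1
    funext x
    ring
  rw [e3, e2]
  linarith

/-! ### Geometry of Lipschitz domains -/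

/-- The orthogonal projection onto the hyperplane with normal `ν`. -/
abbrev projPerp (ν : E d) : E d →L[ℝ] (Submodule.span ℝ {ν})ᗮ :=
  (Submodule.span ℝ {ν})ᗮ.orthogonalProjectionOnto

theorem projPerp_add_smul (ν : E d) (y : E d) (s : ℝ) :
    projPerp ν (y + s • ν) = projPerp ν y := by
  have h : projPerp ν ν = 0 := by
    apply Submodule.orthogonalProjectionOnto_apply_of_mem_orthogonal
    rw [Submodule.orthogonal_orthogonal]
    exact Submodule.mem_span_singleton_self ν
  rw [map_add, map_smul, h, smul_zero, add_zero]

theorem inner_add_smul {ν : E d} (hν : ‖ν‖ = 1) (y : E d) (s : ℝ) :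
    inner ℝ ν (y + s • ν) = inner ℝ ν y + s := by
  rw [inner_add_right, real_inner_smul_right, real_inner_self_eq_norm_sq, hν]
  ring

theorem projPerp_add_inner_smul {ν : E d} (hν : ‖ν‖ = 1) (y : E d) :
    (projPerp ν y : E d) + (inner ℝ ν y) • ν = y := by
  have h := Submodule.starProjection_add_starProjection_orthogonal (K := Submodule.span ℝ {ν}) y
  rw [Submodule.starProjection_unit_singleton ℝ hν] at h
  rw [add_comm]
  exact h

theorem norm_projPerp_sub_le (ν y z : E d) : ‖projPerp ν y - projPerp ν z‖ ≤ ‖y - z‖ := by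
  rw [← map_sub]
  exact Submodule.norm_orthogonalProjectionOnto_apply_le _ _

/-- A local description of `Ω` near a boundary point as an epigraph. -/
structure IsPatch (Ω : Set (E d)) (x ν : E d) (γ : (Submodule.span ℝ {ν})ᗮ → ℝ) (K : ℝ≥0)
    (r : ℝ) : Prop where
  norm_eq : ‖ν‖ = 1
  lip : LipschitzWith K γ
  pos : 0 < r
  mem_iff : ∀ y ∈ Metric.ball x r, (y ∈ Ω ↔ γ (projPerp ν y) < inner ℝ ν y)

theorem IsLipschitzDomain.exists_patch {Ω : Set (E d)} (hΩ : IsLipschitzDomain Ω) {x : E d}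
    (hx : x ∈ frontier Ω) : ∃ (ν : E d) (γ : (Submodule.span ℝ {ν})ᗮ → ℝ) (K : ℝ≥0) (r : ℝ),
      IsPatch Ω x ν γ K r := by
  obtain ⟨ν, γ, K, r, h1, h2, h3, h4⟩ := hΩ.graph x hx
  exact ⟨ν, γ, K, r, h1, h2, h3, h4⟩

namespace IsPatch

variable {Ω : Set (E d)} {x ν : E d} {γ : (Submodule.span ℝ {ν})ᗮ → ℝ} {K : ℝ≥0} {r : ℝ}

/-- The strict opposite inequality is an open condition, so it would also hold at points of `Ω` near
`y`. -/
theorem le_of_mem_closure (h : IsPatch Ω x ν γ K r) {y : E d} (hy : y ∈ Metric.ball x r)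
    (hyc : y ∈ closure Ω) : γ (projPerp ν y) ≤ inner ℝ ν y := by
  by_contra hcon
  push Not at hcon
  have hopen : IsOpen {z : E d | inner ℝ ν z < γ (projPerp ν z)} :=
    isOpen_lt (continuous_const.inner continuous_id)
      (h.lip.continuous.comp (projPerp ν).continuous)
  obtain ⟨z, ⟨hz1, hz2⟩, hz3⟩ := mem_closure_iff.1 hyc _ (hopen.inter Metric.isOpen_ball) ⟨hcon, hy⟩
  exact absurd ((h.mem_iff z hz2).1 hz3) (not_lt.2 (le_of_lt hz1))

theorem eq_of_mem_frontier (hΩ : IsOpen Ω) (h : IsPatch Ω x ν γ K r) {y : E d}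
    (hy : y ∈ Metric.ball x r) (hyf : y ∈ frontier Ω) : γ (projPerp ν y) = inner ℝ ν y := by
  refine le_antisymm (h.le_of_mem_closure hy (frontier_subset_closure hyf)) ?_
  rw [hΩ.frontier_eq] at hyf
  exact not_lt.1 fun hlt => hyf.2 ((h.mem_iff y hy).2 hlt)

/-- Moving up by `s` gains height `s`; a further displacement of size `δs` loses at most `δs` in
height and raises the graph by at most `Kδs`. With `δ = 1/(K+2)` one has `(K+1)δ < 1`, so the point
stays strictly above the graph. The radius `r/3` leaves room for the three displacements inside the
ball of radius `r`. -/
theorem closedBall_subset (h : IsPatch Ω x ν γ K r) {y : E d} {s : ℝ}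
    (hy : y ∈ Metric.ball x (r / 3)) (hyc : y ∈ closure Ω) (hs : 0 < s) (hsr : s < r / 3) :
    Metric.closedBall (y + s • ν) ((1 / (K + 2)) * s) ⊆ Ω := by
  intro w hw
  have hK : (0 : ℝ) ≤ K := K.2
  have hr := h.pos
  set δ : ℝ := 1 / (K + 2) with hδ
  have hδ1 : δ * (K + 2) = 1 := by rw [hδ]; field_simp
  have hδ0 : 0 < δ := by positivity
  have hw' : ‖w - (y + s • ν)‖ ≤ δ * s := by simpa [dist_eq_norm] using hw
  have hδs : δ * s ≤ s := by nlinarith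
  have hy' : ‖y - x‖ < r / 3 := by simpa [dist_eq_norm] using hy
  have hwr : w ∈ Metric.ball x r := by
    rw [Metric.mem_ball, dist_eq_norm]
    have e : w - x = (w - (y + s • ν)) + (y - x) + s • ν := by abel
    rw [e]
    calc _ ≤ ‖w - (y + s • ν)‖ + ‖y - x‖ + ‖s • ν‖ := norm_add₃_le
      _ < r := by rw [norm_smul, h.norm_eq, Real.norm_of_nonneg hs.le]; linarith
  have hyr : y ∈ Metric.ball x r := Metric.ball_subset_ball (by linarith) hy
  rw [h.mem_iff w hwr]
  have a1 := h.le_of_mem_closure hyr hyc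
  have a2 : γ (projPerp ν w) - γ (projPerp ν y) ≤ K * (δ * s) := by
    have := h.lip.dist_le_mul (projPerp ν w) (projPerp ν y)
    rw [dist_eq_norm, dist_eq_norm] at this
    have h2 := norm_projPerp_sub_le ν w (y + s • ν)
    rw [projPerp_add_smul] at h2
    calc _ ≤ ‖γ (projPerp ν w) - γ (projPerp ν y)‖ := le_abs_self _
      _ ≤ _ := this
      _ ≤ _ := by gcongr; linarith
  have a3 : inner ℝ ν y + s - δ * s ≤ inner ℝ ν w := by
    have e : w = (y + s • ν) + (w - (y + s • ν)) := by abel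
    have : |inner ℝ ν (w - (y + s • ν))| ≤ δ * s := by
      refine (abs_real_inner_le_norm _ _).trans ?_
      rw [h.norm_eq, one_mul]
      exact hw'
    rw [e, inner_add_right, inner_add_smul h.norm_eq]
    linarith [(abs_le.1 this).1]
  nlinarith

end IsPatch

/-- The uniform interior cone property of a Lipschitz domain. -/
theorem IsLipschitzDomain.exists_cone {Ω : Set (E d)} (hΩ : IsLipschitzDomain Ω) {x : E d}
    (hx : x ∈ closure Ω) : ∃ ν : E d, ‖ν‖ ≤ 1 ∧ ∃ ε > 0, ∃ δ > 0, ∀ y ∈ Metric.ball x ε,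
      y ∈ closure Ω → ∀ s : ℝ, 0 < s → s < ε → Metric.closedBall (y + s • ν) (δ * s) ⊆ Ω := by
  by_cases hxΩ : x ∈ Ω
  · obtain ⟨ε, hε, hb⟩ := Metric.isOpen_iff.1 hΩ.isOpen x hxΩ
    -- At an interior point no direction is needed; allowing `ν = 0` lets interior and boundary
    -- points be treated alike later.
    refine ⟨0, by simp, ε / 2, by positivity, 1, one_pos, fun y hy _ s hs hsε => ?_⟩
    rw [smul_zero, add_zero, one_mul]
    refine (fun z hz => hb ?_)
    rw [Metric.mem_ball] at hy ⊢
    rw [Metric.mem_closedBall] at hz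
    linarith [dist_triangle z y x]
  · have hf : x ∈ frontier Ω := by rw [hΩ.isOpen.frontier_eq]; exact ⟨hx, hxΩ⟩
    obtain ⟨ν, γ, K, r, h⟩ := hΩ.exists_patch hf
    have hr := h.pos
    exact ⟨ν, h.norm_eq.le, r / 3, by positivity, 1 / (K + 2), by positivity,
      fun y hy hyc s hs hsr => h.closedBall_subset hy hyc hs hsr⟩

/-! ### Hausdorff measure on Lipschitz graphs -/

theorem euclideanHausdorffMeasure_image_le {X Y : Type*} [EMetricSpace X] [EMetricSpace Y]
    [MeasurableSpace X] [BorelSpace X] [MeasurableSpace Y] [BorelSpace Y] {K : ℝ≥0} {f : X → Y}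
    (hf : LipschitzWith K f) (n : ℕ) (s : Set X) :
    (μHE[n] : Measure Y) (f '' s) ≤ (K : ℝ≥0∞) ^ n * (μHE[n] : Measure X) s := by
  rw [Measure.euclideanHausdorffMeasure_def, Measure.euclideanHausdorffMeasure_def,
    Measure.smul_apply, Measure.smul_apply]
  have := hf.hausdorffMeasure_image_le (d := n) (by positivity) s
  rw [ENNReal.rpow_natCast] at this
  rw [ENNReal.smul_def, smul_eq_mul, ENNReal.smul_def, smul_eq_mul]
  calc _ ≤ _ * ((K : ℝ≥0∞) ^ n * μH[n] s) := by gcongr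
    _ = _ := by ring

theorem finrank_perp {ν : E d} (hν : ‖ν‖ = 1) :
    Module.finrank ℝ (Submodule.span ℝ {ν})ᗮ = d - 1 := by
  have h := Submodule.finrank_add_finrank_orthogonal (Submodule.span ℝ {ν})
  rw [finrank_span_singleton (by rintro rfl; simp at hν), finrank_euclideanSpace_fin] at h
  omega

theorem isAddHaarMeasure_perp {ν : E d} (hν : ‖ν‖ = 1) :
    (μHE[d - 1] : Measure (Submodule.span ℝ {ν})ᗮ).IsAddHaarMeasure := by
  rw [← finrank_perp hν]
  infer_instance

/-- Coordinates along and orthogonal to a unit vector. -/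
def perpProdEquiv {ν : E d} (hν : ‖ν‖ = 1) : ((Submodule.span ℝ {ν})ᗮ × ℝ) ≃L[ℝ] E d :=
  LinearEquiv.toContinuousLinearEquiv
    { toFun := fun p => (p.1 : E d) + p.2 • ν
      map_add' := fun p q => by
        simp only [Prod.fst_add, Submodule.coe_add, Prod.snd_add, add_smul]
        abel
      map_smul' := fun a p => by
        simp [smul_smul]
      invFun := fun y => (projPerp ν y, inner ℝ ν y)
      left_inv := fun p => by
        have h0 : inner ℝ ν (p.1 : E d) = 0 :=
          Submodule.mem_orthogonal_singleton_iff_inner_right.1 p.1.2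
        refine Prod.ext ?_ ?_
        · change projPerp ν ((p.1 : E d) + p.2 • ν) = p.1
          rw [projPerp_add_smul]
          exact Submodule.orthogonalProjectionOnto_mem_subspace_eq_self p.1
        · change inner ℝ ν ((p.1 : E d) + p.2 • ν) = p.2
          rw [inner_add_smul hν, h0, zero_add]
      right_inv := fun y => projPerp_add_inner_smul hν y }

/-- The product of Haar measures on the hyperplane and the line is carried to a Haar measure on the
whole space, hence to a multiple of Lebesgue measure. Only estimates follow from this, so the factor
is not computed. -/
theorem lintegral_perp_lintegral {ν : E d} (hν : ‖ν‖ = 1) : ∃ c : ℝ≥0, ∀ f : E d → ℝ≥0∞,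
    Measurable f → ∫⁻ w : (Submodule.span ℝ {ν})ᗮ, (∫⁻ s : ℝ, f ((w : E d) + s • ν)) ∂(μHE[d - 1])
      = c * ∫⁻ y, f y := by
  have := isAddHaarMeasure_perp hν
  set μ : Measure (E d) := Measure.map (perpProdEquiv hν)
    ((μHE[d - 1] : Measure (Submodule.span ℝ {ν})ᗮ).prod volume) with hμ
  have hH : μ.IsAddHaarMeasure := (perpProdEquiv hν).isAddHaarMeasure_map _
  refine ⟨μ.addHaarScalarFactor volume, fun f hf => ?_⟩
  have e := Measure.isAddLeftInvariant_eq_smul μ (volume : Measure (E d))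
  have e2 : ∫⁻ y, f y ∂μ = (μ.addHaarScalarFactor volume : ℝ≥0∞) * ∫⁻ y, f y := by
    conv_lhs => rw [e]
    rw [lintegral_smul_measure]
    rfl
  rw [← e2, hμ, lintegral_map hf (perpProdEquiv hν).continuous.measurable]
  exact (lintegral_prod (fun p => f (perpProdEquiv hν p))
    (hf.comp (perpProdEquiv hν).continuous.measurable).aemeasurable).symm

namespace IsPatch

variable {Ω : Set (E d)} {x ν : E d} {γ : (Submodule.span ℝ {ν})ᗮ → ℝ} {K : ℝ≥0} {r : ℝ}

/-- The graph parametrization of the boundary. -/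
def graphMap (ν : E d) (γ : (Submodule.span ℝ {ν})ᗮ → ℝ) (w : (Submodule.span ℝ {ν})ᗮ) : E d :=
  (w : E d) + γ w • ν

theorem lipschitz_graphMap (h : IsPatch Ω x ν γ K r) : LipschitzWith (1 + K) (graphMap ν γ) := by
  refine LipschitzWith.add (LipschitzWith.subtype_val _) ?_
  refine LipschitzWith.of_dist_le_mul fun a b => ?_
  rw [dist_eq_norm, ← sub_smul, norm_smul, h.norm_eq, mul_one, ← dist_eq_norm]
  exact h.lip.dist_le_mul a b

/-- Boundary points in the patch lie on the graph and are recovered from their projections, so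
boundary sets are covered by Lipschitz images of hyperplane sets. -/
theorem restrict_frontier_le (hΩ : IsOpen Ω) (h : IsPatch Ω x ν γ K r) :
    (μHE[d - 1] : Measure (E d)).restrict (frontier Ω ∩ Metric.ball x r)
      ≤ ((1 + K : ℝ≥0) : ℝ≥0∞) ^ (d - 1) • Measure.map (graphMap ν γ) μHE[d - 1] := by
  have hm : Measurable (graphMap ν γ) := h.lipschitz_graphMap.continuous.measurable
  refine Measure.le_iff.2 fun A hA => ?_
  rw [Measure.restrict_apply hA, Measure.smul_apply, Measure.map_apply hm hA, smul_eq_mul]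
  refine le_trans (measure_mono ?_) (euclideanHausdorffMeasure_image_le h.lipschitz_graphMap _ _)
  rintro y ⟨hyA, hyf, hyb⟩
  have e : graphMap ν γ (projPerp ν y) = y := by
    rw [graphMap, h.eq_of_mem_frontier hΩ hyb hyf, projPerp_add_inner_smul h.norm_eq]
  exact ⟨projPerp ν y, by rw [mem_preimage, e]; exact hyA, e⟩

/-- The geometric half of the trace inequality: vertical segments of length `r/3` issuing from the
boundary stay in `Ω`, and in graph coordinates their integrals add up, by Fubini, to at most a
multiple of a volume integral. -/
theorem lintegral_strip_le (hΩ : IsOpen Ω) (h : IsPatch Ω x ν γ K r) : ∃ C : ℝ≥0,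
    ∀ F : E d → ℝ≥0∞, Measurable F →
      ∫⁻ y in frontier Ω ∩ Metric.ball x (r / 3), (∫⁻ s in Ioo 0 (r / 3), F (y + s • ν))
        ∂(μHE[d - 1]) ≤ C * ∫⁻ y in Ω, F y := by
  obtain ⟨c, hc⟩ := lintegral_perp_lintegral h.norm_eq
  refine ⟨(1 + K) ^ (d - 1) * c, fun F hF => ?_⟩
  have hr := h.pos
  set f : E d → ℝ≥0∞ := Ω.indicator F with hf
  have hfm : Measurable f := hF.indicator hΩ.measurableSet
  have hm : Measurable (graphMap ν γ) := h.lipschitz_graphMap.continuous.measurable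
  have hmeas : Measurable fun y : E d => ∫⁻ s : ℝ, f (y + s • ν) :=
    Measurable.lintegral_prod_right' (f := fun p : E d × ℝ => f (p.1 + p.2 • ν))
      (hfm.comp (by fun_prop))
  calc _ ≤ ∫⁻ y in frontier Ω ∩ Metric.ball x (r / 3), (∫⁻ s : ℝ, f (y + s • ν)) ∂(μHE[d - 1]) := by
        refine setLIntegral_mono hmeas fun y hy => ?_
        rw [← lintegral_indicator measurableSet_Ioo]
        refine lintegral_mono fun s => ?_
        by_cases hs : s ∈ Ioo 0 (r / 3)
        · rw [indicator_of_mem hs, hf, indicator_of_mem]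
          refine h.closedBall_subset hy.2 (frontier_subset_closure hy.1) hs.1 hs.2 ?_
          refine Metric.mem_closedBall_self ?_
          have := hs.1
          positivity
        · rw [indicator_of_notMem hs]
          exact zero_le
    _ ≤ ∫⁻ y in frontier Ω ∩ Metric.ball x r, (∫⁻ s : ℝ, f (y + s • ν)) ∂(μHE[d - 1]) := by
        refine lintegral_mono' (Measure.restrict_mono ?_ le_rfl) le_rfl
        exact inter_subset_inter_right _ (Metric.ball_subset_ball (by linarith))
    _ ≤ ∫⁻ y, (∫⁻ s : ℝ, f (y + s • ν))
          ∂(((1 + K : ℝ≥0) : ℝ≥0∞) ^ (d - 1) • Measure.map (graphMap ν γ) μHE[d - 1]) :=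
        lintegral_mono' (h.restrict_frontier_le hΩ) le_rfl
    _ = ((1 + K : ℝ≥0) : ℝ≥0∞) ^ (d - 1) *
          ∫⁻ w, (∫⁻ s : ℝ, f (graphMap ν γ w + s • ν)) ∂(μHE[d - 1]) := by
        rw [lintegral_smul_measure, lintegral_map hmeas hm, smul_eq_mul]
    _ = ((1 + K : ℝ≥0) : ℝ≥0∞) ^ (d - 1) *
          ∫⁻ w : (Submodule.span ℝ {ν})ᗮ, (∫⁻ s : ℝ, f ((w : E d) + s • ν)) ∂(μHE[d - 1]) := by
        congr 1
        refine lintegral_congr fun w => ?_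
        -- The translation of `s` by `γ w` straightens the graph without producing a Jacobian.
        rw [← lintegral_add_left_eq_self (fun s : ℝ => f ((w : E d) + s • ν)) (γ w)]
        refine lintegral_congr fun s => ?_
        rw [graphMap, add_smul, add_assoc]
    _ = _ := by
        rw [hc f hfm, hf, lintegral_indicator hΩ.measurableSet]
        push_cast
        ring

/-- The projection is nonexpanding and inverts the graph map, so only parameters from a bounded part
of the hyperplane reach the ball. -/
theorem measure_frontier_lt_top (hΩ : IsOpen Ω) (h : IsPatch Ω x ν γ K r) :
    (μHE[d - 1] : Measure (E d)) (frontier Ω ∩ Metric.ball x r) < (⊤ : ℝ≥0∞) := by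
  have := isAddHaarMeasure_perp h.norm_eq
  have hm : Measurable (graphMap ν γ) := h.lipschitz_graphMap.continuous.measurable
  have hS : MeasurableSet (frontier Ω ∩ Metric.ball x r) :=
    isClosed_frontier.measurableSet.inter measurableSet_ball
  have h1 := Measure.le_iff.1 (h.restrict_frontier_le hΩ) _ hS
  rw [Measure.restrict_apply hS, inter_self, Measure.smul_apply, Measure.map_apply hm hS,
    smul_eq_mul] at h1
  refine h1.trans_lt (ENNReal.mul_lt_top (ENNReal.pow_lt_top ENNReal.coe_lt_top) ?_)
  refine (measure_mono (t := Metric.ball (projPerp ν x) r) ?_).trans_lt measure_ball_lt_top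
  rintro w ⟨_, hw⟩
  have e : projPerp ν (graphMap ν γ w) = w := by
    rw [graphMap, projPerp_add_smul]
    exact Submodule.orthogonalProjectionOnto_mem_subspace_eq_self w
  rw [Metric.mem_ball, dist_eq_norm] at hw ⊢
  rw [← e]
  exact (norm_projPerp_sub_le _ _ _).trans_lt hw

/-- Projecting the boundary to the hyperplane does not increase its measure, and the image contains
a neighbourhood of the projection of `x`. -/
theorem measure_frontier_pos (hΩ : IsOpen Ω) (h : IsPatch Ω x ν γ K r) (hx : x ∈ frontier Ω) :
    0 < (μHE[d - 1] : Measure (E d)) (frontier Ω) := by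
  have := isAddHaarMeasure_perp h.norm_eq
  have hlip : LipschitzWith 1 (projPerp ν) := LipschitzWith.of_dist_le_mul fun a b => by
    rw [dist_eq_norm, dist_eq_norm]
    simpa using norm_projPerp_sub_le ν a b
  have hle := euclideanHausdorffMeasure_image_le hlip (d - 1) (frontier Ω)
  rw [ENNReal.coe_one, one_pow, one_mul] at hle
  refine lt_of_lt_of_le ?_ hle
  refine Measure.measure_pos_of_mem_nhds _ (x := projPerp ν x) ?_
  have hx0 : graphMap ν γ (projPerp ν x) = x := by
    rw [graphMap, h.eq_of_mem_frontier hΩ (Metric.mem_ball_self h.pos) hx,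
      projPerp_add_inner_smul h.norm_eq]
  have hnh : ∀ᶠ w in 𝓝 (projPerp ν x), graphMap ν γ w ∈ Metric.ball x r := by
    refine h.lipschitz_graphMap.continuous.continuousAt.eventually_mem ?_
    rw [hx0]
    exact Metric.ball_mem_nhds _ h.pos
  filter_upwards [hnh] with w hw
  have e : ∀ s : ℝ, projPerp ν (graphMap ν γ w + s • ν) = w := by
    intro s
    rw [projPerp_add_smul, graphMap, projPerp_add_smul]
    exact Submodule.orthogonalProjectionOnto_mem_subspace_eq_self w
  have e2 : ∀ s : ℝ, inner ℝ ν (graphMap ν γ w + s • ν) = γ w + s := by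
    intro s
    have h0 : inner ℝ ν (w : E d) = 0 :=
      Submodule.mem_orthogonal_singleton_iff_inner_right.1 w.2
    rw [inner_add_smul h.norm_eq, graphMap, inner_add_smul h.norm_eq, h0, zero_add]
  refine ⟨graphMap ν γ w, ?_, by simpa using e 0⟩
  rw [hΩ.frontier_eq]
  constructor
  -- A point of the graph is a limit of the points directly above it, which lie in `Ω`; it is not in
  -- `Ω` itself because the epigraph is strict.
  · have ht : Tendsto (fun s : ℝ => graphMap ν γ w + s • ν) (𝓝[>] 0) (𝓝 (graphMap ν γ w)) := by
      have : Tendsto (fun s : ℝ => graphMap ν γ w + s • ν) (𝓝 0)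
          (𝓝 (graphMap ν γ w + (0 : ℝ) • ν)) := by
        apply Continuous.tendsto
        fun_prop
      rw [zero_smul, add_zero] at this
      exact this.mono_left nhdsWithin_le_nhds
    refine mem_closure_of_tendsto ht ?_
    filter_upwards [ht.eventually_mem (Metric.isOpen_ball.mem_nhds hw), self_mem_nhdsWithin]
      with s hs hs0
    rw [h.mem_iff _ hs, e, e2]
    simpa using hs0
  · intro hmem
    have := (h.mem_iff _ hw).1 hmem
    have a := e 0
    have b := e2 0
    rw [zero_smul, add_zero] at a b
    rw [a, b] at this
    linarith

end IsPatch

theorem IsLipschitzDomain.isCompact_frontier {Ω : Set (E d)} (hΩ : IsLipschitzDomain Ω) :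
    IsCompact (frontier Ω) :=
  hΩ.isBounded.isCompact_closure.of_isClosed_subset isClosed_frontier frontier_subset_closure

theorem IsLipschitzDomain.isFiniteMeasure_surface {Ω : Set (E d)} (hΩ : IsLipschitzDomain Ω) :
    IsFiniteMeasure (surface Ω) := by
  refine ⟨?_⟩
  rw [surface, Measure.restrict_apply_univ]
  refine hΩ.isCompact_frontier.measure_lt_top_of_nhdsWithin fun x hx => ?_
  obtain ⟨ν, γ, K, r, h⟩ := hΩ.exists_patch hx
  refine ⟨frontier Ω ∩ Metric.ball x r, ?_, h.measure_frontier_lt_top hΩ.isOpen⟩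
  exact inter_mem_nhdsWithin _ (Metric.ball_mem_nhds _ h.pos)

theorem IsLipschitzDomain.frontier_nonempty [NeZero d] {Ω : Set (E d)}
    (hΩ : IsLipschitzDomain Ω) : (frontier Ω).Nonempty := by
  have : Nontrivial (E d) := by
    have : NeZero d := inferInstance
    exact inferInstanceAs (Nontrivial (EuclideanSpace ℝ (Fin d)))
  refine nonempty_frontier_iff.2 ⟨hΩ.isConnected.nonempty, fun h => ?_⟩
  have hb := hΩ.isBounded
  rw [h] at hb
  exact NormedSpace.unbounded_univ ℝ (E d) hb

theorem IsLipschitzDomain.surface_univ_pos [NeZero d] {Ω : Set (E d)}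
    (hΩ : IsLipschitzDomain Ω) : 0 < surface Ω univ := by
  obtain ⟨x, hx⟩ := hΩ.frontier_nonempty
  obtain ⟨ν, γ, K, r, h⟩ := hΩ.exists_patch hx
  rw [surface, Measure.restrict_apply_univ]
  exact h.measure_frontier_pos hΩ.isOpen hx

/-! ### Mollification -/

theorem sq_lintegral_le {α : Type*} [MeasurableSpace α] (μ : Measure α) {g : α → ℝ≥0∞}
    (hg : AEMeasurable g μ) : (∫⁻ x, g x ∂μ) ^ 2 ≤ μ univ * ∫⁻ x, g x ^ 2 ∂μ := by
  have h := ENNReal.lintegral_mul_le_Lp_mul_Lq μ Real.HolderConjugate.two_two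
    (f := fun _ => 1) (g := g) aemeasurable_const hg
  have e : ∀ a : ℝ≥0∞, (a ^ (1 / 2 : ℝ)) ^ 2 = a := fun a => by
    rw [← ENNReal.rpow_natCast, ← ENNReal.rpow_mul]
    norm_num
  have h2 : (∫⁻ x, g x ∂μ) ≤ μ univ ^ (1 / 2 : ℝ) * (∫⁻ x, g x ^ 2 ∂μ) ^ (1 / 2 : ℝ) := by
    simpa using h
  calc _ ≤ (μ univ ^ (1 / 2 : ℝ) * (∫⁻ x, g x ^ 2 ∂μ) ^ (1 / 2 : ℝ)) ^ 2 := by gcongr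
    _ = _ := by rw [mul_pow, e, e]

theorem eLpNorm_two_sq {α F : Type*} [MeasurableSpace α] [NormedAddCommGroup F] (μ : Measure α)
    (f : α → F) : eLpNorm f 2 μ ^ 2 = ∫⁻ x, ‖f x‖ₑ ^ 2 ∂μ := by
  have := eLpNorm_nnreal_pow_eq_lintegral (f := f) (μ := μ) (p := 2) (by norm_num)
  simpa using this

/-- `η` is a smooth probability density concentrated on the closed ball with center `a` and
radius `ρ`. -/
structure IsKernel (η : E d → ℝ) (a : E d) (ρ : ℝ) : Prop where
  contDiff : ContDiff ℝ ∞ η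
  nonneg : ∀ x, 0 ≤ η x
  integral_eq : ∫ x, η x = 1
  tsupport_subset : tsupport η ⊆ Metric.closedBall a ρ

theorem exists_isKernel (a : E d) {ρ : ℝ} (hρ : 0 < ρ) : ∃ η : E d → ℝ, IsKernel η a ρ := by
  let f : ContDiffBump a := ⟨ρ / 2, ρ, by positivity, by linarith⟩
  exact ⟨f.normed volume, f.contDiff_normed, f.nonneg_normed, f.integral_normed,
    f.tsupport_normed_eq.subset⟩

namespace IsKernel

variable {η : E d → ℝ} {a : E d} {ρ : ℝ}

theorem hasCompactSupport (h : IsKernel η a ρ) : HasCompactSupport η :=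
  (isCompact_closedBall a ρ).of_isClosed_subset (isClosed_tsupport η) h.tsupport_subset

theorem integrable (h : IsKernel η a ρ) : Integrable η :=
  h.contDiff.continuous.integrable_of_hasCompactSupport h.hasCompactSupport

theorem lintegral_enorm (h : IsKernel η a ρ) : ∫⁻ x, ‖η x‖ₑ = 1 := by
  have := ofReal_integral_eq_lintegral_ofReal h.integrable (Eventually.of_forall h.nonneg)
  rw [h.integral_eq, ENNReal.ofReal_one] at this
  rw [this]
  refine lintegral_congr fun x => ?_
  rw [Real.enorm_eq_ofReal (h.nonneg x)]

end IsKernel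

/-- The convolution of a scalar kernel with a function. -/
def mollify {F : Type*} [NormedAddCommGroup F] [NormedSpace ℝ F] (η : E d → ℝ) (f : E d → F) :
    E d → F :=
  convolution η f (ContinuousLinearMap.lsmul ℝ ℝ) volume

section

variable {F : Type*} [NormedAddCommGroup F] [NormedSpace ℝ F]

theorem mollify_apply (η : E d → ℝ) (f : E d → F) (x : E d) :
    mollify η f x = ∫ t, η t • f (x - t) := rfl

theorem mollify_eq_swap (η : E d → ℝ) (f : E d → F) (x : E d) :
    mollify η f x = ∫ t, η (x - t) • f t := convolution_lsmul_swap

/-- Jensen's inequality for the probability density `η`, followed by Tonelli, bounds the squared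
error by an average of squared translation errors. The kernel need not be centred at the origin,
which later permits one-sided mollification at the boundary. -/
theorem eLpNorm_mollify_sub_le [CompleteSpace F] {η : E d → ℝ} {a : E d} {ρ : ℝ}
    (hη : IsKernel η a ρ)
    {f : E d → F} (hf : MemLp f 2 volume) (hfm : StronglyMeasurable f) {B : ℝ≥0∞}
    (hB : ∀ z ∈ Metric.closedBall a ρ, eLpNorm (fun x => f (x - z) - f x) 2 volume ≤ B) :
    eLpNorm (mollify η f - f) 2 volume ≤ B := by
  have hfl : LocallyIntegrable f volume := hf.locallyIntegrable (by norm_num)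
  have hpt : ∀ x, ‖(mollify η f - f) x‖ₑ ^ 2 ≤ ∫⁻ t, ‖η t‖ₑ * ‖f (x - t) - f x‖ₑ ^ 2 := by
    intro x
    have hex : Integrable (fun t => η t • f (x - t)) :=
      hη.hasCompactSupport.convolutionExists_left (ContinuousLinearMap.lsmul ℝ ℝ)
        hη.contDiff.continuous hfl x
    have e : (mollify η f - f) x = ∫ t, η t • (f (x - t) - f x) := by
      simp only [smul_sub]
      rw [integral_sub hex (hη.integrable.smul_const _), integral_smul_const, hη.integral_eq,
        one_smul]
      rfl
    have hm : Measurable fun t => ‖f (x - t) - f x‖ₑ :=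
      ((hfm.comp_measurable (by fun_prop)).sub stronglyMeasurable_const).enorm
    have hηm : Measurable fun t => ‖η t‖ₑ := hη.contDiff.continuous.measurable.enorm
    have h1 : ‖(mollify η f - f) x‖ₑ
        ≤ ∫⁻ t, ‖f (x - t) - f x‖ₑ ∂(volume.withDensity fun t => ‖η t‖ₑ) := by
      rw [e, lintegral_withDensity_eq_lintegral_mul _ hηm hm]
      refine (enorm_integral_le_lintegral_enorm _).trans_eq ?_
      refine lintegral_congr fun t => ?_
      rw [enorm_smul, Pi.mul_apply]
    calc _ ≤ (∫⁻ t, ‖f (x - t) - f x‖ₑ ∂(volume.withDensity fun t => ‖η t‖ₑ)) ^ 2 := by gcongr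
      -- Cauchy–Schwarz with respect to the measure of density `η`, whose total mass is one.
      _ ≤ _ := sq_lintegral_le _ hm.aemeasurable
      _ = _ := by
        rw [withDensity_apply _ MeasurableSet.univ, setLIntegral_univ, hη.lintegral_enorm, one_mul,
          lintegral_withDensity_eq_lintegral_mul _ hηm (hm.pow_const 2)]
        rfl
  have hsq : eLpNorm (mollify η f - f) 2 volume ^ 2 ≤ B ^ 2 := by
    rw [eLpNorm_two_sq]
    calc _ ≤ ∫⁻ x, ∫⁻ t, ‖η t‖ₑ * ‖f (x - t) - f x‖ₑ ^ 2 := lintegral_mono hpt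
      _ = ∫⁻ t, ∫⁻ x, ‖η t‖ₑ * ‖f (x - t) - f x‖ₑ ^ 2 := by
        refine lintegral_lintegral_swap (Measurable.aemeasurable ?_)
        have m1 : Measurable fun p : E d × E d => ‖η p.2‖ₑ :=
          (hη.contDiff.continuous.measurable.comp measurable_snd).enorm
        have m2 : Measurable fun p : E d × E d => ‖f (p.1 - p.2) - f p.1‖ₑ :=
          ((hfm.comp_measurable (by fun_prop)).sub (hfm.comp_measurable measurable_fst)).enorm
        exact m1.mul (m2.pow_const 2)
      _ ≤ ∫⁻ t, ‖η t‖ₑ * B ^ 2 := by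
        refine lintegral_mono fun t => ?_
        by_cases ht : η t = 0
        · simp [ht]
        · rw [lintegral_const_mul]
          · rw [← eLpNorm_two_sq]
            gcongr
            exact hB t (hη.tsupport_subset (subset_tsupport _ ht))
          · exact (((hfm.comp_measurable (by fun_prop)).sub hfm).enorm).pow_const 2
      _ = B ^ 2 := by
        rw [lintegral_mul_const _ hη.contDiff.continuous.measurable.enorm, hη.lintegral_enorm,
          one_mul]
  exact (ENNReal.pow_right_strictMono two_ne_zero).le_iff_le.1 hsq

end

theorem tendsto_eLpNorm_translate_sub {F : Type*} [NormedAddCommGroup F] {f : E d → F} (hf : MemLp f 2 volume) :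
    Tendsto (fun z => eLpNorm (fun x => f (x - z) - f x) 2 volume) (𝓝 0) (𝓝 0) := by
  let g : E d → C(E d, E d) := fun z => ⟨fun x => x - z, by fun_prop⟩
  have hg : Continuous g := 
    ContinuousMap.continuous_of_continuous_uncurry _ (continuous_snd.sub continuous_fst)
  have hgm : ∀ z, MeasurePreserving (g z) volume volume := fun z =>
    measurePreserving_sub_right volume z
  have h := (continuousAt_const (y := hf.toLp f) (x := (0 : E d))).compMeasurePreservingLp
    hg.continuousAt hgm (by norm_num)
  have h2 := tendsto_iff_edist_tendsto_0.1 h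
  refine h2.congr fun z => ?_
  rw [Lp.edist_def]
  apply eLpNorm_congr_ae
  have a1 : ∀ z, (Lp.compMeasurePreserving (g z) (hgm z) (hf.toLp f) : E d → F)
      =ᵐ[volume] fun x => f (x - z) := fun z =>
    (Lp.coeFn_compMeasurePreserving _ (hgm z)).trans
      ((hgm z).quasiMeasurePreserving.ae_eq_comp hf.coeFn_toLp)
  filter_upwards [a1 z, a1 0] with x h1 h2
  rw [Pi.sub_apply, h1, h2, sub_zero]

/-- The mollified gradient is the gradient of the mollified function, at points where the weak
derivative may be tested against the translated kernel. -/
theorem hasGradientAt_mollify {Ω : Set (E d)} (hΩ : IsOpen Ω) {u : E d → ℝ} {G : E d → E d}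
    (hu : MemLp u 2 (volume.restrict Ω)) (hG : MemLp G 2 (volume.restrict Ω))
    {η : E d → ℝ} {a : E d} {ρ : ℝ} (hη : IsKernel η a ρ) {y : E d}
    (h : ∀ w, ∫ z in Ω, u z * fderiv ℝ η (y - z) w = ∫ z in Ω, η (y - z) * inner ℝ (G z) w) :
    HasGradientAt (mollify η (Ω.indicator u)) (mollify η (Ω.indicator G) y) y := by
  have hu' : MemLp (Ω.indicator u) 2 volume := (memLp_indicator_iff_restrict hΩ.measurableSet).2 hu
  have hG' : MemLp (Ω.indicator G) 2 volume := (memLp_indicator_iff_restrict hΩ.measurableSet).2 hG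
  have hul : LocallyIntegrable (Ω.indicator u) volume := hu'.locallyIntegrable (by norm_num)
  have hGl : LocallyIntegrable (Ω.indicator G) volume := hG'.locallyIntegrable (by norm_num)
  have hd := hη.hasCompactSupport.hasFDerivAt_convolution_left (μ := volume)
    (ContinuousLinearMap.lsmul ℝ ℝ) (hη.contDiff.of_le (by simp)) hul y
  rw [hasGradientAt_iff_hasFDerivAt]
  refine hd.congr_fderiv ?_
  ext w
  have hex : ConvolutionExistsAt (fderiv ℝ η) (Ω.indicator u) y
      ((ContinuousLinearMap.lsmul ℝ ℝ).precompL (E d)) volume :=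
    (hη.hasCompactSupport.fderiv ℝ).convolutionExists_left _
      (hη.contDiff.continuous_fderiv (by simp)) hul y
  have hexG : Integrable (fun t => η t • Ω.indicator G (y - t)) :=
    hη.hasCompactSupport.convolutionExists_left (ContinuousLinearMap.lsmul ℝ ℝ)
      hη.contDiff.continuous hGl y
  have e1 : (convolution (fderiv ℝ η) (Ω.indicator u)
      ((ContinuousLinearMap.lsmul ℝ ℝ).precompL (E d)) volume y) w
      = ∫ z in Ω, u z * fderiv ℝ η (y - z) w := by
    rw [convolution_def, ContinuousLinearMap.integral_apply hex, ← integral_indicator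
      hΩ.measurableSet, ← integral_sub_left_eq_self _ volume y]
    refine integral_congr_ae (Eventually.of_forall fun t => ?_)
    simp only [ContinuousLinearMap.precompL_apply, ContinuousLinearMap.lsmul_apply, smul_eq_mul,
      sub_sub_cancel]
    by_cases ht : t ∈ Ω
    · simp [ht, mul_comm]
    · simp [ht]
  rw [e1, h w, InnerProductSpace.toDual_apply_apply, mollify_apply, real_inner_comm,
    ← integral_inner hexG, ← integral_indicator hΩ.measurableSet,
    ← integral_sub_left_eq_self _ volume y]
  refine integral_congr_ae (Eventually.of_forall fun t => ?_)
  by_cases ht : y - t ∈ Ω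
  · simp [ht, real_inner_smul_right, real_inner_comm]
  · simp [ht]

/-! ### Density of smooth functions in `H¹(Ω)` -/

theorem memLp_of_continuous {Ω : Set (E d)} (hb : Bornology.IsBounded Ω) {F : Type*}
    [NormedAddCommGroup F] {f : E d → F} (hf : Continuous f) :
    MemLp f 2 (volume.restrict Ω) := by
  have hc : IsCompact (closure Ω) := hb.isCompact_closure
  have : IsFiniteMeasure (volume.restrict (closure Ω)) := ⟨by simpa using hc.measure_lt_top⟩
  obtain ⟨C, hC⟩ := hc.exists_bound_of_continuousOn hf.continuousOn
  have h : MemLp f 2 (volume.restrict (closure Ω)) := by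
    refine MemLp.of_bound (hf.continuousOn.aestronglyMeasurable_of_isCompact hc
      isClosed_closure.measurableSet) C ?_
    filter_upwards [ae_restrict_mem isClosed_closure.measurableSet] with x hx using hC x hx
  exact h.mono_measure (Measure.restrict_mono subset_closure le_rfl)

theorem inner_gradient (φ : E d → ℝ) (x v : E d) : inner ℝ (gradient φ x) v = fderiv ℝ φ x v := by
  simp [gradient]

theorem norm_gradient (φ : E d → ℝ) (x : E d) : ‖gradient φ x‖ = ‖fderiv ℝ φ x‖ := by
  simp [gradient]

theorem continuous_gradient {φ : E d → ℝ} (hφ : ContDiff ℝ ∞ φ) : Continuous (gradient φ) :=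
  (InnerProductSpace.toDual ℝ (E d)).symm.continuous.comp (hφ.continuous_fderiv (by simp))

theorem hasWeakGradient_of_contDiff (Ω : Set (E d)) {φ : E d → ℝ} (hφ : ContDiff ℝ ∞ φ) :
    HasWeakGradient Ω φ (gradient φ) := by
  intro θ hθ v
  have hθ0 : ∀ x, x ∉ Ω → θ x = 0 := fun x hx =>
    image_eq_zero_of_notMem_tsupport fun hx' => hx (hθ.tsupport_subset hx')
  have hθ1 : ∀ x, x ∉ Ω → fderiv ℝ θ x v = 0 := fun x hx => by
    have : x ∉ tsupport (fderiv ℝ θ) := fun hx' =>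
      hx (hθ.tsupport_subset (tsupport_fderiv_subset ℝ hx'))
    rw [image_eq_zero_of_notMem_tsupport this]
    rfl
  rw [setIntegral_eq_integral_of_forall_compl_eq_zero fun x hx => by rw [hθ1 x hx, mul_zero],
    setIntegral_eq_integral_of_forall_compl_eq_zero fun x hx => by rw [hθ0 x hx, zero_mul]]
  have c1 : Continuous fun x => fderiv ℝ θ x v :=
    (hθ.contDiff.continuous_fderiv (by simp)).clm_apply continuous_const
  have c2 : Continuous fun x => fderiv ℝ φ x v :=
    (hφ.continuous_fderiv (by simp)).clm_apply continuous_const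
  rw [integral_mul_fderiv_eq_neg_fderiv_mul_of_integrable]
  · simp only [inner_gradient, mul_comm]
  · exact (c2.mul hθ.contDiff.continuous).integrable_of_hasCompactSupport
      hθ.hasCompactSupport.mul_left
  · exact (hφ.continuous.mul c1).integrable_of_hasCompactSupport
      (hθ.hasCompactSupport.fderiv_apply ℝ v).mul_left
  · exact (hφ.continuous.mul hθ.contDiff.continuous).integrable_of_hasCompactSupport
      hθ.hasCompactSupport.mul_left
  · exact fun x _ => hφ.differentiable (by simp) x
  · exact fun x _ => hθ.contDiff.differentiable (by simp) x

/-- The restriction to a bounded set of a smooth function, as an element of `H¹`. -/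
def smoothH1 {Ω : Set (E d)} (hb : Bornology.IsBounded Ω) {φ : E d → ℝ} (hφ : ContDiff ℝ ∞ φ) :
    H1 Ω :=
  mkH1 φ (gradient φ) (memLp_of_continuous hb hφ.continuous)
    (memLp_of_continuous hb (continuous_gradient hφ)) (hasWeakGradient_of_contDiff Ω hφ)

theorem val_smoothH1 {Ω : Set (E d)} (hb : Bornology.IsBounded Ω) {φ : E d → ℝ}
    (hφ : ContDiff ℝ ∞ φ) : val (smoothH1 hb hφ) =ᵐ[volume.restrict Ω] φ := val_mkH1 _ _ _

theorem grad_smoothH1 {Ω : Set (E d)} (hb : Bornology.IsBounded Ω) {φ : E d → ℝ}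
    (hφ : ContDiff ℝ ∞ φ) : grad (smoothH1 hb hφ) =ᵐ[volume.restrict Ω] gradient φ :=
  grad_mkH1 _ _ _

theorem eLpNorm_restrict_sub_mollify_le {F : Type*} [NormedAddCommGroup F] [NormedSpace ℝ F]
    {Ω : Set (E d)} (hΩ : IsOpen Ω) (f : E d → F) (η : E d → ℝ) :
    eLpNorm (f - mollify η (Ω.indicator f)) 2 (volume.restrict Ω)
      ≤ eLpNorm (mollify η (Ω.indicator f) - Ω.indicator f) 2 volume := by
  rw [eLpNorm_sub_comm]
  have : mollify η (Ω.indicator f) - f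
      =ᵐ[volume.restrict Ω] mollify η (Ω.indicator f) - Ω.indicator f := by
    filter_upwards [ae_restrict_mem hΩ.measurableSet] with x hx
    simp [hx]
  rw [eLpNorm_congr_ae this]
  exact eLpNorm_mono_measure _ Measure.restrict_le_self

/-- An element of `H¹(Ω)` concentrated on `K` can be approximated by mollification as soon as there
are arbitrarily small kernels whose translates either lie in `Ω` or avoid `K`. -/
theorem exists_smooth_approx {Ω : Set (E d)} (hΩ : IsOpen Ω) (hb : Bornology.IsBounded Ω)
    (v : H1 Ω) {K : Set (E d)}
    (hK : ∀ᵐ x ∂(volume.restrict Ω), x ∉ K → val v x = 0 ∧ grad v x = 0)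
    (hker : ∀ r > 0, ∃ (a : E d) (ρ : ℝ), 0 < ρ ∧ ‖a‖ + ρ < r ∧ ∀ y ∈ Ω,
      Metric.closedBall (y - a) ρ ⊆ Ω ∨ Disjoint (Metric.closedBall (y - a) ρ) K)
    {e : ℝ} (he : 0 < e) : ∃ (φ : E d → ℝ) (hφ : ContDiff ℝ ∞ φ),
      ‖v - smoothH1 hb hφ‖ < e ∧ ∀ y, φ y ≠ 0 → ∃ z ∈ K, dist y z < e := by
  have hv : MemLp (Ω.indicator (val v)) 2 volume :=
    (memLp_indicator_iff_restrict hΩ.measurableSet).2 (memLp_val v)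
  have hg : MemLp (Ω.indicator (grad v)) 2 volume :=
    (memLp_indicator_iff_restrict hΩ.measurableSet).2 (memLp_grad v)
  have hvm : StronglyMeasurable (Ω.indicator (val v)) :=
    (Lp.stronglyMeasurable _).indicator hΩ.measurableSet
  have hgm : StronglyMeasurable (Ω.indicator (grad v)) :=
    (Lp.stronglyMeasurable _).indicator hΩ.measurableSet
  set B : ℝ≥0∞ := ENNReal.ofReal (e / 3) with hBdef
  have hB : 0 < B := by rw [hBdef]; positivity
  have ev := ((tendsto_eLpNorm_translate_sub hv).eventually_le_const hB).and
    ((tendsto_eLpNorm_translate_sub hg).eventually_le_const hB)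
  -- Translations shorter than `r` change the function and its gradient by at most `e/3` in `L²`.
  -- Taking the kernel inside the ball of radius `min r e` also keeps the support of the
  -- approximation within `e` of `K`.
  obtain ⟨r, hr, hrB⟩ := Metric.eventually_nhds_iff.1 ev
  obtain ⟨a, ρ, hρ, har, hdich⟩ := hker (min r e) (lt_min hr he)
  obtain ⟨η, hη⟩ := exists_isKernel a hρ
  have hsmall : ∀ z ∈ Metric.closedBall a ρ, ‖z‖ < min r e := by
    intro z hz
    rw [Metric.mem_closedBall, dist_eq_norm] at hz
    calc ‖z‖ = ‖(z - a) + a‖ := by rw [sub_add_cancel]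
      _ ≤ ‖z - a‖ + ‖a‖ := norm_add_le _ _
      _ < _ := by linarith
  have hvl : LocallyIntegrable (Ω.indicator (val v)) volume := hv.locallyIntegrable (by norm_num)
  have hφ : ContDiff ℝ ∞ (mollify η (Ω.indicator (val v))) :=
    hη.hasCompactSupport.contDiff_convolution_left _ hη.contDiff hvl
  have hK' : ∀ᵐ x, x ∈ Ω → x ∉ K → val v x = 0 ∧ grad v x = 0 :=
    (ae_restrict_iff' hΩ.measurableSet).1 hK
  -- Mollification commutes with the gradient at `y` in both alternatives: the reflected kernel is a
  -- test function in `Ω`, or it misses `K` and both integrals vanish.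
  have hgrad : ∀ y ∈ Ω, gradient (mollify η (Ω.indicator (val v))) y
      = mollify η (Ω.indicator (grad v)) y := by
    intro y hy
    refine (hasGradientAt_mollify hΩ (memLp_val v) (memLp_grad v) hη fun w => ?_).gradient
    rcases hdich y hy with hin | hdis
    · have htest : IsTestFunction Ω fun z => η (y - z) := by
        have hts : tsupport (fun z => η (y - z)) ⊆ Metric.closedBall (y - a) ρ := by
          refine closure_minimal (fun z hz => ?_) Metric.isClosed_closedBall
          have := hη.tsupport_subset (subset_tsupport _ hz)
          rw [Metric.mem_closedBall, dist_eq_norm] at this ⊢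
          rwa [show z - (y - a) = -(y - z - a) by abel, norm_neg]
        exact ⟨hη.contDiff.comp (contDiff_const.sub contDiff_id),
          (isCompact_closedBall _ _).of_isClosed_subset (isClosed_tsupport _) hts, hts.trans hin⟩
      have h := hasWeakGradient v _ htest w
      have hf : ∀ z, fderiv ℝ (fun z => η (y - z)) z w = - fderiv ℝ η (y - z) w := by
        intro z
        have h1 : HasFDerivAt (fun z => η (y - z))
            ((fderiv ℝ η (y - z)).comp (-ContinuousLinearMap.id ℝ (E d))) z :=
          (hη.contDiff.differentiable (by simp) (y - z)).hasFDerivAt.comp z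
            ((hasFDerivAt_id z).const_sub y)
        rw [h1.fderiv]
        simp
      simp only [hf, mul_neg, integral_neg, neg_inj] at h
      exact h
    · have hzero : ∀ z, z ∈ K → y - z ∉ tsupport η := by
        intro z hz hz'
        have := hη.tsupport_subset hz'
        refine disjoint_left.1 hdis ?_ hz
        rw [Metric.mem_closedBall, dist_eq_norm] at this ⊢
        rwa [show z - (y - a) = -(y - z - a) by abel, norm_neg]
      rw [integral_eq_zero_of_ae, integral_eq_zero_of_ae]
      · filter_upwards [hK] with z hz
        by_cases hzK : z ∈ K
        · simp [image_eq_zero_of_notMem_tsupport (hzero z hzK)]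
        · simp [(hz hzK).2]
      · filter_upwards [hK] with z hz
        by_cases hzK : z ∈ K
        · have : y - z ∉ tsupport (fderiv ℝ η) := fun h' =>
            hzero z hzK (tsupport_fderiv_subset ℝ h')
          simp [image_eq_zero_of_notMem_tsupport this]
        · simp [(hz hzK).1]
  refine ⟨_, hφ, ?_, ?_⟩
  · have h1 : eLpNorm (val (v - smoothH1 hb hφ)) 2 (volume.restrict Ω) ≤ B := by
      have hae : val (v - smoothH1 hb hφ) =ᵐ[volume.restrict Ω]
          val v - mollify η (Ω.indicator (val v)) := by
        filter_upwards [val_sub v (smoothH1 hb hφ), val_smoothH1 hb hφ] with x h1 h2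
        rw [h1, Pi.sub_apply, Pi.sub_apply, h2]
      rw [eLpNorm_congr_ae hae]
      refine (eLpNorm_restrict_sub_mollify_le hΩ _ _).trans ?_
      refine eLpNorm_mollify_sub_le hη hv hvm fun z hz => (hrB ?_).1
      simpa [dist_eq_norm] using (hsmall z hz).trans_le (min_le_left _ _)
    have h2 : eLpNorm (grad (v - smoothH1 hb hφ)) 2 (volume.restrict Ω) ≤ B := by
      have hae : grad (v - smoothH1 hb hφ) =ᵐ[volume.restrict Ω]
          grad v - mollify η (Ω.indicator (grad v)) := by
        filter_upwards [grad_sub v (smoothH1 hb hφ), grad_smoothH1 hb hφ,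
          ae_restrict_mem hΩ.measurableSet] with x h1 h2 hx
        rw [h1, Pi.sub_apply, Pi.sub_apply, h2, hgrad x hx]
      rw [eLpNorm_congr_ae hae]
      refine (eLpNorm_restrict_sub_mollify_le hΩ _ _).trans ?_
      refine eLpNorm_mollify_sub_le hη hg hgm fun z hz => (hrB ?_).2
      simpa [dist_eq_norm] using (hsmall z hz).trans_le (min_le_left _ _)
    have := norm_le_of_eLpNorm_le _ h1 h2 (by positivity) (by positivity)
    linarith
  · intro y hy
    by_contra hcon
    push Not at hcon
    refine hy ?_
    rw [mollify_eq_swap]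
    apply integral_eq_zero_of_ae
    filter_upwards [hK'] with z hz
    by_cases hzΩ : z ∈ Ω
    · by_cases hzK : z ∈ K
      · have : η (y - z) = 0 := by
          refine image_eq_zero_of_notMem_tsupport fun h' => ?_
          have h3 := hsmall _ (hη.tsupport_subset h')
          rw [← dist_eq_norm] at h3
          exact absurd (h3.trans_le (min_le_right _ _)) (not_lt.2 (hcon z hzK))
        simp [this]
      · simp [hzΩ, (hz hzΩ hzK).1]
    · simp [hzΩ]

theorem IsLipschitzDomain.memLp_surface {Ω : Set (E d)} (hΩ : IsLipschitzDomain Ω) {f : E d → ℝ}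
    (hf : Continuous f) : MemLp f 2 (surface Ω) := by
  have := hΩ.isFiniteMeasure_surface
  obtain ⟨C, hC⟩ := hΩ.isCompact_frontier.exists_bound_of_continuousOn hf.continuousOn
  refine MemLp.of_bound hf.aestronglyMeasurable C ?_
  filter_upwards [ae_restrict_mem isClosed_frontier.measurableSet] with x hx using hC x hx

theorem smoothH1_mem_smoothTraces {Ω : Set (E d)} (hΩ : IsLipschitzDomain Ω) {φ : E d → ℝ}
    (hφ : ContDiff ℝ ∞ φ) :
    (smoothH1 hΩ.isBounded hφ, (hΩ.memLp_surface hφ.continuous).toLp φ) ∈ smoothTraces Ω :=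
  ⟨φ, hφ, val_smoothH1 hΩ.isBounded hφ,
    grad_smoothH1 hΩ.isBounded hφ, (hΩ.memLp_surface hφ.continuous).coeFn_toLp⟩

theorem memLp_mul_of_continuous {Ω : Set (E d)} (hΩ : IsOpen Ω) (hb : Bornology.IsBounded Ω)
    {F : Type*} [NormedAddCommGroup F] [NormedSpace ℝ F]
    {χ : E d → ℝ} (hχ : Continuous χ) {f : E d → F} (hf : MemLp f 2 (volume.restrict Ω)) :
    MemLp (fun x => χ x • f x) 2 (volume.restrict Ω) := by
  obtain ⟨C, hC⟩ := hb.isCompact_closure.exists_bound_of_continuousOn hχ.continuousOn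
  refine MemLp.of_le_mul (c := C) hf (hχ.aestronglyMeasurable.smul hf.1) ?_
  filter_upwards [ae_restrict_mem hΩ.measurableSet] with x hx
  rw [norm_smul]
  gcongr
  exact hC x (subset_closure hx)

/-- The product of an element of `H¹(Ω)` with a smooth function. -/
def mulH1 {Ω : Set (E d)} (hΩ : IsOpen Ω) (hb : Bornology.IsBounded Ω) {χ : E d → ℝ}
    (hχ : ContDiff ℝ ∞ χ) (u : H1 Ω) : H1 Ω :=
  mkH1 (fun x => χ x * val u x) (fun x => χ x • grad u x + val u x • gradient χ x)
    (memLp_mul_of_continuous hΩ hb hχ.continuous (memLp_val u))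
    ((memLp_mul_of_continuous hΩ hb hχ.continuous (memLp_grad u)).add (by
      obtain ⟨C, hC⟩ := hb.isCompact_closure.exists_bound_of_continuousOn
        (continuous_gradient hχ).continuousOn
      refine MemLp.of_le_mul (c := C) (memLp_val u)
        ((memLp_val u).1.smul (continuous_gradient hχ).aestronglyMeasurable) ?_
      filter_upwards [ae_restrict_mem hΩ.measurableSet] with x hx
      rw [norm_smul, mul_comm]
      gcongr
      exact hC x (subset_closure hx)))
    ((hasWeakGradient u).mul_smooth (memLp_val u) (memLp_grad u) hχ)

theorem val_sum {Ω : Set (E d)} {ι : Type*} (s : Finset ι) (u : ι → H1 Ω) :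
    val (∑ i ∈ s, u i) =ᵐ[volume.restrict Ω] fun x => ∑ i ∈ s, val (u i) x := by
  classical
  induction s using Finset.induction_on with
  | empty =>
    simp only [Finset.sum_empty]
    exact Lp.coeFn_zero _ _ _
  | insert i s hi ih =>
    rw [Finset.sum_insert hi]
    filter_upwards [val_add (u i) (∑ j ∈ s, u j), ih] with x h1 h2
    rw [h1, Pi.add_apply, h2, Finset.sum_insert hi]

theorem mem_closure_smooth {Ω : Set (E d)} (hΩ : IsLipschitzDomain Ω)
    (v : H1 Ω) {K : Set (E d)}
    (hK : ∀ᵐ x ∂(volume.restrict Ω), x ∉ K → val v x = 0 ∧ grad v x = 0)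
    (hker : ∀ r > 0, ∃ (a : E d) (ρ : ℝ), 0 < ρ ∧ ‖a‖ + ρ < r ∧ ∀ y ∈ Ω,
      Metric.closedBall (y - a) ρ ⊆ Ω ∨ Disjoint (Metric.closedBall (y - a) ρ) K) :
    v ∈ ((smoothTraces Ω).map (LinearMap.fst ℝ _ _)).topologicalClosure := by
  rw [← SetLike.mem_coe, Submodule.topologicalClosure_coe, Metric.mem_closure_iff]
  intro e he
  obtain ⟨φ, hφ, h, -⟩ := exists_smooth_approx hΩ.isOpen hΩ.isBounded v hK hker he
  exact ⟨_, ⟨_, smoothH1_mem_smoothTraces hΩ hφ, rfl⟩, by rw [dist_eq_norm]; exact h⟩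

/-- The kernel is centred at `-sν`, so that the mollification at `y` samples the ball of radius `δs`
about `y + sν`. Near `x` this ball lies in `Ω` by the cone property; for `y` at distance at least
`ε` from `x` it misses the set where the localized function lives. -/
theorem mulH1_mem_closure_smooth {Ω : Set (E d)} (hΩ : IsLipschitzDomain Ω) (u : H1 Ω)
    {x ν : E d} (hν : ‖ν‖ ≤ 1) {ε δ : ℝ} (hε : 0 < ε) (hδ : 0 < δ)
    (hcone : ∀ y ∈ Metric.ball x ε,
      y ∈ closure Ω → ∀ s : ℝ, 0 < s → s < ε → Metric.closedBall (y + s • ν) (δ * s) ⊆ Ω)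
    {χ : E d → ℝ} (hχ : ContDiff ℝ ∞ χ) (hsupp : tsupport χ ⊆ Metric.ball x (ε / 2)) :
    mulH1 hΩ.isOpen hΩ.isBounded hχ u
      ∈ ((smoothTraces Ω).map (LinearMap.fst ℝ _ _)).topologicalClosure := by
  refine mem_closure_smooth hΩ _ (K := Metric.ball x (ε / 2)) ?_ fun r hr => ?_
  · filter_upwards [val_mkH1 _ _ ((hasWeakGradient u).mul_smooth (memLp_val u) (memLp_grad u) hχ),
      grad_mkH1 _ _ ((hasWeakGradient u).mul_smooth (memLp_val u) (memLp_grad u) hχ)] with y h1 h2 hy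
    have hy1 : y ∉ tsupport χ := fun h => hy (hsupp h)
    have hy2 : gradient χ y = 0 := by
      have : y ∉ tsupport (fderiv ℝ χ) := fun h => hy1 (tsupport_fderiv_subset ℝ h)
      rw [gradient, image_eq_zero_of_notMem_tsupport this, map_zero]
    refine ⟨h1.trans ?_, h2.trans ?_⟩
    · rw [image_eq_zero_of_notMem_tsupport hy1, zero_mul]
    · rw [image_eq_zero_of_notMem_tsupport hy1, hy2, zero_smul, smul_zero, add_zero]
  · set q : ℝ := min r (ε / 2) with hq
    have hq0 : 0 < q := lt_min hr (by positivity)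
    -- The choice makes the total reach `s + δs` of the kernel equal to `q/2`, which is less than
    -- both `r` and `ε/2`.
    set s : ℝ := q / (2 * (1 + δ)) with hs
    have hs0 : 0 < s := by positivity
    have hsq : (1 + δ) * s = q / 2 := by rw [hs]; field_simp
    have hqε : q ≤ ε / 2 := min_le_right _ _
    have hqr : q ≤ r := min_le_left _ _
    have hsn : ‖s • ν‖ ≤ s := by
      rw [norm_smul, Real.norm_of_nonneg hs0.le]
      nlinarith
    have hδs : 0 < δ * s := by positivity
    refine ⟨-(s • ν), δ * s, hδs, ?_, fun y hy => ?_⟩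
    · rw [norm_neg]
      nlinarith
    · rw [sub_neg_eq_add]
      by_cases hyb : y ∈ Metric.ball x ε
      · exact Or.inl (hcone y hyb (subset_closure hy) s hs0 (by nlinarith))
      · right
        rw [disjoint_left]
        intro z hz hz'
        apply hyb
        rw [Metric.mem_ball] at hz' ⊢
        rw [Metric.mem_closedBall, dist_comm] at hz
        have h3 : dist y (y + s • ν) ≤ s := by simpa [dist_eq_norm] using hsn
        have := dist_triangle4 y (y + s • ν) z x
        nlinarith

-- Density up to the boundary: a smooth partition of unity on the compact closure, subordinate to
-- balls with the cone property, splits `u` into finitely many pieces, each approximable by shifted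
-- mollification.
open scoped Manifold in
theorem dense_smooth {Ω : Set (E d)} (hΩ : IsLipschitzDomain Ω) :
    ((smoothTraces Ω).map (LinearMap.fst ℝ (H1 Ω) (Lp ℝ 2 (surface Ω)))).topologicalClosure
      = ⊤ := by
  rw [eq_top_iff]
  rintro u -
  have hcone := fun x : E d => fun hx : x ∈ closure Ω => hΩ.exists_cone hx
  choose! ν hν ε hε δ hδ hc using hcone
  obtain ⟨t, ht, htc⟩ := hΩ.isBounded.isCompact_closure.elim_nhds_subcover
    (fun x => Metric.ball x (ε x / 2))
    fun x hx => Metric.ball_mem_nhds _ (half_pos (hε x hx))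
  obtain ⟨f, hf⟩ := SmoothPartitionOfUnity.exists_isSubordinate 𝓘(ℝ, E d)
    (isClosed_closure (s := Ω)) (fun i : t => Metric.ball (i : E d) (ε i / 2))
    (fun i => Metric.isOpen_ball) (by simpa [iUnion_subtype] using htc)
  have hfc : ∀ i, ContDiff ℝ ∞ (f i) := fun i => (f i).contMDiff.contDiff
  have hsum : u = ∑ i : t, mulH1 hΩ.isOpen hΩ.isBounded (hfc i) u := by
    apply H1.ext hΩ.isOpen
    have hall : ∀ᵐ x ∂(volume.restrict Ω), ∀ i : t,
        val (mulH1 hΩ.isOpen hΩ.isBounded (hfc i) u) x = f i x * val u x :=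
      ae_all_iff.2 fun i => val_mkH1 _ _ _
    filter_upwards [val_sum Finset.univ fun i : t => mulH1 hΩ.isOpen hΩ.isBounded (hfc i) u, hall,
      ae_restrict_mem hΩ.isOpen.measurableSet] with x h1 h2 hx
    rw [h1]
    simp only [h2]
    rw [← Finset.sum_mul]
    have := f.sum_eq_one (subset_closure hx)
    rw [finsum_eq_sum_of_fintype] at this
    rw [this, one_mul]
  rw [hsum]
  exact Submodule.sum_mem _ fun i _ => mulH1_mem_closure_smooth hΩ u (hν i (ht i i.2))
    (hε i (ht i i.2)) (hδ i (ht i i.2)) (hc i (ht i i.2)) (hfc i) (hf i)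

/-- An element of `H¹(Ω)` that vanishes outside a compact subset of `Ω` has trace zero. -/
theorem zero_trace_of_compact {Ω : Set (E d)} (hΩ : IsLipschitzDomain Ω)
    (v : H1 Ω) {K : Set (E d)} (hKc : IsCompact K) (hKΩ : K ⊆ Ω)
    (hK : ∀ᵐ x ∂(volume.restrict Ω), x ∉ K → val v x = 0 ∧ grad v x = 0) :
    (v, (0 : Lp ℝ 2 (surface Ω))) ∈ traceGraph Ω := by
  obtain ⟨ρ₀, hρ₀, hthick⟩ := hKc.exists_cthickening_subset_open hΩ.isOpen hKΩ
  rw [traceGraph, ← SetLike.mem_coe, Submodule.topologicalClosure_coe, Metric.mem_closure_iff]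
  intro e he
  have hker : ∀ r > 0, ∃ (a : E d) (ρ : ℝ), 0 < ρ ∧ ‖a‖ + ρ < r ∧ ∀ y ∈ Ω,
      Metric.closedBall (y - a) ρ ⊆ Ω ∨ Disjoint (Metric.closedBall (y - a) ρ) K := by
    intro r hr
    -- Points of a ball of radius `ρ` are at most `ρ₀` apart, so a ball that meets `K` lies in the
    -- `ρ₀`-thickening of `K`, hence in `Ω`. An unshifted kernel suffices.
    set ρ := min (r / 2) (ρ₀ / 2) with hρ
    have hρ1 : ρ ≤ r / 2 := min_le_left _ _
    have hρ2 : ρ ≤ ρ₀ / 2 := min_le_right _ _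
    refine ⟨0, ρ, lt_min (by positivity) (by positivity), by simp only [norm_zero]; linarith,
      fun y _ => ?_⟩
    rw [sub_zero]
    by_cases hd : Disjoint (Metric.closedBall y ρ) K
    · exact Or.inr hd
    · left
      obtain ⟨z, hz, hzK⟩ := not_disjoint_iff.1 hd
      intro w hw
      refine hthick (Metric.mem_cthickening_of_dist_le w z ρ₀ K hzK ?_)
      rw [Metric.mem_closedBall] at hz hw
      rw [dist_comm] at hz
      linarith [dist_triangle w y z]
  obtain ⟨φ, hφ, h1, h2⟩ := exists_smooth_approx hΩ.isOpen hΩ.isBounded v hK hker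
    (lt_min he hρ₀)
  -- The approximation is nonzero only within `ρ₀` of `K`, hence inside `Ω`; paired with the zero
  -- boundary function it is therefore a smooth trace pair.
  have hz : ∀ y ∈ frontier Ω, φ y = 0 := by
    intro y hy
    by_contra hne
    obtain ⟨z, hz, hyz⟩ := h2 y hne
    have : y ∈ Ω := hthick (Metric.mem_cthickening_of_dist_le y z ρ₀ K hz
      (hyz.le.trans (min_le_right _ _)))
    rw [hΩ.isOpen.frontier_eq] at hy
    exact hy.2 this
  refine ⟨(smoothH1 hΩ.isBounded hφ, 0), ⟨φ, hφ, val_smoothH1 hΩ.isBounded hφ,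
    grad_smoothH1 hΩ.isBounded hφ, ?_⟩, ?_⟩
  · filter_upwards [Lp.coeFn_zero ℝ 2 (surface Ω),
      ae_restrict_mem isClosed_frontier.measurableSet] with x hx hxf
    exact hx.trans (hz x hxf).symm
  · rw [Prod.dist_eq, dist_self, max_lt_iff, dist_eq_norm]
    exact ⟨h1.trans_le (min_le_left _ _), he⟩

/-! ### The trace operator -/

theorem enorm_gradient_le (φ : E d → ℝ) (x : E d) {ν : E d} (hν : ‖ν‖ ≤ 1) :
    ‖fderiv ℝ φ x ν‖ₑ ≤ ‖gradient φ x‖ₑ := by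
  rw [enorm_le_iff_norm_le, norm_gradient]
  refine (ContinuousLinearMap.le_opNorm _ _).trans ?_
  exact mul_le_of_le_one_right (norm_nonneg _) hν

/-- The increment of a smooth function along a segment is controlled by its gradient there. -/
theorem enorm_sub_sq_le {φ : E d → ℝ} (hφ : ContDiff ℝ ∞ φ) (y : E d) {ν : E d} (hν : ‖ν‖ ≤ 1)
    {s : ℝ} (hs : 0 ≤ s) : ‖φ (y + s • ν) - φ y‖ₑ ^ 2
      ≤ ENNReal.ofReal s * ∫⁻ t in Ioo 0 s, ‖gradient φ (y + t • ν)‖ₑ ^ 2 := by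
  have hc : Continuous fun t : ℝ => fderiv ℝ φ (y + t • ν) ν :=
    ((hφ.continuous_fderiv (by simp)).comp (by fun_prop)).clm_apply continuous_const
  have hd : ∀ t : ℝ, HasDerivAt (fun t : ℝ => φ (y + t • ν)) (fderiv ℝ φ (y + t • ν) ν) t := by
    intro t
    have h1 : HasDerivAt (fun t : ℝ => y + t • ν) ν t := by
      simpa using ((hasDerivAt_id t).smul_const ν).const_add y
    exact (hφ.differentiable (by simp) _).hasFDerivAt.comp_hasDerivAt t h1
  have e := intervalIntegral.integral_eq_sub_of_hasDerivAt (a := 0) (b := s)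
    (fun t _ => hd t) (hc.intervalIntegrable _ _)
  rw [zero_smul, add_zero, intervalIntegral.integral_of_le hs, integral_Ioc_eq_integral_Ioo] at e
  have hm : Measurable fun t : ℝ => ‖gradient φ (y + t • ν)‖ₑ :=
    ((continuous_gradient hφ).comp (by fun_prop)).enorm.measurable
  calc _ ≤ (∫⁻ t in Ioo 0 s, ‖gradient φ (y + t • ν)‖ₑ) ^ 2 := by
        rw [← e]
        gcongr
        refine (enorm_integral_le_lintegral_enorm _).trans (lintegral_mono fun t => ?_)
        exact enorm_gradient_le φ _ hν
    _ ≤ _ := sq_lintegral_le _ hm.aemeasurable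
    _ = _ := by simp

theorem enorm_sq_le_two_mul (a b : ℝ) : ‖a‖ₑ ^ 2 ≤ 2 * ‖b‖ₑ ^ 2 + 2 * ‖b - a‖ₑ ^ 2 := by
  have h : ∀ c : ℝ, ‖c‖ₑ ^ 2 = ENNReal.ofReal (c ^ 2) := fun c => by
    rw [← ofReal_norm, ← ENNReal.ofReal_pow (norm_nonneg _), Real.norm_eq_abs, sq_abs]
  rw [h, h, h, ← ENNReal.ofReal_ofNat 2, ← ENNReal.ofReal_mul (by norm_num),
    ← ENNReal.ofReal_mul (by norm_num), ← ENNReal.ofReal_add (by positivity) (by positivity)]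
  apply ENNReal.ofReal_le_ofReal
  nlinarith [sq_nonneg (2 * b - a)]

/-- The squared `H¹(Ω)` norm of a smooth function. -/
def energy (Ω : Set (E d)) (φ : E d → ℝ) : ℝ≥0∞ :=
  (∫⁻ x in Ω, ‖φ x‖ₑ ^ 2) + ∫⁻ x in Ω, ‖gradient φ x‖ₑ ^ 2

/-- The boundary value at `y` is compared with the values along the vertical segment above `y`;
averaging over the segment and integrating over the boundary leaves two strip integrals. -/
theorem IsPatch.lintegral_frontier_le {Ω : Set (E d)} {x ν : E d}
    {γ : (Submodule.span ℝ {ν})ᗮ → ℝ} {K : ℝ≥0} {r : ℝ} (hΩ : IsOpen Ω)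
    (h : IsPatch Ω x ν γ K r) : ∃ C : ℝ≥0, ∀ φ : E d → ℝ, ContDiff ℝ ∞ φ →
      ∫⁻ y in frontier Ω ∩ Metric.ball x (r / 3), ‖φ y‖ₑ ^ 2 ∂(μHE[d - 1])
        ≤ C * energy Ω φ := by
  obtain ⟨C, hC⟩ := h.lintegral_strip_le hΩ
  have hr := h.pos
  set τ : ℝ≥0 := Real.toNNReal (r / 3) with hτ
  have hτr : ENNReal.ofReal (r / 3) = τ := rfl
  have hτ0 : (τ : ℝ≥0∞) ≠ 0 := by
    rw [← hτr]
    simpa using by positivity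
  have hτ0' : τ ≠ 0 := by simpa using hτ0
  refine ⟨τ⁻¹ * (2 * C + 2 * τ * τ * C), fun φ hφ => ?_⟩
  set μ := (μHE[d - 1] : Measure (E d)).restrict (frontier Ω ∩ Metric.ball x (r / 3))
  have hmφ : Measurable fun y => ‖φ y‖ₑ ^ 2 := hφ.continuous.enorm.measurable.pow_const 2
  have hmg : Measurable fun y => ‖gradient φ y‖ₑ ^ 2 :=
    (continuous_gradient hφ).enorm.measurable.pow_const 2
  have hm1 : Measurable fun y : E d => ∫⁻ s in Ioo 0 (r / 3), ‖φ (y + s • ν)‖ₑ ^ 2 :=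
    Measurable.lintegral_prod_right' (f := fun p : E d × ℝ => ‖φ (p.1 + p.2 • ν)‖ₑ ^ 2)
      (hmφ.comp (by fun_prop))
  have hm2 : Measurable fun y : E d => ∫⁻ s in Ioo 0 (r / 3), ‖gradient φ (y + s • ν)‖ₑ ^ 2 :=
    Measurable.lintegral_prod_right' (f := fun p : E d × ℝ => ‖gradient φ (p.1 + p.2 • ν)‖ₑ ^ 2)
      (hmg.comp (by fun_prop))
  have hpt : ∀ y : E d, τ * ‖φ y‖ₑ ^ 2 ≤ 2 * (∫⁻ s in Ioo 0 (r / 3), ‖φ (y + s • ν)‖ₑ ^ 2)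
      + 2 * τ * τ * ∫⁻ s in Ioo 0 (r / 3), ‖gradient φ (y + s • ν)‖ₑ ^ 2 := by
    intro y
    set I := ∫⁻ s in Ioo 0 (r / 3), ‖gradient φ (y + s • ν)‖ₑ ^ 2 with hI
    have e : τ * ‖φ y‖ₑ ^ 2 = ∫⁻ s in Ioo 0 (r / 3), ‖φ y‖ₑ ^ 2 := by
      rw [setLIntegral_const, Real.volume_Ioo, sub_zero, hτr, mul_comm]
    rw [e]
    calc _ ≤ ∫⁻ s in Ioo 0 (r / 3), (2 * ‖φ (y + s • ν)‖ₑ ^ 2 + 2 * τ * I) := by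
          refine setLIntegral_mono' measurableSet_Ioo fun s hs => ?_
          refine (enorm_sq_le_two_mul _ (φ (y + s • ν))).trans ?_
          rw [mul_assoc]
          gcongr
          refine (enorm_sub_sq_le hφ y h.norm_eq.le hs.1.le).trans ?_
          rw [← hτr, hI]
          gcongr
          · exact hs.2.le
          · exact hs.2.le
      _ = _ := by
          rw [lintegral_add_right _ measurable_const, setLIntegral_const, Real.volume_Ioo,
            sub_zero, hτr, lintegral_const_mul]
          · ring
          · exact hmφ.comp (by fun_prop)
  have hmain : τ * ∫⁻ y, ‖φ y‖ₑ ^ 2 ∂μ ≤ (2 * C + 2 * τ * τ * C) * energy Ω φ := by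
    calc _ = ∫⁻ y, τ * ‖φ y‖ₑ ^ 2 ∂μ := (lintegral_const_mul _ hmφ).symm
      _ ≤ _ := lintegral_mono hpt
      _ = 2 * (∫⁻ y, (∫⁻ s in Ioo 0 (r / 3), ‖φ (y + s • ν)‖ₑ ^ 2) ∂μ) + 2 * τ * τ *
          ∫⁻ y, (∫⁻ s in Ioo 0 (r / 3), ‖gradient φ (y + s • ν)‖ₑ ^ 2) ∂μ := by
        rw [lintegral_add_left (hm1.const_mul _), lintegral_const_mul _ hm1,
          lintegral_const_mul _ hm2]
      _ ≤ 2 * (C * ∫⁻ y in Ω, ‖φ y‖ₑ ^ 2)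
          + 2 * τ * τ * (C * ∫⁻ y in Ω, ‖gradient φ y‖ₑ ^ 2) := by
        gcongr
        · exact hC _ hmφ
        · exact hC _ hmg
      _ ≤ 2 * (C * energy Ω φ) + 2 * τ * τ * (C * energy Ω φ) := by
        gcongr
        · exact le_self_add
        · exact le_add_self
      _ = _ := by ring
  calc _ = (τ : ℝ≥0∞)⁻¹ * (τ * ∫⁻ y, ‖φ y‖ₑ ^ 2 ∂μ) := by
        rw [← mul_assoc, ENNReal.inv_mul_cancel hτ0 ENNReal.coe_ne_top, one_mul]
    _ ≤ (τ : ℝ≥0∞)⁻¹ * ((2 * C + 2 * τ * τ * C) * energy Ω φ) := by gcongr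
    _ = _ := by
        rw [ENNReal.coe_mul, ENNReal.coe_inv hτ0']
        push_cast
        ring

/-- The trace inequality for smooth functions. -/
theorem IsLipschitzDomain.lintegral_surface_le {Ω : Set (E d)} (hΩ : IsLipschitzDomain Ω) :
    ∃ C : ℝ≥0, ∀ φ : E d → ℝ, ContDiff ℝ ∞ φ →
      ∫⁻ y, ‖φ y‖ₑ ^ 2 ∂(surface Ω) ≤ C * energy Ω φ := by
  suffices H : ∃ C : ℝ≥0, ∀ φ : E d → ℝ, ContDiff ℝ ∞ φ →
      ∫⁻ y in frontier Ω ∩ frontier Ω, ‖φ y‖ₑ ^ 2 ∂(μHE[d - 1]) ≤ C * energy Ω φ by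
    simpa [surface] using H
  -- Compactness reduces the estimate to a neighbourhood of each boundary point: it passes to
  -- subsets, and constants add under unions.
  refine hΩ.isCompact_frontier.induction_on (p := fun S => ∃ C : ℝ≥0, ∀ φ : E d → ℝ,
    ContDiff ℝ ∞ φ → ∫⁻ y in frontier Ω ∩ S, ‖φ y‖ₑ ^ 2 ∂(μHE[d - 1]) ≤ C * energy Ω φ)
    ?_ ?_ ?_ ?_
  · exact ⟨0, fun φ _ => by simp⟩
  · rintro S T hST ⟨C, hC⟩
    refine ⟨C, fun φ hφ => le_trans ?_ (hC φ hφ)⟩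
    exact lintegral_mono' (Measure.restrict_mono (inter_subset_inter_right _ hST) le_rfl) le_rfl
  · rintro S T ⟨C, hC⟩ ⟨D, hD⟩
    refine ⟨C + D, fun φ hφ => ?_⟩
    rw [inter_union_distrib_left, ENNReal.coe_add, add_mul]
    exact (lintegral_union_le _ _ _).trans (add_le_add (hC φ hφ) (hD φ hφ))
  · intro x hx
    obtain ⟨ν, γ, K, r, h⟩ := hΩ.exists_patch hx
    have hr := h.pos
    exact ⟨Metric.ball x (r / 3), mem_nhdsWithin_of_mem_nhds (Metric.ball_mem_nhds _ (by positivity)),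
      h.lintegral_frontier_le hΩ.isOpen⟩

theorem enorm_sq_eq {Ω : Set (E d)} (u : H1 Ω) :
    ‖u‖ₑ ^ 2 = (∫⁻ x in Ω, ‖val u x‖ₑ ^ 2) + ∫⁻ x in Ω, ‖grad u x‖ₑ ^ 2 := by
  have h : ‖u‖ ^ 2 = ‖(u : L2Pair Ω).fst‖ ^ 2 + ‖(u : L2Pair Ω).snd‖ ^ 2 :=
    WithLp.prod_norm_sq_eq_of_L2 (u : L2Pair Ω)
  have e1 : ‖(u : L2Pair Ω).fst‖ₑ ^ 2 = ∫⁻ x in Ω, ‖val u x‖ₑ ^ 2 := by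
    rw [Lp.enorm_def, eLpNorm_two_sq]
    rfl
  have e2 : ‖(u : L2Pair Ω).snd‖ₑ ^ 2 = ∫⁻ x in Ω, ‖grad u x‖ₑ ^ 2 := by
    rw [Lp.enorm_def, eLpNorm_two_sq]
    rfl
  rw [← e1, ← e2]
  simp only [← ofReal_norm]
  rw [← ENNReal.ofReal_pow (norm_nonneg _), ← ENNReal.ofReal_pow (norm_nonneg _),
    ← ENNReal.ofReal_pow (norm_nonneg _), h, ENNReal.ofReal_add (by positivity) (by positivity)]

theorem enorm_sq_eq_energy {Ω : Set (E d)} {u : H1 Ω} {φ : E d → ℝ}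
    (h1 : val u =ᵐ[volume.restrict Ω] φ) (h2 : grad u =ᵐ[volume.restrict Ω] gradient φ) :
    ‖u‖ₑ ^ 2 = energy Ω φ := by
  rw [enorm_sq_eq, energy]
  congr 1
  · refine lintegral_congr_ae ?_
    filter_upwards [h1] with x hx
    rw [hx]
  · refine lintegral_congr_ae ?_
    filter_upwards [h2] with x hx
    rw [hx]

/-- The trace inequality is a closed condition, so it passes from smooth pairs to their closure. It
makes the trace graph single-valued. -/
theorem IsLipschitzDomain.norm_le_of_mem_traceGraph {Ω : Set (E d)} (hΩ : IsLipschitzDomain Ω) :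
    ∃ C : ℝ≥0, ∀ p ∈ traceGraph Ω, ‖p.2‖ ≤ C * ‖p.1‖ := by
  obtain ⟨C, hC⟩ := hΩ.lintegral_surface_le
  refine ⟨NNReal.sqrt C, fun p hp => ?_⟩
  have hclosed : IsClosed {p : H1 Ω × Lp ℝ 2 (surface Ω) | ‖p.2‖ ≤ NNReal.sqrt C * ‖p.1‖} :=
    isClosed_le (by fun_prop) (by fun_prop)
  refine closure_minimal ?_ hclosed hp
  rintro p ⟨φ, hφ, h1, h2, h3⟩
  have e1 : ‖p.2‖ₑ ^ 2 = ∫⁻ y, ‖φ y‖ₑ ^ 2 ∂(surface Ω) := by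
    rw [Lp.enorm_def, eLpNorm_two_sq]
    refine lintegral_congr_ae ?_
    filter_upwards [h3] with x hx
    rw [hx]
  have h4 : ‖p.2‖ₑ ^ 2 ≤ C * ‖p.1‖ₑ ^ 2 := by
    rw [e1, enorm_sq_eq_energy h1 h2]
    exact hC φ hφ
  have h5 : ‖p.2‖ₑ ^ 2 ≤ (NNReal.sqrt C * ‖p.1‖ₑ) ^ 2 := by
    rw [mul_pow, ← ENNReal.coe_pow, NNReal.sq_sqrt]
    exact h4
  have h6 : ‖p.2‖ₑ ≤ NNReal.sqrt C * ‖p.1‖ₑ :=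
    (ENNReal.pow_right_strictMono two_ne_zero).le_iff_le.1 h5
  have h7 : ‖p.2‖₊ ≤ NNReal.sqrt C * ‖p.1‖₊ := by
    rw [enorm_eq_nnnorm, enorm_eq_nnnorm, ← ENNReal.coe_mul, ENNReal.coe_le_coe] at h6
    exact h6
  have h8 := NNReal.coe_le_coe.2 h7
  rw [NNReal.coe_mul] at h8
  exact h8

/-- The first projection of the complete trace graph is bounded below by the trace inequality, so
its range is closed; the range contains the dense set of smooth functions. -/
theorem IsLipschitzDomain.exists_mem_traceGraph {Ω : Set (E d)} (hΩ : IsLipschitzDomain Ω)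
    (u : H1 Ω) : ∃ T : Lp ℝ 2 (surface Ω), (u, T) ∈ traceGraph Ω := by
  obtain ⟨C, hC⟩ := hΩ.norm_le_of_mem_traceGraph
  let π : traceGraph Ω →L[ℝ] H1 Ω :=
    (ContinuousLinearMap.fst ℝ (H1 Ω) (Lp ℝ 2 (surface Ω))).comp (traceGraph Ω).subtypeL
  have hanti : AntilipschitzWith (max 1 C) π := by
    refine AddMonoidHomClass.antilipschitz_of_bound π fun p => ?_
    change max ‖p.1.1‖ ‖p.1.2‖ ≤ _ * ‖p.1.1‖
    have h1 := hC p.1 p.2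
    refine max_le ?_ (h1.trans ?_)
    · refine le_mul_of_one_le_left (norm_nonneg _) ?_
      simp
    · gcongr
      simp
  have hcomplete : CompleteSpace (traceGraph Ω) :=
    (Submodule.isClosed_topologicalClosure _).completeSpace_coe
  have hclosed : IsClosed (range π) := hanti.isClosed_range π.uniformContinuous
  have hsub : ((smoothTraces Ω).map (LinearMap.fst ℝ (H1 Ω) (Lp ℝ 2 (surface Ω))) : Set (H1 Ω))
      ⊆ range π := by
    rintro _ ⟨p, hp, rfl⟩
    exact ⟨⟨p, Submodule.le_topologicalClosure _ hp⟩, rfl⟩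
  have hu : u ∈ ((smoothTraces Ω).map
      (LinearMap.fst ℝ (H1 Ω) (Lp ℝ 2 (surface Ω)))).topologicalClosure := by
    rw [dense_smooth hΩ]
    trivial
  obtain ⟨p, hp⟩ := closure_minimal hsub hclosed hu
  refine ⟨p.1.2, ?_⟩
  have : (u, p.1.2) = p.1 := Prod.ext hp.symm rfl
  rw [this]
  exact p.2

theorem IsLipschitzDomain.exists_traceOp {Ω : Set (E d)} (hΩ : IsLipschitzDomain Ω) :
    ∃ tr : H1 Ω →L[ℝ] Lp ℝ 2 (surface Ω), ∀ u T, (u, T) ∈ traceGraph Ω ↔ T = tr u := by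
  obtain ⟨C, hC⟩ := hΩ.norm_le_of_mem_traceGraph
  choose f hf using hΩ.exists_mem_traceGraph
  have huniq : ∀ u T, (u, T) ∈ traceGraph Ω → T = f u := by
    intro u T h
    have h1 : (0, T - f u) ∈ traceGraph Ω := by
      have := (traceGraph Ω).sub_mem h (hf u)
      rwa [Prod.mk_sub_mk, sub_self] at this
    have h2 : ‖T - f u‖ ≤ C * ‖(0 : H1 Ω)‖ := hC (0, T - f u) h1
    rw [norm_zero, mul_zero] at h2
    exact sub_eq_zero.1 (norm_le_zero_iff.1 h2)
  have hadd : ∀ u w, f (u + w) = f u + f w := by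
    intro u w
    have h : (u + w, f u + f w) ∈ traceGraph Ω := (traceGraph Ω).add_mem (hf u) (hf w)
    exact (huniq _ _ h).symm
  have hsmul : ∀ (a : ℝ) u, f (a • u) = a • f u := by
    intro a u
    have h : (a • u, a • f u) ∈ traceGraph Ω := (traceGraph Ω).smul_mem a (hf u)
    exact (huniq _ _ h).symm
  have hb : ∀ u, ‖f u‖ ≤ C * ‖u‖ := fun u => hC (u, f u) (hf u)
  let L : H1 Ω →ₗ[ℝ] Lp ℝ 2 (surface Ω) :=
    { toFun := f
      map_add' := hadd
      map_smul' := hsmul }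
  refine ⟨L.mkContinuous C hb, fun u T => ⟨huniq u T, fun h => ?_⟩⟩
  have h' : T = f u := h
  rw [h']
  exact hf u

/-- The trace operator on a Lipschitz domain. -/
def traceOp {Ω : Set (E d)} (hΩ : IsLipschitzDomain Ω) : H1 Ω →L[ℝ] Lp ℝ 2 (surface Ω) :=
  hΩ.exists_traceOp.choose

theorem mem_traceGraph_iff {Ω : Set (E d)} (hΩ : IsLipschitzDomain Ω) (u : H1 Ω)
    (T : Lp ℝ 2 (surface Ω)) : (u, T) ∈ traceGraph Ω ↔ T = traceOp hΩ u :=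
  hΩ.exists_traceOp.choose_spec u T

/-- Existence of a trace gives the choice in the definition of `trace` its intended meaning. -/
theorem isTrace_trace {Ω : Set (E d)} (hΩ : IsLipschitzDomain Ω) (u : H1 Ω) :
    IsTrace u (trace u) := by
  have h := (mem_traceGraph_iff hΩ u _).2 rfl
  exact Classical.epsilon_spec (p := IsTrace u) ⟨⟨traceOp hΩ u, ⟨_, h, rfl⟩⟩, h⟩

theorem coe_trace {Ω : Set (E d)} (hΩ : IsLipschitzDomain Ω) (u : H1 Ω) :
    (trace u : Lp ℝ 2 (surface Ω)) = traceOp hΩ u :=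
  (mem_traceGraph_iff hΩ u _).1 (isTrace_trace hΩ u)

theorem traceOp_smoothH1 {Ω : Set (E d)} (hΩ : IsLipschitzDomain Ω) {φ : E d → ℝ}
    (hφ : ContDiff ℝ ∞ φ) :
    traceOp hΩ (smoothH1 hΩ.isBounded hφ) = (hΩ.memLp_surface hφ.continuous).toLp φ :=
  ((mem_traceGraph_iff hΩ _ _).1
    (Submodule.le_topologicalClosure _ (smoothH1_mem_smoothTraces hΩ hφ))).symm

theorem dense_range_smooth {Ω : Set (E d)} (hΩ : IsLipschitzDomain Ω) (u : H1 Ω) :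
    u ∈ closure {w : H1 Ω | ∃ (φ : E d → ℝ) (hφ : ContDiff ℝ ∞ φ), w = smoothH1 hΩ.isBounded hφ} := by
  have hu : u ∈ ((smoothTraces Ω).map
      (LinearMap.fst ℝ (H1 Ω) (Lp ℝ 2 (surface Ω)))).topologicalClosure := by
    rw [dense_smooth hΩ]
    trivial
  refine closure_mono ?_ hu
  rintro _ ⟨p, ⟨φ, hφ, h1, -, -⟩, rfl⟩
  exact ⟨φ, hφ, H1.ext hΩ.isOpen (h1.trans (val_smoothH1 _ hφ).symm)⟩

/-! ### The Poincaré inequality -/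

/-- The Dirichlet energy of a smooth function. -/
def dirichlet (Ω : Set (E d)) (φ : E d → ℝ) : ℝ≥0∞ := ∫⁻ x in Ω, ‖gradient φ x‖ₑ ^ 2

/-- The increment is controlled by the gradient along the segment. After exchanging integrals, each
slice is a translate of the gradient integral and costs at most the full Dirichlet energy. -/
theorem lintegral_translate_sub_le {Ω A : Set (E d)} (hΩ : IsOpen Ω) {ν : E d} (hν : ‖ν‖ ≤ 1)
    {τ : ℝ} (hτ : 0 ≤ τ) (hA : MeasurableSet A) (h : ∀ y ∈ A, ∀ t, 0 < t → t < τ → y + t • ν ∈ Ω)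
    {φ : E d → ℝ} (hφ : ContDiff ℝ ∞ φ) :
    ∫⁻ y in A, ‖φ (y + τ • ν) - φ y‖ₑ ^ 2 ≤ ENNReal.ofReal τ ^ 2 * dirichlet Ω φ := by
  set F : E d → ℝ≥0∞ := Ω.indicator fun y => ‖gradient φ y‖ₑ ^ 2 with hF
  have hFm : Measurable F :=
    ((continuous_gradient hφ).enorm.measurable.pow_const 2).indicator hΩ.measurableSet
  have hFp : Measurable fun p : E d × ℝ => F (p.1 + p.2 • ν) := hFm.comp (by fun_prop)
  calc _ ≤ ∫⁻ y in A, ENNReal.ofReal τ * ∫⁻ t in Ioo 0 τ, F (y + t • ν) := by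
        refine setLIntegral_mono' hA fun y hy => ?_
        refine (enorm_sub_sq_le hφ y hν hτ).trans ?_
        gcongr 1
        refine setLIntegral_mono' measurableSet_Ioo fun t ht => ?_
        rw [hF, indicator_of_mem (h y hy t ht.1 ht.2)]
    _ = ENNReal.ofReal τ * ∫⁻ y in A, ∫⁻ t in Ioo 0 τ, F (y + t • ν) :=
        lintegral_const_mul _ (Measurable.lintegral_prod_right' hFp)
    _ = ENNReal.ofReal τ * ∫⁻ t in Ioo 0 τ, ∫⁻ y in A, F (y + t • ν) := by
        rw [lintegral_lintegral_swap hFp.aemeasurable]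
    _ ≤ ENNReal.ofReal τ * ∫⁻ t in Ioo 0 τ, dirichlet Ω φ := by
        gcongr with t
        refine (setLIntegral_le_lintegral _ _).trans ?_
        rw [lintegral_add_right_eq_self F (t • ν), hF, lintegral_indicator hΩ.measurableSet,
          dirichlet]
    _ = _ := by
        rw [setLIntegral_const, Real.volume_Ioo, sub_zero]
        ring

/-- `A` satisfies a Poincaré inequality with respect to the Dirichlet energy on `Ω`. -/
def IsGood (Ω A : Set (E d)) : Prop :=
  ∃ C : ℝ≥0, ∀ φ : E d → ℝ, ContDiff ℝ ∞ φ → ∃ c : ℝ,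
    ∫⁻ y in A, ‖φ y - c‖ₑ ^ 2 ≤ C * dirichlet Ω φ

theorem enorm_sub_sq_le_two_mul (a b c : ℝ) :
    ‖a - c‖ₑ ^ 2 ≤ 2 * ‖b - c‖ₑ ^ 2 + 2 * ‖b - a‖ₑ ^ 2 := by
  have := enorm_sq_le_two_mul (a - c) (b - c)
  rwa [sub_sub_sub_cancel_right] at this

/-- The translation estimate is averaged over base points `a` in the ball and shifts of length below
`2ρ`. Some `a` does no worse than average, and `φ a` is then an admissible constant. The ball of
radius `3ρ` contains all the segments used. -/
theorem isGood_ball {Ω : Set (E d)} (hΩ : IsOpen Ω) {p : E d} {ρ : ℝ} (hρ : 0 < ρ)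
    (h : Metric.ball p (3 * ρ) ⊆ Ω) : IsGood Ω (Metric.ball p ρ) := by
  set V := volume (Metric.ball (0 : E d) (2 * ρ)) with hV
  set W := volume (Metric.ball p ρ) with hW
  have hV' : V ≠ ⊤ := measure_ball_lt_top.ne
  have hW0 : W ≠ 0 := (Metric.measure_ball_pos volume p hρ).ne'
  have hW' : W ≠ ⊤ := measure_ball_lt_top.ne
  have hC : ENNReal.ofReal (2 * ρ) ^ 2 * V / W ≠ ⊤ :=
    ENNReal.div_ne_top (ENNReal.mul_ne_top (ENNReal.pow_ne_top ENNReal.ofReal_ne_top) hV') hW0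
  refine ⟨(ENNReal.ofReal (2 * ρ) ^ 2 * V / W).toNNReal, fun φ hφ => ?_⟩
  rw [ENNReal.coe_toNNReal hC]
  have hm : Measurable fun q : E d × E d => ‖φ (q.1 + q.2) - φ q.1‖ₑ ^ 2 := by
    have : Continuous fun q : E d × E d => φ (q.1 + q.2) - φ q.1 := by
      have := hφ.continuous
      fun_prop
    exact this.enorm.measurable.pow_const 2
  have hD : Measurable fun a : E d =>
      ∫⁻ v in Metric.ball (0 : E d) (2 * ρ), ‖φ (a + v) - φ a‖ₑ ^ 2 :=
    Measurable.lintegral_prod_right' hm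
  have htot : ∫⁻ a in Metric.ball p ρ, ∫⁻ v in Metric.ball (0 : E d) (2 * ρ),
      ‖φ (a + v) - φ a‖ₑ ^ 2 ≤ ENNReal.ofReal (2 * ρ) ^ 2 * dirichlet Ω φ * V := by
    rw [lintegral_lintegral_swap hm.aemeasurable, hV, ← setLIntegral_const]
    refine setLIntegral_mono' measurableSet_ball fun v hv => ?_
    have hv' : ‖v‖ < 2 * ρ := by simpa using hv
    -- All shifts are given the common step `2ρ` and a direction of norm at most one, so one bound
    -- serves every `v`.
    have e : v = (2 * ρ) • ((2 * ρ)⁻¹ • v) := by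
      rw [smul_smul, mul_inv_cancel₀ (by positivity), one_smul]
    have hn : ‖(2 * ρ)⁻¹ • v‖ ≤ 1 := by
      rw [norm_smul, norm_inv, Real.norm_of_nonneg (by positivity), inv_mul_le_iff₀ (by positivity)]
      linarith
    have key := lintegral_translate_sub_le hΩ hn (τ := 2 * ρ) (by positivity)
      (A := Metric.ball p ρ) measurableSet_ball ?_ hφ
    · rwa [← e] at key
    · intro y hy t ht ht'
      apply h
      rw [Metric.mem_ball, dist_eq_norm] at hy ⊢
      calc ‖y + t • (2 * ρ)⁻¹ • v - p‖ = ‖(y - p) + t • (2 * ρ)⁻¹ • v‖ := by congr 1; abel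
        _ ≤ ‖y - p‖ + t * ‖(2 * ρ)⁻¹ • v‖ := by
          refine (norm_add_le _ _).trans ?_
          rw [norm_smul t, Real.norm_of_nonneg ht.le]
        _ < 3 * ρ := by nlinarith [norm_nonneg ((2 * ρ)⁻¹ • v)]
  obtain ⟨a, ha, hle⟩ := exists_le_setLAverage (μ := volume) hW0 hW' hD.aemeasurable
  refine ⟨φ a, ?_⟩
  calc ∫⁻ y in Metric.ball p ρ, ‖φ y - φ a‖ₑ ^ 2
      ≤ ∫⁻ v in Metric.ball (0 : E d) (2 * ρ), ‖φ (a + v) - φ a‖ₑ ^ 2 := by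
        rw [← lintegral_indicator measurableSet_ball, ← lintegral_indicator measurableSet_ball,
          ← lintegral_add_left_eq_self _ a]
        refine lintegral_mono fun v => ?_
        by_cases hv : a + v ∈ Metric.ball p ρ
        · have : v ∈ Metric.ball (0 : E d) (2 * ρ) := by
            rw [Metric.mem_ball] at hv ha
            rw [mem_ball_zero_iff]
            have h1 := dist_triangle_right (a + v) a p
            have h2 : dist (a + v) a = ‖v‖ := by simp [dist_eq_norm]
            linarith
          simp [indicator_of_mem hv, indicator_of_mem this]
        · simp [indicator_of_notMem hv]
    _ ≤ _ := hle
    _ ≤ (ENNReal.ofReal (2 * ρ) ^ 2 * dirichlet Ω φ * V) / W := by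
        rw [setLAverage_eq]
        exact ENNReal.div_le_div_right htot _
    _ = _ := by
        rw [ENNReal.div_eq_inv_mul, ENNReal.div_eq_inv_mul]
        ring

/-- The shift by `τν` carries the part of `Ω` near `x` into a ball whose threefold enlargement lies
in `Ω`; the constant of that ball is kept, at the cost of one translation estimate. -/
theorem IsLipschitzDomain.exists_isGood_ball_inter {Ω : Set (E d)} (hΩ : IsLipschitzDomain Ω)
    {x : E d} (hx : x ∈ closure Ω) : ∃ ρ > 0, IsGood Ω (Metric.ball x ρ ∩ Ω) := by
  obtain ⟨ν, hν, ε, hε, δ, hδ, hcone⟩ := hΩ.exists_cone hx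
  set τ := ε / 2 with hτ
  have hτ0 : 0 < τ := by positivity
  set ρ := min (δ * τ / 3) ε with hρ
  have hρ0 : 0 < ρ := lt_min (by positivity) hε
  have hρ1 : ρ ≤ δ * τ / 3 := min_le_left _ _
  have hρ2 : ρ ≤ ε := min_le_right _ _
  have hball : Metric.ball (x + τ • ν) (3 * ρ) ⊆ Ω := by
    refine subset_trans ?_ (hcone x (Metric.mem_ball_self hε) hx τ hτ0 (by linarith))
    exact Metric.ball_subset_closedBall.trans (Metric.closedBall_subset_closedBall (by linarith))
  obtain ⟨C, hC⟩ := isGood_ball hΩ.isOpen hρ0 hball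
  have hAm : MeasurableSet (Metric.ball x ρ ∩ Ω) := measurableSet_ball.inter hΩ.isOpen.measurableSet
  refine ⟨ρ, hρ0, 2 * C + 2 * Real.toNNReal τ ^ 2, fun φ hφ => ?_⟩
  obtain ⟨c, hc⟩ := hC φ hφ
  refine ⟨c, ?_⟩
  have ht := lintegral_translate_sub_le hΩ.isOpen hν hτ0.le hAm (fun y hy t ht0 htτ =>
    hcone y (Metric.ball_subset_ball hρ2 hy.1) (subset_closure hy.2) t ht0 (by linarith)
      (Metric.mem_closedBall_self (by positivity))) hφ
  have hcm : Measurable fun y => ‖φ y - c‖ₑ ^ 2 :=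
    (hφ.continuous.sub continuous_const).enorm.measurable.pow_const 2
  have hcm2 : Measurable fun y => ‖φ (y + τ • ν) - φ y‖ₑ ^ 2 := by
    have : Continuous fun y => φ (y + τ • ν) - φ y := by
      have := hφ.continuous
      fun_prop
    exact this.enorm.measurable.pow_const 2
  have hshift : ∫⁻ y in Metric.ball x ρ ∩ Ω, ‖φ (y + τ • ν) - c‖ₑ ^ 2
      ≤ ∫⁻ y in Metric.ball (x + τ • ν) ρ, ‖φ y - c‖ₑ ^ 2 := by
    rw [← lintegral_indicator hAm, ← lintegral_indicator measurableSet_ball,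
      ← lintegral_add_right_eq_self ((Metric.ball (x + τ • ν) ρ).indicator _) (τ • ν)]
    refine lintegral_mono fun y => ?_
    by_cases hy : y ∈ Metric.ball x ρ ∩ Ω
    · have : y + τ • ν ∈ Metric.ball (x + τ • ν) ρ := by simpa using hy.1
      simp [indicator_of_mem hy, indicator_of_mem this]
    · simp [indicator_of_notMem hy]
  calc _ ≤ ∫⁻ y in Metric.ball x ρ ∩ Ω,
        (2 * ‖φ (y + τ • ν) - c‖ₑ ^ 2 + 2 * ‖φ (y + τ • ν) - φ y‖ₑ ^ 2) :=
        lintegral_mono fun y => enorm_sub_sq_le_two_mul _ _ _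
    _ = 2 * (∫⁻ y in Metric.ball x ρ ∩ Ω, ‖φ (y + τ • ν) - c‖ₑ ^ 2)
        + 2 * ∫⁻ y in Metric.ball x ρ ∩ Ω, ‖φ (y + τ • ν) - φ y‖ₑ ^ 2 := by
        rw [lintegral_add_right _ (hcm2.const_mul 2), lintegral_const_mul _ hcm2,
          lintegral_const_mul]
        exact hcm.comp (by fun_prop)
    _ ≤ 2 * (C * dirichlet Ω φ) + 2 * (ENNReal.ofReal τ ^ 2 * dirichlet Ω φ) := by
        gcongr
        exact hshift.trans hc
    _ = _ := by
        rw [show ENNReal.ofReal τ = (Real.toNNReal τ : ℝ≥0∞) from rfl]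
        push_cast
        ring

/-- Both constants approximate `φ` on the overlap, which has positive measure, so their difference
is controlled by the Dirichlet energy and `c₁` may replace `c₂` on `B`. -/
theorem IsGood.union {Ω A B : Set (E d)} (hA : IsGood Ω A) (hB : IsGood Ω B)
    (hAB : volume (A ∩ B) ≠ 0) (hABt : volume (A ∩ B) ≠ ⊤) (hBt : volume B ≠ ⊤) :
    IsGood Ω (A ∪ B) := by
  obtain ⟨C₁, h₁⟩ := hA
  obtain ⟨C₂, h₂⟩ := hB
  set k : ℝ≥0 := (volume (A ∩ B)).toNNReal with hk
  set b : ℝ≥0 := (volume B).toNNReal with hb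
  have hk' : volume (A ∩ B) = k := (ENNReal.coe_toNNReal hABt).symm
  have hb' : volume B = b := (ENNReal.coe_toNNReal hBt).symm
  have hk0 : k ≠ 0 := by
    intro h0
    rw [hk', h0] at hAB
    simp at hAB
  refine ⟨C₁ + (2 * C₂ + 2 * b * (k⁻¹ * (2 * C₂ + 2 * C₁))), fun φ hφ => ?_⟩
  obtain ⟨c₁, hc₁⟩ := h₁ φ hφ
  obtain ⟨c₂, hc₂⟩ := h₂ φ hφ
  refine ⟨c₁, ?_⟩
  have hm : ∀ c : ℝ, Measurable fun y => ‖φ y - c‖ₑ ^ 2 := fun c =>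
    (hφ.continuous.sub continuous_const).enorm.measurable.pow_const 2
  have hcc : ‖c₁ - c₂‖ₑ ^ 2 ≤ (k⁻¹ * (2 * C₂ + 2 * C₁) : ℝ≥0) * dirichlet Ω φ := by
    have h3 : k * ‖c₁ - c₂‖ₑ ^ 2 ≤ (2 * C₂ + 2 * C₁) * dirichlet Ω φ := by
      calc _ = ∫⁻ y in A ∩ B, ‖c₁ - c₂‖ₑ ^ 2 := by rw [setLIntegral_const, hk', mul_comm]
        _ ≤ ∫⁻ y in A ∩ B, (2 * ‖φ y - c₂‖ₑ ^ 2 + 2 * ‖φ y - c₁‖ₑ ^ 2) :=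
          lintegral_mono fun y => enorm_sub_sq_le_two_mul _ _ _
        _ = 2 * (∫⁻ y in A ∩ B, ‖φ y - c₂‖ₑ ^ 2) + 2 * ∫⁻ y in A ∩ B, ‖φ y - c₁‖ₑ ^ 2 := by
          rw [lintegral_add_right _ ((hm c₁).const_mul 2), lintegral_const_mul _ (hm c₁),
            lintegral_const_mul _ (hm c₂)]
        _ ≤ 2 * (C₂ * dirichlet Ω φ) + 2 * (C₁ * dirichlet Ω φ) := by
          gcongr
          · exact (lintegral_mono_set inter_subset_right).trans hc₂
          · exact (lintegral_mono_set inter_subset_left).trans hc₁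
        _ = _ := by ring
    calc _ = (k : ℝ≥0∞)⁻¹ * (k * ‖c₁ - c₂‖ₑ ^ 2) := by
          rw [← mul_assoc, ENNReal.inv_mul_cancel (by simpa using hk0) ENNReal.coe_ne_top, one_mul]
      _ ≤ (k : ℝ≥0∞)⁻¹ * ((2 * C₂ + 2 * C₁) * dirichlet Ω φ) := by gcongr
      _ = _ := by
          rw [ENNReal.coe_mul, ENNReal.coe_inv hk0]
          push_cast
          ring
  have hBc : ∫⁻ y in B, ‖φ y - c₁‖ₑ ^ 2 ≤ 2 * (C₂ * dirichlet Ω φ)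
      + 2 * (b * ((k⁻¹ * (2 * C₂ + 2 * C₁) : ℝ≥0) * dirichlet Ω φ)) := by
    calc _ ≤ ∫⁻ y in B, (2 * ‖φ y - c₂‖ₑ ^ 2 + 2 * ‖c₁ - c₂‖ₑ ^ 2) := by
          refine lintegral_mono fun y => ?_
          have := enorm_sub_sq_le_two_mul (-c₁) (-c₂) (-φ y)
          simpa [sub_eq_add_neg, add_comm] using this
      _ = 2 * (∫⁻ y in B, ‖φ y - c₂‖ₑ ^ 2) + 2 * (b * ‖c₁ - c₂‖ₑ ^ 2) := by
          rw [lintegral_add_right _ measurable_const, lintegral_const_mul _ (hm c₂),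
            setLIntegral_const, hb']
          ring
      _ ≤ _ := by gcongr
  calc _ ≤ (∫⁻ y in A, ‖φ y - c₁‖ₑ ^ 2) + ∫⁻ y in B, ‖φ y - c₁‖ₑ ^ 2 := lintegral_union_le _ _ _
    _ ≤ C₁ * dirichlet Ω φ + (2 * (C₂ * dirichlet Ω φ)
      + 2 * (b * ((k⁻¹ * (2 * C₂ + 2 * C₁) : ℝ≥0) * dirichlet Ω φ))) := add_le_add hc₁ hBc
    _ = _ := by
        push_cast
        ring

/-- A bounded Lipschitz domain satisfies the Poincaré inequality. -/
theorem IsLipschitzDomain.isGood {Ω : Set (E d)} (hΩ : IsLipschitzDomain Ω) : IsGood Ω Ω := by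
  have hfin : ∀ {A : Set (E d)}, A ⊆ Ω → volume A ≠ ⊤ := fun hA =>
    ((hΩ.isBounded.subset hA).measure_lt_top).ne
  have hunion : ∀ {A B : Set (E d)}, IsOpen A → IsOpen B → A ⊆ Ω → B ⊆ Ω → (A ∩ B).Nonempty →
      IsGood Ω A → IsGood Ω B → IsGood Ω (A ∪ B) := fun hA hB hA' hB' hne h1 h2 =>
    h1.union h2 ((hA.inter hB).measure_pos volume hne).ne'
      (hfin (inter_subset_left.trans hA')) (hfin hB')
  obtain ⟨x₀, hx₀⟩ := hΩ.isConnected.nonempty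
  -- The points that share a good open set with `x₀`. This set is open and relatively closed, so it
  -- contains the connected set `Ω`.
  set S : Set (E d) := {x | ∃ A, IsOpen A ∧ A ⊆ Ω ∧ IsGood Ω A ∧ x₀ ∈ A ∧ x ∈ A} with hS
  have hSopen : IsOpen S := by
    rw [isOpen_iff_mem_nhds]
    rintro x ⟨A, hA, hAΩ, hg, h0, hxA⟩
    filter_upwards [hA.mem_nhds hxA] with y hy
    exact ⟨A, hA, hAΩ, hg, h0, hy⟩
  have hx₀S : x₀ ∈ S := by
    obtain ⟨ρ, hρ, hg⟩ := hΩ.exists_isGood_ball_inter (subset_closure hx₀)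
    have : x₀ ∈ Metric.ball x₀ ρ ∩ Ω := ⟨Metric.mem_ball_self hρ, hx₀⟩
    exact ⟨_, Metric.isOpen_ball.inter hΩ.isOpen, inter_subset_right, hg, this, this⟩
  have hext : ∀ {x : E d} {ρ : ℝ}, IsGood Ω (Metric.ball x ρ ∩ Ω) →
      (Metric.ball x ρ ∩ Ω ∩ S).Nonempty → ∃ A, IsOpen A ∧ A ⊆ Ω ∧ IsGood Ω A ∧ x₀ ∈ A ∧
        Metric.ball x ρ ∩ Ω ⊆ A := by
    rintro x ρ hg ⟨y, hy, A, hA, hAΩ, hgA, h0, hyA⟩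
    have hO : IsOpen (Metric.ball x ρ ∩ Ω) := Metric.isOpen_ball.inter hΩ.isOpen
    exact ⟨A ∪ (Metric.ball x ρ ∩ Ω), hA.union hO, union_subset hAΩ inter_subset_right,
      hunion hA hO hAΩ inter_subset_right ⟨y, hyA, hy⟩ hgA hg, Or.inl h0, subset_union_right⟩
  have hΩS : Ω ⊆ S := by
    refine hΩ.isConnected.isPreconnected.subset_of_closure_inter_subset hSopen ⟨x₀, hx₀, hx₀S⟩ ?_
    rintro x ⟨hxc, hxΩ⟩
    obtain ⟨ρ, hρ, hg⟩ := hΩ.exists_isGood_ball_inter (subset_closure hxΩ)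
    have hxb : x ∈ Metric.ball x ρ ∩ Ω := ⟨Metric.mem_ball_self hρ, hxΩ⟩
    obtain ⟨A, hA, hAΩ, hgA, h0, hsub⟩ := hext hg
      (mem_closure_iff.1 hxc _ (Metric.isOpen_ball.inter hΩ.isOpen) hxb)
    exact ⟨A, hA, hAΩ, hgA, h0, hsub hxb⟩
  -- Compactness of the closure reduces to finitely many unions up to the boundary. Requiring every
  -- piece to contain `x₀` guarantees the overlaps.
  have hp : ∃ A, IsOpen A ∧ A ⊆ Ω ∧ IsGood Ω A ∧ x₀ ∈ A ∧ closure Ω ∩ Ω ⊆ A := by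
    refine hΩ.isBounded.isCompact_closure.induction_on
      (p := fun T => ∃ A, IsOpen A ∧ A ⊆ Ω ∧ IsGood Ω A ∧ x₀ ∈ A ∧ T ∩ Ω ⊆ A) ?_ ?_ ?_ ?_
    · obtain ⟨A, hA, hAΩ, hgA, h0, -⟩ := hx₀S
      exact ⟨A, hA, hAΩ, hgA, h0, by simp⟩
    · rintro T T' hT ⟨A, hA, hAΩ, hgA, h0, hsub⟩
      exact ⟨A, hA, hAΩ, hgA, h0, (inter_subset_inter_left _ hT).trans hsub⟩
    · rintro T T' ⟨A, hA, hAΩ, hgA, h0, hsub⟩ ⟨A', hA', hAΩ', hgA', h0', hsub'⟩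
      refine ⟨A ∪ A', hA.union hA', union_subset hAΩ hAΩ',
        hunion hA hA' hAΩ hAΩ' ⟨x₀, h0, h0'⟩ hgA hgA', Or.inl h0, ?_⟩
      rw [union_inter_distrib_right]
      exact union_subset_union hsub hsub'
    · intro x hx
      obtain ⟨ρ, hρ, hg⟩ := hΩ.exists_isGood_ball_inter hx
      obtain ⟨y, hy⟩ := mem_closure_iff.1 hx _ Metric.isOpen_ball (Metric.mem_ball_self hρ)
      exact ⟨_, mem_nhdsWithin_of_mem_nhds (Metric.ball_mem_nhds x hρ),
        hext hg ⟨y, hy, hΩS hy.2⟩⟩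
  obtain ⟨A, -, hAΩ, hgA, -, hsub⟩ := hp
  have : A = Ω := Subset.antisymm hAΩ fun x hx => hsub ⟨subset_closure hx, hx⟩
  rwa [this] at hgA

/-- The gradient as a continuous linear map. -/
def gradL (Ω : Set (E d)) : H1 Ω →L[ℝ] Lp (E d) 2 (volume.restrict Ω) :=
  (WithLp.sndL 2 ℝ _ _).comp (H1 Ω).subtypeL

theorem coe_gradL {Ω : Set (E d)} (u : H1 Ω) : (gradL Ω u : E d → E d) = grad u := rfl

/-- The boundary integral of the trace. -/
def bdryMean {Ω : Set (E d)} (hΩ : IsLipschitzDomain Ω) : H1 Ω →L[ℝ] ℝ :=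
  (innerSL ℝ ((hΩ.memLp_surface continuous_const (f := fun _ => (1 : ℝ))).toLp _)).comp (traceOp hΩ)

theorem bdryMean_apply {Ω : Set (E d)} (hΩ : IsLipschitzDomain Ω) (u : H1 Ω) :
    bdryMean hΩ u = ∫ x, traceOp hΩ u x ∂(surface Ω) := by
  rw [bdryMean, ContinuousLinearMap.comp_apply, innerSL_apply_apply, L2.inner_def]
  apply integral_congr_ae
  filter_upwards [(hΩ.memLp_surface continuous_const (f := fun _ => (1 : ℝ))).coeFn_toLp] with x hx
  rw [hx]
  simp

/-- The constant function `1`. -/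
def oneH1 {Ω : Set (E d)} (hΩ : IsLipschitzDomain Ω) : H1 Ω :=
  smoothH1 hΩ.isBounded (contDiff_const (c := (1 : ℝ)))

theorem val_oneH1 {Ω : Set (E d)} (hΩ : IsLipschitzDomain Ω) :
    val (oneH1 hΩ) =ᵐ[volume.restrict Ω] fun _ => 1 := val_smoothH1 _ _

theorem gradL_oneH1 {Ω : Set (E d)} (hΩ : IsLipschitzDomain Ω) : gradL Ω (oneH1 hΩ) = 0 := by
  apply Lp.ext
  filter_upwards [grad_smoothH1 hΩ.isBounded (contDiff_const (c := (1 : ℝ))),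
    Lp.coeFn_zero (E d) 2 (volume.restrict Ω)] with x h1 h2
  rw [h2]
  exact h1.trans (gradient_fun_const x (1 : ℝ))

theorem traceOp_oneH1 {Ω : Set (E d)} (hΩ : IsLipschitzDomain Ω) :
    traceOp hΩ (oneH1 hΩ) =ᵐ[surface Ω] fun _ => 1 := by
  rw [oneH1, traceOp_smoothH1]
  exact MemLp.coeFn_toLp _

theorem bdryMean_oneH1_pos [NeZero d] {Ω : Set (E d)} (hΩ : IsLipschitzDomain Ω) :
    0 < bdryMean hΩ (oneH1 hΩ) := by
  have := hΩ.isFiniteMeasure_surface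
  rw [bdryMean_apply, integral_congr_ae (traceOp_oneH1 hΩ), integral_const, smul_eq_mul, mul_one]
  exact ENNReal.toReal_pos hΩ.surface_univ_pos.ne' (measure_ne_top _ _)

theorem norm_le_of_enorm_sq_le {F G : Type*} [NormedAddCommGroup F] [NormedAddCommGroup G]
    {v : F} {w : G} {D : ℝ≥0} (h : ‖v‖ₑ ^ 2 ≤ D * ‖w‖ₑ ^ 2) : ‖v‖ ≤ NNReal.sqrt D * ‖w‖ := by
  have h5 : ‖v‖ₑ ^ 2 ≤ (NNReal.sqrt D * ‖w‖ₑ) ^ 2 := by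
    rw [mul_pow, ← ENNReal.coe_pow, NNReal.sq_sqrt]
    exact h
  have h6 := (ENNReal.pow_right_strictMono two_ne_zero).le_iff_le.1 h5
  rw [enorm_eq_nnnorm, enorm_eq_nnnorm, ← ENNReal.coe_mul, ENNReal.coe_le_coe] at h6
  have h8 := NNReal.coe_le_coe.2 h6
  rw [NNReal.coe_mul] at h8
  exact h8

theorem IsLipschitzDomain.exists_norm_smooth_sub_const_le {Ω : Set (E d)}
    (hΩ : IsLipschitzDomain Ω) : ∃ k : ℝ≥0, ∀ {φ : E d → ℝ} (hφ : ContDiff ℝ ∞ φ), ∃ c : ℝ,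
      ‖smoothH1 hΩ.isBounded hφ - c • oneH1 hΩ‖ ≤ k * ‖gradL Ω (smoothH1 hΩ.isBounded hφ)‖ := by
  obtain ⟨D, hD⟩ := hΩ.isGood
  refine ⟨NNReal.sqrt (D + 1), fun {φ} hφ => ?_⟩
  obtain ⟨c, hc⟩ := hD φ hφ
  refine ⟨c, norm_le_of_enorm_sq_le ?_⟩
  have hgv : gradL Ω (smoothH1 hΩ.isBounded hφ - c • oneH1 hΩ)
      = gradL Ω (smoothH1 hΩ.isBounded hφ) := by
    rw [map_sub, map_smul, gradL_oneH1, smul_zero, sub_zero]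
  have hgw : ‖gradL Ω (smoothH1 hΩ.isBounded hφ)‖ₑ ^ 2 = dirichlet Ω φ := by
    rw [Lp.enorm_def, eLpNorm_two_sq]
    refine lintegral_congr_ae ?_
    filter_upwards [grad_smoothH1 hΩ.isBounded hφ] with x hx
    rw [coe_gradL, hx]
  have e1 : ∫⁻ x in Ω, ‖val (smoothH1 hΩ.isBounded hφ - c • oneH1 hΩ) x‖ₑ ^ 2
      = ∫⁻ x in Ω, ‖φ x - c‖ₑ ^ 2 := by
    refine lintegral_congr_ae ?_
    have hs : val (c • oneH1 hΩ) =ᵐ[volume.restrict Ω] c • val (oneH1 hΩ) := Lp.coeFn_smul _ _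
    filter_upwards [val_sub (smoothH1 hΩ.isBounded hφ) (c • oneH1 hΩ), hs,
      val_smoothH1 hΩ.isBounded hφ, val_oneH1 hΩ] with x h1 h2 h3 h4
    rw [h1, Pi.sub_apply, h2, Pi.smul_apply, h3, h4, smul_eq_mul, mul_one]
  have e2 : ∫⁻ x in Ω, ‖grad (smoothH1 hΩ.isBounded hφ - c • oneH1 hΩ) x‖ₑ ^ 2
      = ‖gradL Ω (smoothH1 hΩ.isBounded hφ)‖ₑ ^ 2 := by
    rw [← hgv, Lp.enorm_def, eLpNorm_two_sq]
    rfl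
  rw [enorm_sq_eq, e1, e2, ENNReal.coe_add, add_mul, ENNReal.coe_one, one_mul]
  gcongr
  rw [hgw]
  exact hc

/-- Split `w = (w - c e) + c e`. The first part is bounded by `G w`; applying `m` then bounds `|c|`,
as `m e > 0`. The resulting inequality is closed and extends from the dense set. -/
theorem norm_le_of_dense {V W : Type*} [NormedAddCommGroup V] [NormedSpace ℝ V]
    [NormedAddCommGroup W] [NormedSpace ℝ W] (G : V →L[ℝ] W) (m : V →L[ℝ] ℝ) (e : V)
    (hm : 0 < m e) {S : Set V} (hS : ∀ u, u ∈ closure S) {k : ℝ} (hk0 : 0 ≤ k)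
    (hk : ∀ w ∈ S, ∃ c : ℝ, ‖w - c • e‖ ≤ k * ‖G w‖) :
    ∃ C : ℝ, 0 < C ∧ ∀ u : V, ‖u‖ ≤ C * (‖G u‖ + |m u|) := by
  have hC0 : 0 < 1 + k + (1 + ‖m‖ * k) / m e * ‖e‖ := by positivity
  refine ⟨_, hC0, fun u => ?_⟩
  have hclosed : IsClosed {u : V | ‖u‖ ≤ (1 + k + (1 + ‖m‖ * k) / m e * ‖e‖) *
      (‖G u‖ + |m u|)} :=
    isClosed_le continuous_norm
      (continuous_const.mul (G.continuous.norm.add m.continuous.abs))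
  refine closure_minimal ?_ hclosed (hS u)
  intro w hw
  obtain ⟨c, hc⟩ := hk w hw
  have hmv : |m (w - c • e)| ≤ ‖m‖ * ‖w - c • e‖ := m.le_opNorm _
  have hmw : c * m e = m w - m (w - c • e) := by
    rw [map_sub, map_smul, smul_eq_mul]
    ring
  have hwn : ‖w‖ ≤ ‖w - c • e‖ + |c| * ‖e‖ := by
    have := norm_add_le (w - c • e) (c • e)
    rwa [sub_add_cancel, norm_smul, Real.norm_eq_abs] at this
  change ‖w‖ ≤ (1 + k + (1 + ‖m‖ * k) / m e * ‖e‖) * (‖G w‖ + |m w|)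
  have q2 : 0 ≤ ‖G w‖ := norm_nonneg _
  have q3 : 0 ≤ |m w| := abs_nonneg _
  have hcb : |c| * m e ≤ |m w| + ‖m‖ * (k * ‖G w‖) := by
    calc |c| * m e = |c * m e| := by rw [abs_mul, abs_of_pos hm]
      _ ≤ |m w| + |m (w - c • e)| := by rw [hmw]; exact abs_sub _ _
      _ ≤ |m w| + ‖m‖ * ‖w - c • e‖ := by linarith
      _ ≤ _ := by gcongr
  have hcb' : |c| ≤ (1 + ‖m‖ * k) / m e * (‖G w‖ + |m w|) := by
    rw [div_mul_eq_mul_div, le_div_iff₀ hm]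
    have p2 : 0 ≤ ‖m‖ * k * |m w| := by positivity
    nlinarith
  have q1 : |c| * ‖e‖ ≤ (1 + ‖m‖ * k) / m e * (‖G w‖ + |m w|) * ‖e‖ := by gcongr
  have q4 : 0 ≤ k * |m w| := by positivity
  nlinarith

/-- The `H¹` norm is controlled by the gradient and the boundary mean. -/
theorem IsLipschitzDomain.norm_le_gradL_add_bdryMean [NeZero d] {Ω : Set (E d)}
    (hΩ : IsLipschitzDomain Ω) :
    ∃ C : ℝ, 0 < C ∧ ∀ u : H1 Ω, ‖u‖ ≤ C * (‖gradL Ω u‖ + |bdryMean hΩ u|) := by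
  obtain ⟨k, hk⟩ := hΩ.exists_norm_smooth_sub_const_le
  refine norm_le_of_dense (gradL Ω) (bdryMean hΩ) (oneH1 hΩ) (bdryMean_oneH1_pos hΩ)
    (dense_range_smooth hΩ) k.2 ?_
  rintro _ ⟨φ, hφ, rfl⟩
  exact hk hφ

/-! ### Velocity fields in `W^{1,∞}` -/

theorem IsW1Infty.exists_ae_bound {U : E d → E d} {DU : E d → E d →L[ℝ] E d}
    (hU : IsW1Infty U DU) : ∃ L : ℝ≥0, ∀ᵐ x, ‖DU x‖ ≤ L := by
  have h := hU.memLp_deriv.2.ne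
  rw [eLpNorm_exponent_top] at h
  refine ⟨(eLpNormEssSup DU volume).toNNReal, ?_⟩
  filter_upwards [ae_le_eLpNormEssSup (f := DU) (μ := volume)] with x hx
  rw [← ENNReal.coe_toNNReal h, enorm_eq_nnnorm, ENNReal.coe_le_coe] at hx
  exact hx

/-- The weak derivative tested with the reflected kernel shows that differentiating the mollified
field amounts to mollifying `DU`. -/
theorem IsW1Infty.fderiv_mollify {U : E d → E d} {DU : E d → E d →L[ℝ] E d}
    (hUc : Continuous U) (hU : IsW1Infty U DU) {η : E d → ℝ} {a : E d} {ρ : ℝ}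
    (hη : IsKernel η a ρ) (x : E d) : HasFDerivAt (mollify η U)
      (convolution (fderiv ℝ η) U ((ContinuousLinearMap.lsmul ℝ ℝ).precompL (E d)) volume x) x ∧
      ∀ w, convolution (fderiv ℝ η) U ((ContinuousLinearMap.lsmul ℝ ℝ).precompL (E d)) volume x w
        = ∫ z, η (x - z) • DU z w := by
  have hul : LocallyIntegrable U volume := hUc.locallyIntegrable
  refine ⟨hη.hasCompactSupport.hasFDerivAt_convolution_left (μ := volume)
    (ContinuousLinearMap.lsmul ℝ ℝ) (hη.contDiff.of_le (by simp)) hul x, fun w => ?_⟩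
  have hex : ConvolutionExistsAt (fderiv ℝ η) U x
      ((ContinuousLinearMap.lsmul ℝ ℝ).precompL (E d)) volume :=
    (hη.hasCompactSupport.fderiv ℝ).convolutionExists_left _
      (hη.contDiff.continuous_fderiv (by simp)) hul x
  have htest : IsTestFunction univ fun z => η (x - z) :=
    ⟨hη.contDiff.comp (contDiff_const.sub contDiff_id),
      hη.hasCompactSupport.comp_homeomorph (Homeomorph.subLeft x), subset_univ _⟩
  have hf : ∀ z, fderiv ℝ (fun z => η (x - z)) z w = - fderiv ℝ η (x - z) w := by
    intro z
    have h1 : HasFDerivAt (fun z => η (x - z))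
        ((fderiv ℝ η (x - z)).comp (-ContinuousLinearMap.id ℝ (E d))) z :=
      (hη.contDiff.differentiable (by simp) (x - z)).hasFDerivAt.comp z
        ((hasFDerivAt_id z).const_sub x)
    rw [h1.fderiv]
    simp
  have h := hU.weak_deriv _ htest w
  simp only [hf, neg_smul, integral_neg, neg_inj] at h
  rw [← h, convolution_def, ContinuousLinearMap.integral_apply hex,
    ← integral_sub_left_eq_self _ volume x]
  refine integral_congr_ae (Eventually.of_forall fun t => ?_)
  simp [ContinuousLinearMap.precompL_apply]

/-- Mollifications have derivatives bounded by the essential bound of `DU`, because the kernels are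
probability densities; they converge pointwise to the continuous field `U`, and the Lipschitz bound
survives the limit. -/
theorem IsW1Infty.lipschitzWith {U : E d → E d} {DU : E d → E d →L[ℝ] E d}
    (hUc : Continuous U) (hU : IsW1Infty U DU) : ∃ L : ℝ≥0, LipschitzWith L U := by
  obtain ⟨L, hL⟩ := hU.exists_ae_bound
  refine ⟨L, ?_⟩
  have hmol : ∀ {η : E d → ℝ} {a : E d} {ρ : ℝ}, IsKernel η a ρ →
      LipschitzWith L (mollify η U) := by
    intro η a ρ hη
    refine lipschitzWith_of_nnnorm_fderiv_le
      (fun x => (hU.fderiv_mollify hUc hη x).1.differentiableAt) fun x => ?_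
    obtain ⟨h1, h2⟩ := hU.fderiv_mollify hUc hη x
    rw [h1.fderiv, ← NNReal.coe_le_coe, coe_nnnorm]
    refine ContinuousLinearMap.opNorm_le_bound _ L.2 fun w => ?_
    rw [h2 w]
    have hint : Integrable fun z => η (x - z) * (L * ‖w‖) :=
      (hη.integrable.comp_sub_left x).mul_const _
    refine (norm_integral_le_of_norm_le hint ?_).trans_eq ?_
    · filter_upwards [hL] with z hz
      rw [norm_smul, Real.norm_of_nonneg (hη.nonneg _)]
      gcongr
      · exact hη.nonneg _
      · exact (DU z).le_of_opNorm_le hz w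
    · rw [integral_mul_const, integral_sub_left_eq_self η volume x, hη.integral_eq, one_mul]
  let φ : ℕ → ContDiffBump (0 : E d) := fun n =>
    ⟨1 / (n + 1 : ℝ) / 2, 1 / (n + 1 : ℝ), by positivity, half_lt_self (by positivity)⟩
  have hk : ∀ n, IsKernel ((φ n).normed volume) 0 (φ n).rOut := fun n =>
    ⟨(φ n).contDiff_normed, (φ n).nonneg_normed, (φ n).integral_normed,
      (φ n).tsupport_normed_eq.subset⟩
  have hlim : ∀ x, Tendsto (fun n => mollify ((φ n).normed volume) U x) atTop (𝓝 (U x)) :=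
    fun x => ContDiffBump.convolution_tendsto_right_of_continuous
      tendsto_one_div_add_atTop_nhds_zero_nat hUc x
  refine LipschitzWith.of_dist_le_mul fun x y => ?_
  exact le_of_tendsto ((hlim x).dist (hlim y))
    (Eventually.of_forall fun n => (hmol (hk n)).dist_le_mul x y)

/-- Rademacher's theorem supplies a classical derivative almost everywhere. Its directional
components satisfy the same integration by parts as those of `DU`, hence agree with them almost
everywhere, and finitely many basis components determine the matrix. -/
theorem IsW1Infty.ae_hasFDerivAt {U : E d → E d} {DU : E d → E d →L[ℝ] E d} {L : ℝ≥0}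
    (hL : LipschitzWith L U) (hU : IsW1Infty U DU) : ∀ᵐ x, HasFDerivAt U (DU x) x := by
  have hUc : Continuous U := hL.continuous
  have hDl : LocallyIntegrable DU volume := hU.memLp_deriv.locallyIntegrable le_top
  have key : ∀ v e : E d, ∀ᵐ x, lineDeriv ℝ (fun y => inner ℝ (U y) e) x v
      = inner ℝ (DU x v) e := by
    intro v e
    have hf : LipschitzWith (‖e‖₊ * L) fun y => inner ℝ (U y) e := by
      refine LipschitzWith.of_dist_le_mul fun x y => ?_
      rw [Real.dist_eq, ← inner_sub_left]
      refine (abs_real_inner_le_norm _ _).trans ?_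
      rw [← dist_eq_norm, mul_comm, NNReal.coe_mul, coe_nnnorm, mul_assoc]
      gcongr
      exact hL.dist_le_mul x y
    have hDe : LocallyIntegrable (fun x => inner ℝ (DU x v) e) volume := by
      let A : (E d →L[ℝ] E d) →L[ℝ] ℝ :=
        (innerSL ℝ e).comp (ContinuousLinearMap.apply ℝ (E d) v)
      have hA : (fun x => inner ℝ (DU x v) e) = fun x => A (DU x) := by
        funext x
        simp [A, real_inner_comm]
      rw [hA]
      intro x
      obtain ⟨s, hs, hi⟩ := hDl x
      exact ⟨s, hs, A.integrable_comp hi⟩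
    refine ae_eq_of_integral_contDiff_smul_eq (hf.locallyIntegrable_lineDeriv v) hDe ?_
    intro φ hφ hφc
    have htest : IsTestFunction univ φ := ⟨hφ, hφc, subset_univ _⟩
    obtain ⟨D, hD⟩ := (hφ.of_le (by simp) : ContDiff ℝ 1 φ).lipschitzWith_of_hasCompactSupport
      hφc one_ne_zero
    have h1 := hf.integral_lineDeriv_mul_eq (μ := volume) hD hφc v
    have h2 := hU.weak_deriv φ htest v
    have i1 : Integrable fun x => fderiv ℝ φ x v • U x := by
      have hc : Continuous fun x => fderiv ℝ φ x v :=
        (hφ.continuous_fderiv (by simp)).clm_apply continuous_const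
      exact (hc.smul hUc).integrable_of_hasCompactSupport
        (hφc.fderiv_apply ℝ v).smul_right
    have i2 : Integrable fun x => φ x • DU x v := by
      have : LocallyIntegrable (fun x => DU x v) volume := by
        intro x
        obtain ⟨s, hs, hi⟩ := hDl x
        exact ⟨s, hs, (ContinuousLinearMap.apply ℝ (E d) v).integrable_comp hi⟩
      exact this.integrable_smul_left_of_hasCompactSupport hφ.continuous hφc
    have h3 := congrArg (fun y => inner ℝ e y) h2
    simp only [inner_neg_right] at h3
    rw [← integral_inner i1, ← integral_inner i2] at h3
    have e1 : ∫ x, φ x • lineDeriv ℝ (fun y => inner ℝ (U y) e) x v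
        = ∫ x, lineDeriv ℝ (fun y => inner ℝ (U y) e) x v * φ x := by
      simp only [smul_eq_mul, mul_comm]
    have e2 : ∫ x, lineDeriv ℝ φ x (-v) * inner ℝ (U x) e
        = - ∫ x, inner ℝ e (fderiv ℝ φ x v • U x) := by
      rw [← integral_neg]
      refine integral_congr_ae (Eventually.of_forall fun x => ?_)
      simp only [(hφ.differentiable (by simp) x).lineDeriv_eq_fderiv, map_neg,
        real_inner_smul_right, real_inner_comm]
      ring
    rw [e1, h1, e2, h3, neg_neg]
    refine integral_congr_ae (Eventually.of_forall fun x => ?_)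
    simp only [real_inner_smul_right, real_inner_comm, smul_eq_mul]
  have hall : ∀ᵐ x, ∀ i j : Fin d,
      lineDeriv ℝ (fun y => inner ℝ (U y) (EuclideanSpace.single i (1 : ℝ))) x
        (EuclideanSpace.single j (1 : ℝ))
      = inner ℝ (DU x (EuclideanSpace.single j (1 : ℝ))) (EuclideanSpace.single i (1 : ℝ)) :=
    ae_all_iff.2 fun i => ae_all_iff.2 fun j => key _ _
  filter_upwards [hall, hL.ae_differentiableAt (μ := volume)] with x hx hdx
  refine hdx.hasFDerivAt.congr_fderiv ?_
  have hbasis : ∀ j : Fin d, fderiv ℝ U x (EuclideanSpace.single j (1 : ℝ))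
      = DU x (EuclideanSpace.single j (1 : ℝ)) := by
    intro j
    ext i
    have h1 : HasFDerivAt (fun y => inner ℝ (U y) (EuclideanSpace.single i (1 : ℝ)))
        ((innerSL ℝ (EuclideanSpace.single i (1 : ℝ))).comp (fderiv ℝ U x)) x := by
      have := (innerSL ℝ (EuclideanSpace.single i (1 : ℝ))).hasFDerivAt.comp x hdx.hasFDerivAt
      refine this.congr_of_eventuallyEq (Eventually.of_forall fun y => ?_)
      simp [real_inner_comm]
    have h2 := hx i j
    rw [h1.differentiableAt.lineDeriv_eq_fderiv, h1.fderiv] at h2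
    simpa [EuclideanSpace.inner_single_right, EuclideanSpace.inner_single_left] using h2
  apply ContinuousLinearMap.coe_injective
  refine (EuclideanSpace.basisFun (Fin d) ℝ).toBasis.ext fun j => ?_
  simpa using hbasis j

/-! ### The perturbation of the identity -/

theorem dist_Phi_sub_le {U : E d → E d} {L : ℝ≥0} (hL : LipschitzWith L U) {t : ℝ}
    (ht : |t| * L ≤ 1 / 2) (x y : E d) : ‖t • U x - t • U y‖ ≤ 1 / 2 * ‖x - y‖ := by
  rw [← smul_sub, norm_smul, Real.norm_eq_abs]
  have := hL.dist_le_mul x y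
  rw [dist_eq_norm, dist_eq_norm] at this
  calc _ ≤ |t| * (L * ‖x - y‖) := by gcongr
    _ = |t| * L * ‖x - y‖ := by ring
    _ ≤ _ := by gcongr

theorem norm_sub_le_Phi {U : E d → E d} {L : ℝ≥0} (hL : LipschitzWith L U) {t : ℝ}
    (ht : |t| * L ≤ 1 / 2) (x y : E d) : ‖x - y‖ ≤ 2 * ‖Phi U t x - Phi U t y‖ := by
  have h1 := dist_Phi_sub_le hL ht x y
  have e : x - y = (Phi U t x - Phi U t y) - (t • U x - t • U y) := by
    simp only [Phi]
    abel
  have h2 := norm_sub_le (Phi U t x - Phi U t y) (t • U x - t • U y)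
  rw [← e] at h2
  linarith

theorem lipschitzWith_Phi {U : E d → E d} {L : ℝ≥0} (hL : LipschitzWith L U) {t : ℝ}
    (ht : |t| * L ≤ 1 / 2) : LipschitzWith 2 (Phi U t) := by
  refine LipschitzWith.of_dist_le_mul fun x y => ?_
  rw [dist_eq_norm, dist_eq_norm]
  have h1 := dist_Phi_sub_le hL ht x y
  have e : Phi U t x - Phi U t y = (x - y) + (t • U x - t • U y) := by
    simp only [Phi]
    abel
  rw [e]
  refine (norm_add_le _ _).trans ?_
  push_cast
  linarith [norm_nonneg (x - y)]

/-- The field `tU` is a contraction with constant `1/2`. A preimage of `y` is the fixed point of `x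
↦ y - tU x`. -/
theorem bijective_Phi {U : E d → E d} {L : ℝ≥0} (hL : LipschitzWith L U) {t : ℝ}
    (ht : |t| * L ≤ 1 / 2) : Function.Bijective (Phi U t) := by
  constructor
  · intro x y hxy
    have := norm_sub_le_Phi hL ht x y
    rw [hxy, sub_self, norm_zero, mul_zero] at this
    exact sub_eq_zero.1 (norm_le_zero_iff.1 this)
  · intro y
    have hc : ContractingWith (1 / 2) fun x => y - t • U x := by
      refine ⟨by rw [← NNReal.coe_lt_coe]; push_cast; norm_num,
        LipschitzWith.of_dist_le_mul fun a b => ?_⟩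
      rw [dist_eq_norm, dist_eq_norm, sub_sub_sub_cancel_left, norm_sub_rev]
      simpa using dist_Phi_sub_le hL ht a b
    refine ⟨hc.fixedPoint _, ?_⟩
    have := hc.fixedPoint_isFixedPt
    have h2 : y - t • U (hc.fixedPoint _) = hc.fixedPoint _ := this
    rw [Phi, ← sub_eq_iff_eq_add.1 h2]

/-- `Ψ` is a bi-Lipschitz homeomorphism with inverse `Ψ'` that maps `Ω` onto itself and is the
identity on `Ω` outside the compact set `K`. -/
structure IsDeformation (Ω K : Set (E d)) (Ψ Ψ' : E d → E d) : Prop where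
  isCompact : IsCompact K
  subset : K ⊆ Ω
  lip : LipschitzWith 2 Ψ
  lip' : LipschitzWith 2 Ψ'
  left_inv : Function.LeftInverse Ψ' Ψ
  right_inv : Function.RightInverse Ψ' Ψ
  mem_iff : ∀ x, Ψ x ∈ Ω ↔ x ∈ Ω
  eq_self : ∀ x ∈ Ω, x ∉ K → Ψ x = x

theorem IsDeformation.symm {Ω K : Set (E d)} {Ψ Ψ' : E d → E d} (h : IsDeformation Ω K Ψ Ψ') :
    IsDeformation Ω K Ψ' Ψ where
  isCompact := h.isCompact
  subset := h.subset
  lip := h.lip'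
  lip' := h.lip
  left_inv := h.right_inv
  right_inv := h.left_inv
  mem_iff x := by rw [← h.mem_iff (Ψ' x), h.right_inv x]
  eq_self x hx hxK := by
    have := h.eq_self x hx hxK
    conv_lhs => rw [← this]
    exact h.left_inv x

theorem inter_frontier_nonempty {X : Type*} [TopologicalSpace X] {S A : Set X}
    (hS : IsPreconnected S) (h1 : (S ∩ A).Nonempty) (h2 : (S ∩ Aᶜ).Nonempty) :
    (S ∩ frontier A).Nonempty := by
  by_contra hcon
  rw [not_nonempty_iff_eq_empty] at hcon
  have hsub : S ⊆ interior A ∪ (closure A)ᶜ := by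
    intro x hx
    by_cases hxi : x ∈ interior A
    · exact Or.inl hxi
    · refine Or.inr fun hxc => ?_
      exact (hcon ▸ (⟨hx, hxc, hxi⟩ : x ∈ S ∩ frontier A) : x ∈ (∅ : Set X))
  obtain ⟨x, hx, hxA⟩ := h1
  obtain ⟨y, hy, hyA⟩ := h2
  have hxi : x ∈ interior A := (hsub hx).resolve_right fun h => h (subset_closure hxA)
  have hyc : y ∈ (closure A)ᶜ := (hsub hy).resolve_left fun h => hyA (interior_subset h)
  obtain ⟨z, -, hz1, hz2⟩ := hS _ _ isOpen_interior isClosed_closure.isOpen_compl hsub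
    ⟨x, hx, hxi⟩ ⟨y, hy, hyc⟩
  exact hz2 (subset_closure (interior_subset hz1))

/-- The path `s ↦ Φ_{st}(x)` joins `x` to `Φ_t(x)`. If only one end were in `Ω`, the path would meet
the frontier; frontier points are fixed by the injective map `Φ_{st}`, so `x` itself would be a
frontier point and hence fixed. -/
theorem Phi_mem_iff {Ω : Set (E d)} (hΩ : IsOpen Ω) {U : E d → E d} {L : ℝ≥0}
    (hL : LipschitzWith L U) (hU0 : ∀ x ∈ frontier Ω, U x = 0) {t : ℝ}
    (ht : |t| * L ≤ 1 / 2) (x : E d) : Phi U t x ∈ Ω ↔ x ∈ Ω := by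
  have hfix : ∀ s, ∀ y ∈ frontier Ω, Phi U s y = y := fun s y hy => by
    rw [Phi, hU0 y hy, smul_zero, add_zero]
  have hpath : IsPreconnected ((fun s : ℝ => Phi U (s * t) x) '' Icc 0 1) := by
    refine isPreconnected_Icc.image _ (Continuous.continuousOn ?_)
    unfold Phi
    fun_prop
  have h0 : x ∈ (fun s : ℝ => Phi U (s * t) x) '' Icc 0 1 :=
    ⟨0, by simp, by simp [Phi]⟩
  have h1 : Phi U t x ∈ (fun s : ℝ => Phi U (s * t) x) '' Icc 0 1 :=
    ⟨1, by simp, by simp⟩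
  have hcross : ∀ y ∈ (fun s : ℝ => Phi U (s * t) x) '' Icc 0 1, y ∈ frontier Ω →
      x ∈ frontier Ω := by
    rintro _ ⟨s, hs, rfl⟩ hy
    have hst : |s * t| * L ≤ 1 / 2 := by
      rw [abs_mul, abs_of_nonneg hs.1]
      have : 0 ≤ |t| * L := by positivity
      nlinarith [hs.2]
    have := (bijective_Phi hL hst).1 (hfix (s * t) _ hy)
    change Phi U (s * t) x ∈ frontier Ω at hy
    rwa [this] at hy
  have hnf : ∀ y ∈ Ω, y ∉ frontier Ω := fun y hy hyf => by
    rw [hΩ.frontier_eq] at hyf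
    exact hyf.2 hy
  constructor
  · intro h
    by_contra hx
    obtain ⟨y, hy, hyf⟩ := inter_frontier_nonempty hpath ⟨_, h1, h⟩ ⟨_, h0, hx⟩
    have hxf := hcross y hy hyf
    rw [hfix t x hxf] at h
    exact hx h
  · intro hx
    by_contra h
    obtain ⟨y, hy, hyf⟩ := inter_frontier_nonempty hpath ⟨_, h0, hx⟩ ⟨_, h1, h⟩
    exact hnf x hx (hcross y hy hyf)

/-- The compact set is the closure of `Ω` minus an open neighbourhood of the frontier on which `U`
vanishes, so it serves every admissible `t`. -/
theorem exists_isDeformation_Phi {Ω : Set (E d)} (hΩ : IsLipschitzDomain Ω) {U : E d → E d}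
    {L : ℝ≥0} (hL : LipschitzWith L U) (hU0 : ∀ᶠ x in 𝓝ˢ (frontier Ω), U x = 0) :
    ∃ K, ∀ t : ℝ, |t| * L ≤ 1 / 2 →
      IsDeformation Ω K (Phi U t) (Function.invFun (Phi U t)) := by
  obtain ⟨O, hO, hfO, hOU⟩ := eventually_nhdsSet_iff_exists.1 hU0
  refine ⟨closure Ω \ O, fun t ht => ?_⟩
  have hb := bijective_Phi hL ht
  have hl : Function.LeftInverse (Function.invFun (Phi U t)) (Phi U t) :=
    Function.leftInverse_invFun hb.1
  have hr : Function.RightInverse (Function.invFun (Phi U t)) (Phi U t) :=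
    Function.rightInverse_invFun hb.2
  refine ⟨hΩ.isBounded.isCompact_closure.diff hO, ?_, lipschitzWith_Phi hL ht, ?_, hl, hr,
    Phi_mem_iff hΩ.isOpen hL (fun x hx => hOU x (hfO hx)) ht, ?_⟩
  · rintro x ⟨hx, hxO⟩
    by_contra hxΩ
    exact hxO (hfO (by rw [hΩ.isOpen.frontier_eq]; exact ⟨hx, hxΩ⟩))
  · refine LipschitzWith.of_dist_le_mul fun x y => ?_
    have := norm_sub_le_Phi hL ht (Function.invFun (Phi U t) x) (Function.invFun (Phi U t) y)
    rw [hr x, hr y] at this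
    simpa [dist_eq_norm] using this
  · intro x hx hxK
    have : x ∈ O := by
      by_contra hxO
      exact hxK ⟨subset_closure hx, hxO⟩
    rw [Phi, hOU x this, smul_zero, add_zero]

/-! ### Composition with bi-Lipschitz deformations -/

namespace IsDeformation

variable {Ω K : Set (E d)} {Ψ Ψ' : E d → E d}

theorem volume_image_le (h : IsDeformation Ω K Ψ Ψ') (A : Set (E d)) :
    volume (Ψ '' A) ≤ (2 : ℝ≥0∞) ^ d * volume A := by
  have := euclideanHausdorffMeasure_image_le h.lip d A
  rw [EuclideanSpace.euclideanHausdorffMeasure_eq_volume] at this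
  simpa using this

theorem measurable (h : IsDeformation Ω K Ψ Ψ') : Measurable Ψ := h.lip.continuous.measurable

theorem preimage_eq (h : IsDeformation Ω K Ψ Ψ') (A : Set (E d)) : Ψ ⁻¹' A = Ψ' '' A :=
  (image_eq_preimage_of_inverse h.right_inv h.left_inv).symm ▸ rfl

/-- Preimages are images under the 2-Lipschitz inverse, which preserves `Ω`. Both the preservation
of null sets and the `L²` bound for composition follow. -/
theorem map_restrict_le (h : IsDeformation Ω K Ψ Ψ') :
    Measure.map Ψ (volume.restrict Ω) ≤ (2 : ℝ≥0∞) ^ d • volume.restrict Ω := by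
  refine Measure.le_iff.2 fun A hA => ?_
  rw [Measure.map_apply h.measurable hA, Measure.restrict_apply (h.measurable hA),
    Measure.smul_apply, Measure.restrict_apply hA, smul_eq_mul]
  have e : Ψ ⁻¹' A ∩ Ω = Ψ' '' (A ∩ Ω) := by
    rw [← h.preimage_eq, preimage_inter]
    congr 1
    ext x
    exact (h.mem_iff x).symm
  rw [e]
  exact h.symm.volume_image_le _

theorem quasiMeasurePreserving (h : IsDeformation Ω K Ψ Ψ') :
    Measure.QuasiMeasurePreserving Ψ (volume.restrict Ω) (volume.restrict Ω) :=
  ⟨h.measurable, (Measure.absolutelyContinuous_of_le h.map_restrict_le).trans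
    (Measure.smul_absolutelyContinuous)⟩

theorem memLp_comp {F : Type*} [NormedAddCommGroup F]
    (h : IsDeformation Ω K Ψ Ψ') {f : E d → F} (hf : MemLp f 2 (volume.restrict Ω)) :
    MemLp (f ∘ Ψ) 2 (volume.restrict Ω) := by
  have h1 : MemLp f 2 (Measure.map Ψ (volume.restrict Ω)) :=
    hf.of_measure_le_smul (by simp) h.map_restrict_le
  exact (memLp_map_measure_iff h1.1 h.measurable.aemeasurable).1 h1

theorem eLpNorm_comp_le {F : Type*} [NormedAddCommGroup F]
    (h : IsDeformation Ω K Ψ Ψ') {f : E d → F} (hf : MemLp f 2 (volume.restrict Ω)) :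
    eLpNorm (f ∘ Ψ) 2 (volume.restrict Ω) ≤ 2 ^ d * eLpNorm f 2 (volume.restrict Ω) := by
  have h1 : MemLp f 2 (Measure.map Ψ (volume.restrict Ω)) :=
    hf.of_measure_le_smul (by simp) h.map_restrict_le
  refine (ENNReal.pow_right_strictMono two_ne_zero).le_iff_le.1 ?_
  change eLpNorm (f ∘ Ψ) 2 (volume.restrict Ω) ^ 2 ≤ _
  rw [← eLpNorm_map_measure h1.1 h.measurable.aemeasurable, eLpNorm_two_sq, mul_pow,
    eLpNorm_two_sq]
  calc _ ≤ ∫⁻ x, ‖f x‖ₑ ^ 2 ∂((2 : ℝ≥0∞) ^ d • volume.restrict Ω) :=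
        lintegral_mono' h.map_restrict_le le_rfl
    _ = 2 ^ d * ∫⁻ x in Ω, ‖f x‖ₑ ^ 2 := by rw [lintegral_smul_measure, smul_eq_mul]
    _ ≤ _ := by
        -- A crude bound in place of the factor `2^(d/2)`, which avoids fractional powers; only
        -- continuity of the composition is needed.
        have h2 : (2 : ℝ≥0∞) ^ d ≤ (2 ^ d) ^ 2 :=
          le_self_pow₀ (one_le_pow₀ (by norm_num)) two_ne_zero
        gcongr

/-- The transformed gradient field. -/
def pullGrad (Ψ : E d → E d) (G : E d → E d) (x : E d) : E d :=
  ContinuousLinearMap.adjoint (fderiv ℝ Ψ x) (G (Ψ x))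

theorem norm_pullGrad_le (h : IsDeformation Ω K Ψ Ψ') (G : E d → E d) (x : E d) :
    ‖pullGrad Ψ G x‖ ≤ 2 * ‖(G ∘ Ψ) x‖ := by
  refine (ContinuousLinearMap.le_opNorm _ _).trans ?_
  gcongr
  · rw [LinearIsometryEquiv.norm_map]
    simpa using norm_fderiv_le_of_lipschitz ℝ h.lip (x₀ := x)
  · rfl

theorem memLp_pullGrad (h : IsDeformation Ω K Ψ Ψ') {G : E d → E d}
    (hG : MemLp G 2 (volume.restrict Ω)) : MemLp (pullGrad Ψ G) 2 (volume.restrict Ω) := by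
  refine MemLp.of_le_mul (c := 2) (h.memLp_comp hG) ?_
    (Eventually.of_forall (h.norm_pullGrad_le G))
  have h1 : AEStronglyMeasurable (fun x => ContinuousLinearMap.adjoint (fderiv ℝ Ψ x))
      (volume.restrict Ω) :=
    (ContinuousLinearMap.adjoint (𝕜 := ℝ) (E := E d)
      (F := E d)).continuous.comp_aestronglyMeasurable (measurable_fderiv ℝ Ψ).aestronglyMeasurable
  exact (ContinuousLinearMap.id ℝ (E d →L[ℝ] E d)).aestronglyMeasurable_comp₂ h1
    (h.memLp_comp hG).1

theorem eLpNorm_pullGrad_le (h : IsDeformation Ω K Ψ Ψ') {G : E d → E d}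
    (hG : MemLp G 2 (volume.restrict Ω)) :
    eLpNorm (pullGrad Ψ G) 2 (volume.restrict Ω)
      ≤ 2 * (2 ^ d * eLpNorm G 2 (volume.restrict Ω)) := by
  refine (eLpNorm_le_mul_eLpNorm_of_ae_le_mul (c := 2)
    (Eventually.of_forall (h.norm_pullGrad_le G)) 2).trans ?_
  rw [ENNReal.ofReal_ofNat]
  gcongr
  exact h.eLpNorm_comp_le hG

/-- The pull-back of an element of `H¹(Ω)` together with its transformed gradient. -/
def pullPair (h : IsDeformation Ω K Ψ Ψ') (u : H1 Ω) : L2Pair Ω :=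
  WithLp.toLp 2 ((h.memLp_comp (memLp_val u)).toLp _,
    (h.memLp_pullGrad (memLp_grad u)).toLp _)

theorem norm_pullPair_sub_le (h : IsDeformation Ω K Ψ Ψ') (u w : H1 Ω) :
    ‖h.pullPair u - h.pullPair w‖ ≤ (2 ^ d + 2 * 2 ^ d) * ‖u - w‖ := by
  have hv : eLpNorm (val u - val w) 2 (volume.restrict Ω) ≤ ENNReal.ofReal ‖u - w‖ := by
    rw [← eLpNorm_congr_ae (val_sub u w), ofReal_norm]
    refine (ENNReal.pow_right_strictMono two_ne_zero).le_iff_le.1 ?_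
    change eLpNorm _ 2 _ ^ 2 ≤ ‖u - w‖ₑ ^ 2
    rw [eLpNorm_two_sq, enorm_sq_eq]
    exact le_self_add
  have hg : eLpNorm (grad u - grad w) 2 (volume.restrict Ω) ≤ ENNReal.ofReal ‖u - w‖ := by
    rw [← eLpNorm_congr_ae (grad_sub u w), ofReal_norm]
    refine (ENNReal.pow_right_strictMono two_ne_zero).le_iff_le.1 ?_
    change eLpNorm _ 2 _ ^ 2 ≤ ‖u - w‖ₑ ^ 2
    rw [eLpNorm_two_sq, enorm_sq_eq]
    exact le_add_self
  have a1 : ‖(h.pullPair u - h.pullPair w).fst‖ ≤ 2 ^ d * ‖u - w‖ := by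
    change ‖(h.memLp_comp (memLp_val u)).toLp _ - (h.memLp_comp (memLp_val w)).toLp _‖ ≤ _
    rw [← MemLp.toLp_sub, Lp.norm_toLp]
    refine ENNReal.toReal_le_of_le_ofReal (by positivity) ?_
    rw [ENNReal.ofReal_mul (by positivity), ENNReal.ofReal_pow (by norm_num),
      ENNReal.ofReal_ofNat]
    refine (h.eLpNorm_comp_le ((memLp_val u).sub (memLp_val w))).trans ?_
    gcongr
  have a2 : ‖(h.pullPair u - h.pullPair w).snd‖ ≤ 2 * 2 ^ d * ‖u - w‖ := by
    change ‖(h.memLp_pullGrad (memLp_grad u)).toLp _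
      - (h.memLp_pullGrad (memLp_grad w)).toLp _‖ ≤ _
    rw [← MemLp.toLp_sub, Lp.norm_toLp]
    refine ENNReal.toReal_le_of_le_ofReal (by positivity) ?_
    have e : pullGrad Ψ (grad u) - pullGrad Ψ (grad w) = pullGrad Ψ (grad u - grad w) := by
      funext x
      simp [pullGrad]
    rw [e, ENNReal.ofReal_mul (by positivity), ENNReal.ofReal_mul (by positivity),
      ENNReal.ofReal_pow (by norm_num), ENNReal.ofReal_ofNat, mul_assoc]
    refine (h.eLpNorm_pullGrad_le ((memLp_grad u).sub (memLp_grad w))).trans ?_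
    gcongr
  generalize h.pullPair u - h.pullPair w = p at a1 a2
  refine abs_le_of_sq_le_sq' ?_ (by positivity) |>.2
  rw [WithLp.prod_norm_sq_eq_of_L2]
  have b1 : ‖p.fst‖ ^ 2 ≤ (2 ^ d * ‖u - w‖) ^ 2 := by gcongr
  have b2 : ‖p.snd‖ ^ 2 ≤ (2 * 2 ^ d * ‖u - w‖) ^ 2 := by gcongr
  have b3 : 0 ≤ (2 ^ d * ‖u - w‖) * (2 * 2 ^ d * ‖u - w‖) := by positivity
  nlinarith

/-- Integration by parts for the composition of a smooth function with a deformation. -/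
theorem hasWeakGradient_comp (h : IsDeformation Ω K Ψ Ψ') {φ : E d → ℝ} (hφ : ContDiff ℝ ∞ φ)
    (hφc : HasCompactSupport φ) : HasWeakGradient Ω (φ ∘ Ψ) (pullGrad Ψ (gradient φ)) := by
  intro θ hθ v
  have hθ0 : ∀ x, x ∉ Ω → θ x = 0 := fun x hx =>
    image_eq_zero_of_notMem_tsupport fun hx' => hx (hθ.tsupport_subset hx')
  have hθ1 : ∀ x, x ∉ Ω → fderiv ℝ θ x v = 0 := fun x hx => by
    have : x ∉ tsupport (fderiv ℝ θ) := fun hx' =>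
      hx (hθ.tsupport_subset (tsupport_fderiv_subset ℝ hx'))
    rw [image_eq_zero_of_notMem_tsupport this]
    rfl
  rw [setIntegral_eq_integral_of_forall_compl_eq_zero fun x hx => by rw [hθ1 x hx, mul_zero],
    setIntegral_eq_integral_of_forall_compl_eq_zero fun x hx => by rw [hθ0 x hx, zero_mul]]
  obtain ⟨C, hC⟩ := (hφ.of_le (by simp) : ContDiff ℝ 1 φ).lipschitzWith_of_hasCompactSupport
    hφc one_ne_zero
  obtain ⟨D, hD⟩ := (hθ.contDiff.of_le (by simp) :
    ContDiff ℝ 1 θ).lipschitzWith_of_hasCompactSupport hθ.hasCompactSupport one_ne_zero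
  -- The composition is Lipschitz, so it may be integrated by parts against `θ`, and the chain rule
  -- holds wherever `Ψ` is differentiable, that is, almost everywhere.
  have hlip : LipschitzWith (C * 2) (φ ∘ Ψ) := hC.comp h.lip
  have key := hlip.integral_lineDeriv_mul_eq (μ := volume) hD hθ.hasCompactSupport v
  have e1 : ∫ x, lineDeriv ℝ θ x (-v) * (φ ∘ Ψ) x = - ∫ x, (φ ∘ Ψ) x * fderiv ℝ θ x v := by
    rw [← integral_neg]
    refine integral_congr_ae (Eventually.of_forall fun x => ?_)
    simp only [(hθ.contDiff.differentiable (by simp) x).lineDeriv_eq_fderiv, map_neg]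
    ring
  have e2 : ∫ x, lineDeriv ℝ (φ ∘ Ψ) x v * θ x
      = ∫ x, θ x * inner ℝ (pullGrad Ψ (gradient φ) x) v := by
    refine integral_congr_ae ?_
    filter_upwards [h.lip.ae_differentiableAt (μ := volume)] with x hx
    have hd : HasFDerivAt (φ ∘ Ψ) ((fderiv ℝ φ (Ψ x)).comp (fderiv ℝ Ψ x)) x :=
      (hφ.differentiable (by simp) (Ψ x)).hasFDerivAt.comp x hx.hasFDerivAt
    rw [hd.differentiableAt.lineDeriv_eq_fderiv, hd.fderiv, pullGrad,
      ContinuousLinearMap.adjoint_inner_left, inner_gradient, mul_comm]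
    rfl
  rw [← e2, key, e1, neg_neg]

end IsDeformation

/-- A cutoff equal to one on a ball containing `Ω` changes nothing on `Ω` and supplies the global
Lipschitz bound used in the chain rule. -/
theorem exists_compactlySupported_smooth {Ω : Set (E d)} (hΩ : IsOpen Ω)
    (hb : Bornology.IsBounded Ω) {φ : E d → ℝ} (hφ : ContDiff ℝ ∞ φ) :
    ∃ (ψ : E d → ℝ) (hψ : ContDiff ℝ ∞ ψ), HasCompactSupport ψ ∧
      smoothH1 hb hφ = smoothH1 hb hψ := by
  obtain ⟨R, hR0, hR⟩ := hb.subset_closedBall_lt 0 0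
  let χ : ContDiffBump (0 : E d) := ⟨R, R + 1, hR0, by linarith⟩
  have hψ : ContDiff ℝ ∞ fun x => χ x * φ x := χ.contDiff.mul hφ
  refine ⟨_, hψ, χ.hasCompactSupport.mul_right, H1.ext hΩ ?_⟩
  filter_upwards [val_smoothH1 hb hφ, val_smoothH1 hb hψ, ae_restrict_mem hΩ.measurableSet]
    with x h1 h2 hx
  rw [h1, h2, χ.one_of_mem_closedBall (hR hx), one_mul]

namespace IsDeformation

variable {Ω K : Set (E d)} {Ψ Ψ' : E d → E d}

/-- The chain rule for smooth functions extends by density, since the pull-back is continuous and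
`H¹` is closed in the space of `L²` pairs. -/
theorem pullPair_mem (hΩ : IsLipschitzDomain Ω) (h : IsDeformation Ω K Ψ Ψ') (u : H1 Ω) :
    h.pullPair u ∈ H1 Ω := by
  have hcont : Continuous (h.pullPair) := by
    have : LipschitzWith (2 ^ d + 2 * 2 ^ d) (h.pullPair) :=
      LipschitzWith.of_dist_le_mul fun u w => by
        rw [dist_eq_norm, dist_eq_norm]
        simpa using h.norm_pullPair_sub_le u w
    exact this.continuous
  have hclosed : IsClosed (h.pullPair ⁻¹' (H1 Ω : Set (L2Pair Ω))) :=
    (isClosed_H1 Ω).preimage hcont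
  refine closure_minimal ?_ hclosed (dense_range_smooth hΩ u)
  rintro _ ⟨φ, hφ, rfl⟩
  obtain ⟨ψ, hψ, hψc, e⟩ := exists_compactlySupported_smooth hΩ.isOpen hΩ.isBounded hφ
  rw [e]
  have hq := h.quasiMeasurePreserving
  refine (h.hasWeakGradient_comp hψ hψc).congr ?_ ?_
  · refine EventuallyEq.trans ?_ (h.memLp_comp (memLp_val _)).coeFn_toLp.symm
    exact (hq.ae_eq_comp (val_smoothH1 hΩ.isBounded hψ)).symm
  · refine EventuallyEq.trans ?_ (h.memLp_pullGrad (memLp_grad _)).coeFn_toLp.symm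
    filter_upwards [hq.ae_eq_comp (grad_smoothH1 hΩ.isBounded hψ)] with x hx
    simp only [Function.comp_apply] at hx
    simp only [pullGrad, hx]

/-- Elements of `H¹(Ω)` may be composed with a deformation, without changing the trace. -/
theorem exists_comp (hΩ : IsLipschitzDomain Ω) (h : IsDeformation Ω K Ψ Ψ') (u : H1 Ω) :
    ∃ v : H1 Ω, val v =ᵐ[volume.restrict Ω] val u ∘ Ψ ∧
      grad v =ᵐ[volume.restrict Ω] pullGrad Ψ (grad u) ∧ traceOp hΩ v = traceOp hΩ u := by
  obtain ⟨v, hv⟩ : ∃ v : H1 Ω, (v : L2Pair Ω) = h.pullPair u :=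
    ⟨⟨_, h.pullPair_mem hΩ u⟩, rfl⟩
  have h1 : val v =ᵐ[volume.restrict Ω] val u ∘ Ψ := by
    rw [val, hv]
    exact (h.memLp_comp (memLp_val u)).coeFn_toLp
  have h2 : grad v =ᵐ[volume.restrict Ω] pullGrad Ψ (grad u) := by
    rw [grad, hv]
    exact (h.memLp_pullGrad (memLp_grad u)).coeFn_toLp
  refine ⟨v, h1, h2, ?_⟩
  -- On the open set `Ω \ K` the map and its derivative are the identity, so `v - u` vanishes
  -- together with its gradient outside a compact subset of `Ω`.
  have hz : (v - u, (0 : Lp ℝ 2 (surface Ω))) ∈ traceGraph Ω := by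
    refine zero_trace_of_compact hΩ (v - u) h.isCompact h.subset ?_
    filter_upwards [h1, h2, val_sub v u, grad_sub v u, ae_restrict_mem hΩ.isOpen.measurableSet]
      with x h1 h2 h3 h4 hx hxK
    have hopen : IsOpen (Ω \ K) := hΩ.isOpen.sdiff h.isCompact.isClosed
    have hΨ : Ψ =ᶠ[𝓝 x] id := by
      filter_upwards [hopen.mem_nhds ⟨hx, hxK⟩] with y hy
      exact h.eq_self y hy.1 hy.2
    have hx1 : Ψ x = x := h.eq_self x hx hxK
    have hx2 : fderiv ℝ Ψ x = ContinuousLinearMap.id ℝ (E d) := by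
      rw [hΨ.fderiv_eq, fderiv_id]
    refine ⟨?_, ?_⟩
    · rw [h3, Pi.sub_apply, h1, Function.comp_apply, hx1, sub_self]
    · rw [h4, Pi.sub_apply, h2, pullGrad, hx1, hx2, ← ContinuousLinearMap.one_def,
        ← ContinuousLinearMap.star_eq_adjoint, star_one, one_apply_eq_self, sub_self]
  have := (mem_traceGraph_iff hΩ _ _).1 hz
  rw [map_sub] at this
  exact sub_eq_zero.1 this.symm

/-- The change of variables formula for a deformation. -/
theorem setIntegral_eq (hΩ : IsOpen Ω) (h : IsDeformation Ω K Ψ Ψ') (f : E d → ℝ) :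
    ∫ x in Ω, f x = ∫ x in Ω, |(fderiv ℝ Ψ x).det| * f (Ψ x) := by
  set s : Set (E d) := Ω ∩ {x | DifferentiableAt ℝ Ψ x} with hs
  have hsm : MeasurableSet s := hΩ.measurableSet.inter (measurableSet_of_differentiableAt ℝ Ψ)
  have hnull : volume {x | DifferentiableAt ℝ Ψ x}ᶜ = 0 := h.lip.ae_differentiableAt
  have e1 : (s : Set (E d)) =ᵐ[volume] Ω := by
    refine (inter_ae_eq_left_of_ae_eq_univ ?_)
    rw [ae_eq_univ]
    exact hnull
  -- Lipschitz maps send null sets to null sets, so discarding the points of non-differentiability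
  -- affects neither `Ω` nor its image.
  have e2 : (Ψ '' s : Set (E d)) =ᵐ[volume] Ω := by
    have hΩim : Ψ '' Ω = Ω := by
      rw [← h.symm.preimage_eq]
      ext x
      exact h.symm.mem_iff x
    have hsub : Ψ '' s ⊆ Ω := by
      rw [← hΩim]
      exact image_mono inter_subset_left
    refine (LE.le.eventuallyLE hsub).antisymm ?_
    rw [ae_le_set]
    refine measure_mono_null (t := Ψ '' {x | DifferentiableAt ℝ Ψ x}ᶜ) ?_ ?_
    · rintro y ⟨hy, hys⟩
      rw [← hΩim] at hy
      obtain ⟨x, hx, rfl⟩ := hy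
      exact ⟨x, fun hd => hys ⟨x, ⟨hx, hd⟩, rfl⟩, rfl⟩
    · refine le_antisymm ((h.volume_image_le _).trans ?_) zero_le
      rw [hnull, mul_zero]
  rw [← setIntegral_congr_set e2, integral_image_eq_integral_abs_det_fderiv_smul volume hsm
    (f' := fun x => fderiv ℝ Ψ x) (fun x hx => hx.2.hasFDerivAt.hasFDerivWithinAt)
    h.left_inv.injective.injOn, setIntegral_congr_set e1]
  rfl

end IsDeformation

/-! ### Well-posedness and perturbation of abstract Neumann problems -/

section Abstract

variable {H V W : Type*} [NormedAddCommGroup H] [InnerProductSpace ℝ H]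
  [NormedAddCommGroup V] [InnerProductSpace ℝ V] [NormedAddCommGroup W] [InnerProductSpace ℝ W]

/-- An abstract Neumann problem with a normalization is well posed: `G` plays the role of the
gradient, `m` of the mean value, `e` of the constant function `1`. -/
theorem existsUnique_neumann [CompleteSpace H] {G : H →L[ℝ] V} {m : H →L[ℝ] ℝ} {e : H}
    (hGe : G e = 0) (hme : m e ≠ 0) {C : ℝ} (hC : 0 < C)
    (hpoinc : ∀ u, ‖u‖ ≤ C * (‖G u‖ + |m u|)) {T : V →L[ℝ] V} {lam : ℝ} (hlam : 0 < lam)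
    (hT : ∀ v, lam * ‖v‖ ^ 2 ≤ inner ℝ (T v) v) {l : H →L[ℝ] ℝ} (hl : l e = 0) (b : ℝ) :
    ∃! u, (∀ w, inner ℝ (T (G u)) (G w) = l w) ∧ m u = b := by
  -- The added term `m u * m w` makes the form coercive on the whole space, including the kernel of
  -- `G`.
  let B₀ : H →ₗ[ℝ] H →ₗ[ℝ] ℝ := LinearMap.mk₂ ℝ (fun u w => inner ℝ (T (G u)) (G w) + m u * m w)
    (by intros; simp only [map_add, inner_add_left]; ring)
    (by intros; simp only [map_smul, real_inner_smul_left, smul_eq_mul]; ring)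
    (by intros; simp only [map_add, inner_add_right]; ring)
    (by intros; simp only [map_smul, real_inner_smul_right, smul_eq_mul]; ring)
  have hB₀ : ∀ u w, B₀ u w = inner ℝ (T (G u)) (G w) + m u * m w := fun _ _ => rfl
  let B : H →L[ℝ] H →L[ℝ] ℝ := B₀.mkContinuous₂ (‖T‖ * ‖G‖ * ‖G‖ + ‖m‖ * ‖m‖) fun u w => by
    rw [hB₀]
    refine (norm_add_le _ _).trans ?_
    have h1 : ‖inner ℝ (T (G u)) (G w)‖ ≤ (‖T‖ * (‖G‖ * ‖u‖)) * (‖G‖ * ‖w‖) :=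
      (norm_inner_le_norm _ _).trans (mul_le_mul
        ((T.le_opNorm _).trans (mul_le_mul_of_nonneg_left (G.le_opNorm _) (norm_nonneg _)))
        (G.le_opNorm _) (norm_nonneg _) (by positivity))
    have h2 : ‖m u * m w‖ ≤ (‖m‖ * ‖u‖) * (‖m‖ * ‖w‖) := by
      rw [norm_mul]
      exact mul_le_mul (m.le_opNorm _) (m.le_opNorm _) (norm_nonneg _) (by positivity)
    linarith
  have hB : ∀ u w, B u w = inner ℝ (T (G u)) (G w) + m u * m w := fun _ _ => rfl
  have hcoer : IsCoercive B := by
    refine ⟨min lam 1 / (2 * C ^ 2), by positivity, fun u => ?_⟩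
    rw [hB]
    have h1 := hT (G u)
    have h2 := hpoinc u
    have hmin : 0 < min lam 1 := lt_min hlam one_pos
    have h3 : ‖u‖ ^ 2 ≤ 2 * C ^ 2 * (‖G u‖ ^ 2 + m u ^ 2) := by
      have h4 : ‖u‖ ^ 2 ≤ (C * (‖G u‖ + |m u|)) ^ 2 := by gcongr
      have h5 : m u ^ 2 = |m u| ^ 2 := (sq_abs _).symm
      have h6 : 0 ≤ C ^ 2 * (‖G u‖ - |m u|) ^ 2 := by positivity
      rw [h5]
      nlinarith
    have h7 : min lam 1 / (2 * C ^ 2) * ‖u‖ * ‖u‖ ≤ min lam 1 * (‖G u‖ ^ 2 + m u ^ 2) := by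
      rw [mul_assoc, ← pow_two, div_mul_eq_mul_div, div_le_iff₀ (by positivity)]
      nlinarith
    have h8 : min lam 1 * ‖G u‖ ^ 2 ≤ lam * ‖G u‖ ^ 2 := by
      gcongr
      exact min_le_left _ _
    have h9 : min lam 1 * m u ^ 2 ≤ 1 * m u ^ 2 := by
      gcongr
      exact min_le_right _ _
    nlinarith
  obtain ⟨u₀, hu₀⟩ : ∃ u₀, ∀ w, B u₀ w = l w := by
    refine ⟨hcoer.continuousLinearEquivOfBilin.symm ((InnerProductSpace.toDual ℝ H).symm l),
      fun w => ?_⟩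
    rw [← hcoer.continuousLinearEquivOfBilin_apply, ContinuousLinearEquiv.apply_symm_apply,
      InnerProductSpace.toDual_symm_apply]
  -- Testing with `e` and using `l e = 0` shows that the added term vanishes at the solution; a
  -- multiple of `e` then adjusts the mean to `b`.
  have hm₀ : m u₀ = 0 := by
    have h1 := hu₀ e
    rw [hB, hGe, inner_zero_right, hl, zero_add] at h1
    exact (mul_eq_zero.1 h1).resolve_right hme
  refine ⟨u₀ + (b / m e) • e, ⟨fun w => ?_, ?_⟩, ?_⟩
  · rw [map_add, map_smul, hGe, smul_zero, add_zero, ← hu₀ w, hB, hm₀, zero_mul, add_zero]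
  · rw [map_add, map_smul, hm₀, smul_eq_mul, zero_add, div_mul_cancel₀ _ hme]
  · rintro v ⟨hv, hvb⟩
    refine sub_eq_zero.1 (norm_le_zero_iff.1 ((hpoinc _).trans ?_))
    have hm : m (v - (u₀ + (b / m e) • e)) = 0 := by
      rw [map_sub, map_add, map_smul, hm₀, hvb, smul_eq_mul, zero_add, div_mul_cancel₀ _ hme,
        sub_self]
    have hG : G (v - (u₀ + (b / m e) • e)) = G v - G u₀ := by
      rw [map_sub, map_add, map_smul, hGe, smul_zero, add_zero]
    have h1 : inner ℝ (T (G v - G u₀)) (G v - G u₀) = 0 := by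
      rw [map_sub, inner_sub_left, ← map_sub G, hv, ← hu₀, hB, hm₀, zero_mul, add_zero, sub_self]
    have h2 := hT (G v - G u₀)
    rw [h1] at h2
    have h3 : ‖G v - G u₀‖ = 0 := by
      have : ‖G v - G u₀‖ ^ 2 ≤ 0 := by nlinarith
      exact pow_eq_zero_iff two_ne_zero |>.1 (le_antisymm this (by positivity))
    rw [hm, hG, h3, abs_zero, add_zero, mul_zero]

/-- First order expansion of the misfit functional under a perturbation `S` of the coefficient
operator `T`, expressed through the adjoint state `z`. -/
theorem abs_misfit_sub_le {G : H →L[ℝ] V} {m : H →L[ℝ] ℝ} {C : ℝ} (hC : 0 < C)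
    (hpoinc : ∀ u, ‖u‖ ≤ C * (‖G u‖ + |m u|)) {S T : V →L[ℝ] V} {lam : ℝ} (hlam : 0 < lam)
    (hT : ∀ v, lam * ‖v‖ ^ 2 ≤ inner ℝ (T v) v)
    (hsymm : ∀ v w, inner ℝ (T v) w = inner ℝ v (T w)) (hS : ‖S - T‖ ≤ lam / 2)
    {τ : H →L[ℝ] W} {f : W} {u v z : H} (hm : m v = m u)
    (hv : ∀ w, inner ℝ (S (G v)) (G w) = inner ℝ (T (G u)) (G w))
    (hz : ∀ w, inner ℝ (T (G z)) (G w) = inner ℝ (f - τ u) (τ w)) :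
    |1 / 2 * ‖τ v - f‖ ^ 2 - 1 / 2 * ‖τ u - f‖ ^ 2 - inner ℝ ((S - T) (G u)) (G z)|
      ≤ (2 * ‖G u‖ / lam * ‖G z‖ + 1 / 2 * (‖τ‖ * (C * (2 * ‖G u‖ / lam))) ^ 2)
        * ‖S - T‖ ^ 2 := by
  obtain ⟨δ, rfl⟩ : ∃ δ, v = u + δ := ⟨v - u, by abel⟩
  set R := S - T with hR
  have hSR : S = T + R := by rw [hR]; abel
  have hmδ : m δ = 0 := by
    rw [map_add] at hm
    linarith
  have heq : ∀ w, inner ℝ (T (G δ)) (G w) + inner ℝ (R (G δ)) (G w)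
      = - inner ℝ (R (G u)) (G w) := fun w => by
    have := hv w
    simp only [hSR, map_add, add_apply, inner_add_left] at this
    linarith
  have hbR : ∀ x y : V, |inner ℝ (R x) y| ≤ ‖R‖ * ‖x‖ * ‖y‖ := fun x y =>
    (abs_real_inner_le_norm _ _).trans
      (mul_le_mul_of_nonneg_right (R.le_opNorm _) (norm_nonneg _))
  -- Test the difference equation with `δ`: since `‖R‖ ≤ lam/2`, the perturbed operator keeps half
  -- of the coercivity.
  have hGδ : ‖G δ‖ ≤ 2 * ‖G u‖ / lam * ‖R‖ := by
    have h1 := hT (G δ)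
    have h2 := heq δ
    have h3 := (abs_le.1 (hbR (G δ) (G δ))).1
    have h4 := (abs_le.1 (hbR (G u) (G δ))).1
    have h5 : ‖R‖ * ‖G δ‖ * ‖G δ‖ ≤ lam / 2 * ‖G δ‖ * ‖G δ‖ := by gcongr
    rw [div_mul_eq_mul_div, le_div_iff₀ hlam]
    by_contra! h6
    have h7 : 0 < ‖G δ‖ := by
      rcases (norm_nonneg (G δ)).lt_or_eq with h | h
      · exact h
      · rw [← h, zero_mul] at h6
        exact absurd h6 (not_lt.2 (by positivity))
    nlinarith
  have hδ : ‖δ‖ ≤ C * (2 * ‖G u‖ / lam * ‖R‖) := by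
    have := hpoinc δ
    rw [hmδ, abs_zero, add_zero] at this
    exact this.trans (mul_le_mul_of_nonneg_left hGδ hC.le)
  have hτδ : ‖τ δ‖ ≤ ‖τ‖ * (C * (2 * ‖G u‖ / lam * ‖R‖)) :=
    (τ.le_opNorm δ).trans (mul_le_mul_of_nonneg_left hδ (norm_nonneg _))
  -- The cross term in the expanded square is the adjoint equation tested with `δ`.
  have e1 : 1 / 2 * ‖τ (u + δ) - f‖ ^ 2 - 1 / 2 * ‖τ u - f‖ ^ 2
      = - inner ℝ (T (G z)) (G δ) + 1 / 2 * ‖τ δ‖ ^ 2 := by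
    rw [hz, map_add, add_sub_right_comm, norm_add_sq_real, ← neg_sub (τ u) f, inner_neg_left]
    ring
  have e2 : inner ℝ (T (G z)) (G δ) = inner ℝ (T (G δ)) (G z) := by
    rw [hsymm, real_inner_comm]
  -- Symmetry of `T` and the difference equation tested with `z` leave only terms of second order in
  -- `R`.
  have e3 : 1 / 2 * ‖τ (u + δ) - f‖ ^ 2 - 1 / 2 * ‖τ u - f‖ ^ 2 - inner ℝ (R (G u)) (G z)
      = inner ℝ (R (G δ)) (G z) + 1 / 2 * ‖τ δ‖ ^ 2 := by
    have := heq z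
    rw [e1, e2]
    linarith
  rw [e3]
  refine (abs_add_le _ _).trans ?_
  have b1 : |inner ℝ (R (G δ)) (G z)| ≤ ‖R‖ * (2 * ‖G u‖ / lam * ‖R‖) * ‖G z‖ :=
    (hbR _ _).trans (by gcongr)
  have b2 : |1 / 2 * ‖τ δ‖ ^ 2| ≤ 1 / 2 * (‖τ‖ * (C * (2 * ‖G u‖ / lam * ‖R‖))) ^ 2 := by
    rw [abs_of_nonneg (by positivity)]
    gcongr
  refine (add_le_add b1 b2).trans (le_of_eq ?_)
  ring

/-- Derivative of the misfit functional along a family of states whose coefficient operators have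
the derivative `D` at the parameter `0`. -/
theorem hasDerivAt_misfit {G : H →L[ℝ] V} {m : H →L[ℝ] ℝ} {C : ℝ} (hC : 0 < C)
    (hpoinc : ∀ u, ‖u‖ ≤ C * (‖G u‖ + |m u|)) {T D : V →L[ℝ] V} {lam : ℝ} (hlam : 0 < lam)
    (hT : ∀ v, lam * ‖v‖ ^ 2 ≤ inner ℝ (T v) v)
    (hsymm : ∀ v w, inner ℝ (T v) w = inner ℝ v (T w))
    {τ : H →L[ℝ] W} {f : W} {u z : H} {v : ℝ → H}
    (hv : ∀ ε > 0, ∀ᶠ t in 𝓝 (0 : ℝ), m (v t) = m u ∧ ∃ S : V →L[ℝ] V,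
      ‖S - T - t • D‖ ≤ ε * |t| ∧
      ∀ w, inner ℝ (S (G (v t))) (G w) = inner ℝ (T (G u)) (G w))
    (hz : ∀ w, inner ℝ (T (G z)) (G w) = inner ℝ (f - τ u) (τ w)) :
    HasDerivAt (fun t => 1 / 2 * ‖τ (v t) - f‖ ^ 2) (inner ℝ (D (G u)) (G z)) 0 := by
  obtain ⟨K, hK0, hK⟩ : ∃ K : ℝ, 0 ≤ K ∧ ∀ (S : V →L[ℝ] V) (x : H), ‖S - T‖ ≤ lam / 2 →
      m x = m u → (∀ w, inner ℝ (S (G x)) (G w) = inner ℝ (T (G u)) (G w)) →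
      |1 / 2 * ‖τ x - f‖ ^ 2 - 1 / 2 * ‖τ u - f‖ ^ 2 - inner ℝ ((S - T) (G u)) (G z)|
        ≤ K * ‖S - T‖ ^ 2 :=
    ⟨_, by positivity, fun S x h1 h2 h3 =>
      abs_misfit_sub_le hC hpoinc hlam hT hsymm h1 h2 h3 hz⟩
  -- `v 0 = u` is not assumed. At `t = 0` the hypothesis forces `S = T`, and the expansion then
  -- gives equal misfits.
  have h0 : 1 / 2 * ‖τ (v 0) - f‖ ^ 2 = 1 / 2 * ‖τ u - f‖ ^ 2 := by
    obtain ⟨hm, S, hS, hSv⟩ := (hv 1 one_pos).self_of_nhds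
    have hST : S - T = 0 := by
      rw [abs_zero, mul_zero, zero_smul, sub_zero] at hS
      exact norm_le_zero_iff.1 hS
    have := hK S (v 0) (by rw [hST, norm_zero]; positivity) hm hSv
    rw [hST, norm_zero, zero_apply, inner_zero_left, sub_zero] at this
    have h := abs_nonpos_iff.1 (this.trans (le_of_eq (by ring)))
    linarith
  rw [hasDerivAt_iff_isLittleO, Asymptotics.isLittleO_iff]
  intro ε hε
  set a := ‖G u‖ * ‖G z‖ + 1 with ha
  have ha0 : 0 < a := by positivity
  set η := ε / (2 * a) with hη
  have hη0 : 0 < η := by positivity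
  set L := η + ‖D‖ with hL
  have hL0 : 0 < L := by positivity
  -- The first threshold ensures `‖S - T‖ ≤ lam/2`. The second makes the quadratic remainder at most
  -- `ε/2 * |t|`; the choice of `η` reserves the other half for the linear term. `K + 1` avoids
  -- dividing by zero.
  have hsmall : ∀ᶠ t in 𝓝 (0 : ℝ), |t| < min (lam / 2 / L) (ε / (2 * (K + 1) * L ^ 2)) := by
    have : Tendsto (fun t : ℝ => |t|) (𝓝 0) (𝓝 0) := by
      simpa using (continuous_abs (G := ℝ)).tendsto 0
    exact this.eventually_lt_const (by positivity)
  filter_upwards [hv η hη0, hsmall] with t ⟨hm, S, hS, hSv⟩ ht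
  have hST : ‖S - T‖ ≤ L * |t| := by
    have h1 : S - T = (S - T - t • D) + t • D := by abel
    rw [h1]
    refine (norm_add_le _ _).trans ?_
    rw [norm_smul, Real.norm_eq_abs]
    nlinarith
  have ht1 : |t| * L ≤ lam / 2 := ((lt_div_iff₀ hL0).1 (ht.trans_le (min_le_left _ _))).le
  have ht2 : |t| * (2 * (K + 1) * L ^ 2) ≤ ε :=
    ((lt_div_iff₀ (by positivity)).1 (ht.trans_le (min_le_right _ _))).le
  have key := hK S (v t) (by linarith) hm hSv
  have h1 : |inner ℝ ((S - T) (G u)) (G z) - t * inner ℝ (D (G u)) (G z)|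
      ≤ η * |t| * (‖G u‖ * ‖G z‖) := by
    have e : inner ℝ ((S - T) (G u)) (G z) - t * inner ℝ (D (G u)) (G z)
        = inner ℝ ((S - T - t • D) (G u)) (G z) := by
      rw [sub_apply (S - T), smul_apply, inner_sub_left,
        real_inner_smul_left]
    rw [e]
    refine (abs_real_inner_le_norm _ _).trans ?_
    rw [← mul_assoc]
    refine mul_le_mul_of_nonneg_right ((ContinuousLinearMap.le_opNorm _ _).trans ?_)
      (norm_nonneg _)
    exact mul_le_mul_of_nonneg_right hS (norm_nonneg _)
  have h2 : η * |t| * (‖G u‖ * ‖G z‖) ≤ ε / 2 * |t| := by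
    have : η * (‖G u‖ * ‖G z‖) ≤ η * a := by gcongr; linarith
    have e : η * a = ε / 2 := by rw [hη]; field_simp
    nlinarith [abs_nonneg t]
  have h3 : K * ‖S - T‖ ^ 2 ≤ ε / 2 * |t| := by
    have h4 : ‖S - T‖ ^ 2 ≤ (L * |t|) ^ 2 := by gcongr
    have h5 : K * ‖S - T‖ ^ 2 ≤ (K + 1) * (L * |t|) ^ 2 := by gcongr; linarith
    nlinarith [abs_nonneg t]
  simp only [sub_zero, smul_eq_mul, Real.norm_eq_abs]
  rw [h0]
  have e : 1 / 2 * ‖τ (v t) - f‖ ^ 2 - 1 / 2 * ‖τ u - f‖ ^ 2 - t * inner ℝ (D (G u)) (G z)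
      = (1 / 2 * ‖τ (v t) - f‖ ^ 2 - 1 / 2 * ‖τ u - f‖ ^ 2 - inner ℝ ((S - T) (G u)) (G z))
        + (inner ℝ ((S - T) (G u)) (G z) - t * inner ℝ (D (G u)) (G z)) := by ring
  rw [e]
  refine (abs_add_le _ _).trans ?_
  linarith

end Abstract

/-! ### Multiplication by bounded matrix fields -/

section Multiplication

variable {μ : Measure (E d)} {A : E d → E d →L[ℝ] E d} {Λ : ℝ}

theorem memLp_clm_apply (hA : AEStronglyMeasurable A μ) (hb : ∀ᵐ x ∂μ, ‖A x‖ ≤ Λ)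
    {G : E d → E d} (hG : MemLp G 2 μ) : MemLp (fun x => A x (G x)) 2 μ := by
  refine MemLp.of_le_mul (c := Λ) hG
    ((ContinuousLinearMap.id ℝ (E d →L[ℝ] E d)).aestronglyMeasurable_comp₂ hA hG.1) ?_
  filter_upwards [hb] with x hx
  exact (ContinuousLinearMap.le_opNorm _ _).trans
    (mul_le_mul_of_nonneg_right hx (norm_nonneg _))

/-- Multiplication by a bounded matrix field, as an operator on `L²`. -/
def mulL2 (hA : AEStronglyMeasurable A μ) (hb : ∀ᵐ x ∂μ, ‖A x‖ ≤ Λ) :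
    Lp (E d) 2 μ →L[ℝ] Lp (E d) 2 μ :=
  LinearMap.mkContinuous
    { toFun := fun G => (memLp_clm_apply hA hb (Lp.memLp G)).toLp _
      map_add' := fun G H => by
        rw [← MemLp.toLp_add, MemLp.toLp_eq_toLp_iff]
        filter_upwards [Lp.coeFn_add G H] with x hx
        rw [hx, Pi.add_apply, map_add, Pi.add_apply]
      map_smul' := fun a G => by
        rw [RingHom.id_apply, ← MemLp.toLp_const_smul, MemLp.toLp_eq_toLp_iff]
        filter_upwards [Lp.coeFn_smul a G] with x hx
        rw [hx, Pi.smul_apply, map_smul, Pi.smul_apply] } Λ fun G => by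
    refine Lp.norm_le_mul_norm_of_ae_le_mul ?_
    filter_upwards [hb, (memLp_clm_apply hA hb (Lp.memLp G)).coeFn_toLp] with x hx h
    change ‖(((memLp_clm_apply hA hb (Lp.memLp G)).toLp _ : Lp (E d) 2 μ) : E d → E d) x‖ ≤ _
    rw [h]
    exact (ContinuousLinearMap.le_opNorm _ _).trans
      (mul_le_mul_of_nonneg_right hx (norm_nonneg _))

theorem coeFn_mulL2 (hA : AEStronglyMeasurable A μ) (hb : ∀ᵐ x ∂μ, ‖A x‖ ≤ Λ)
    (G : Lp (E d) 2 μ) : mulL2 hA hb G =ᵐ[μ] fun x => A x (G x) :=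
  (memLp_clm_apply hA hb (Lp.memLp G)).coeFn_toLp

theorem inner_mulL2 (hA : AEStronglyMeasurable A μ) (hb : ∀ᵐ x ∂μ, ‖A x‖ ≤ Λ)
    (G H : Lp (E d) 2 μ) : inner ℝ (mulL2 hA hb G) H = ∫ x, inner ℝ (A x (G x)) (H x) ∂μ := by
  rw [L2.inner_def]
  refine integral_congr_ae ?_
  filter_upwards [coeFn_mulL2 hA hb G] with x hx
  rw [hx]

/-- Uniform pointwise bounds on matrix fields become operator norm bounds; this is how the matrix
expansion yields differentiability of the coefficient operators. -/
theorem norm_mulL2_sub_sub_le {B D : E d → E d →L[ℝ] E d} {Λ' Λ'' : ℝ}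
    (hA : AEStronglyMeasurable A μ) (hb : ∀ᵐ x ∂μ, ‖A x‖ ≤ Λ)
    (hB : AEStronglyMeasurable B μ) (hb' : ∀ᵐ x ∂μ, ‖B x‖ ≤ Λ')
    (hD : AEStronglyMeasurable D μ) (hb'' : ∀ᵐ x ∂μ, ‖D x‖ ≤ Λ'') (t : ℝ) {ε : ℝ} (hε : 0 ≤ ε)
    (h : ∀ᵐ x ∂μ, ‖A x - B x - t • D x‖ ≤ ε) :
    ‖mulL2 hA hb - mulL2 hB hb' - t • mulL2 hD hb''‖ ≤ ε := by
  refine ContinuousLinearMap.opNorm_le_bound _ hε fun G => ?_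
  refine Lp.norm_le_mul_norm_of_ae_le_mul ?_
  have e : (mulL2 hA hb - mulL2 hB hb' - t • mulL2 hD hb'') G
      = mulL2 hA hb G - mulL2 hB hb' G - t • mulL2 hD hb'' G := rfl
  rw [e]
  filter_upwards [h, coeFn_mulL2 hA hb G, coeFn_mulL2 hB hb' G, coeFn_mulL2 hD hb'' G,
    Lp.coeFn_sub (mulL2 hA hb G - mulL2 hB hb' G) (t • mulL2 hD hb'' G),
    Lp.coeFn_sub (mulL2 hA hb G) (mulL2 hB hb' G), Lp.coeFn_smul t (mulL2 hD hb'' G)]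
    with x hx h1 h2 h3 h4 h5 h6
  rw [h4, Pi.sub_apply, h5, Pi.sub_apply, h6, Pi.smul_apply, h1, h2, h3]
  exact (ContinuousLinearMap.le_opNorm (A x - B x - t • D x) (G x)).trans
    (mul_le_mul_of_nonneg_right hx (norm_nonneg _))

end Multiplication

/-! ### Well-posedness of the state and adjoint problems -/

/-- The scalar matrix field of a conductivity. -/
def scalarField (κ : E d → ℝ) (x : E d) : E d →L[ℝ] E d := κ x • ContinuousLinearMap.id ℝ (E d)

/-- `κ` is measurable and satisfies `lam ≤ κ ≤ Λ` almost everywhere in `Ω`. -/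
structure IsConductivity (Ω : Set (E d)) (lam Λ : ℝ) (κ : E d → ℝ) : Prop where
  aestronglyMeasurable : AEStronglyMeasurable κ (volume.restrict Ω)
  lower : ∀ᵐ x ∂(volume.restrict Ω), lam ≤ κ x
  upper : ∀ᵐ x ∂(volume.restrict Ω), |κ x| ≤ Λ

namespace IsConductivity

variable {Ω : Set (E d)} {lam Λ : ℝ} {κ : E d → ℝ}

theorem aestronglyMeasurable_scalarField (h : IsConductivity Ω lam Λ κ) :
    AEStronglyMeasurable (scalarField κ) (volume.restrict Ω) :=
  h.aestronglyMeasurable.smul_const _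

theorem norm_scalarField_le (h : IsConductivity Ω lam Λ κ) :
    ∀ᵐ x ∂(volume.restrict Ω), ‖scalarField κ x‖ ≤ Λ := by
  filter_upwards [h.upper] with x hx
  rw [scalarField, norm_smul, Real.norm_eq_abs]
  exact (mul_le_of_le_one_right (abs_nonneg _) ContinuousLinearMap.norm_id_le).trans hx

/-- Multiplication by the conductivity in `L²(Ω; ℝ^d)`. -/
def op (h : IsConductivity Ω lam Λ κ) :
    Lp (E d) 2 (volume.restrict Ω) →L[ℝ] Lp (E d) 2 (volume.restrict Ω) :=
  mulL2 h.aestronglyMeasurable_scalarField h.norm_scalarField_le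

theorem inner_op (h : IsConductivity Ω lam Λ κ) (G H : Lp (E d) 2 (volume.restrict Ω)) :
    inner ℝ (h.op G) H = ∫ x in Ω, κ x * inner ℝ (G x) (H x) := by
  rw [op, inner_mulL2]
  refine integral_congr_ae (Eventually.of_forall fun x => ?_)
  simp [scalarField, real_inner_smul_left]

theorem inner_op_comm (h : IsConductivity Ω lam Λ κ) (G H : Lp (E d) 2 (volume.restrict Ω)) :
    inner ℝ (h.op G) H = inner ℝ G (h.op H) := by
  rw [real_inner_comm (h.op H) G, inner_op, inner_op]
  refine integral_congr_ae (Eventually.of_forall fun x => ?_)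
  simp only [real_inner_comm]

theorem le_inner_op (h : IsConductivity Ω lam Λ κ) (G : Lp (E d) 2 (volume.restrict Ω)) :
    lam * ‖G‖ ^ 2 ≤ inner ℝ (h.op G) G := by
  rw [← real_inner_self_eq_norm_sq, L2.inner_def, ← integral_const_mul, op, L2.inner_def]
  refine integral_mono_ae ((L2.integrable_inner G G).const_mul lam) (L2.integrable_inner _ _) ?_
  filter_upwards [h.lower, coeFn_mulL2 h.aestronglyMeasurable_scalarField
    h.norm_scalarField_le G] with x hx h1
  rw [h1]
  simp only [scalarField, smul_apply, ContinuousLinearMap.id_apply, real_inner_smul_left]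
  exact mul_le_mul_of_nonneg_right hx (real_inner_self_nonneg)

theorem inner_op_gradL (h : IsConductivity Ω lam Λ κ) (u w : H1 Ω) :
    inner ℝ (h.op (gradL Ω u)) (gradL Ω w)
      = ∫ x in Ω, κ x * inner ℝ (grad u x) (grad w x) := by
  rw [h.inner_op]
  rfl

theorem existsUnique [NeZero d] (hΩ : IsLipschitzDomain Ω) (hlam : 0 < lam)
    (h : IsConductivity Ω lam Λ κ) {l : H1 Ω →L[ℝ] ℝ} (hl : l (oneH1 hΩ) = 0) (b : ℝ) :
    ∃! u : H1 Ω, (∀ w : H1 Ω, ∫ x in Ω, κ x * inner ℝ (grad u x) (grad w x) = l w) ∧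
      bdryMean hΩ u = b := by
  obtain ⟨C, hC, hp⟩ := hΩ.norm_le_gradL_add_bdryMean
  have := existsUnique_neumann (gradL_oneH1 hΩ) (bdryMean_oneH1_pos hΩ).ne' hC hp hlam
    h.le_inner_op hl b
  simpa only [h.inner_op_gradL] using this

end IsConductivity

section Functionals

variable {Ω : Set (E d)}

theorem traceOp_mem_HHalf (hΩ : IsLipschitzDomain Ω) (u : H1 Ω) : traceOp hΩ u ∈ HHalf Ω := by
  rw [← coe_trace hΩ u]
  exact (trace u).2

/-- The trace operator with values in `H^{1/2}(∂Ω)`. -/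
def traceHalf (hΩ : IsLipschitzDomain Ω) : H1 Ω →ₗ[ℝ] HHalf Ω :=
  (traceOp hΩ).toLinearMap.codRestrict (HHalf Ω) (traceOp_mem_HHalf hΩ)

theorem traceHalf_apply (hΩ : IsLipschitzDomain Ω) (u : H1 Ω) : traceHalf hΩ u = trace u :=
  Subtype.ext (coe_trace hΩ u).symm

theorem halfNorm_trace_le (hΩ : IsLipschitzDomain Ω) (u : H1 Ω) : halfNorm (trace u) ≤ ‖u‖ := by
  refine csInf_le ⟨0, ?_⟩ ⟨u, isTrace_trace hΩ u, rfl⟩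
  rintro _ ⟨v, -, rfl⟩
  exact norm_nonneg v

theorem halfNorm_nonneg (T : HHalf Ω) : 0 ≤ halfNorm T := by
  refine Real.sInf_nonneg ?_
  rintro _ ⟨v, -, rfl⟩
  exact norm_nonneg v

theorem exists_state_functional (hΩ : IsLipschitzDomain Ω) {g : HHalf Ω →ₗ[ℝ] ℝ}
    (hg : MemHNegHalfZero g) :
    ∃ l : H1 Ω →L[ℝ] ℝ, (∀ w, l w = g (trace w)) ∧ l (oneH1 hΩ) = 0 := by
  obtain ⟨C, hC⟩ := hg.bounded
  -- The constant bounding `g` is not assumed nonnegative, hence the absolute value.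
  refine ⟨LinearMap.mkContinuous (g ∘ₗ traceHalf hΩ) |C| fun w => ?_, fun w => ?_, ?_⟩
  · rw [LinearMap.comp_apply, traceHalf_apply, Real.norm_eq_abs]
    refine (hC _).trans ?_
    exact mul_le_mul (le_abs_self C) (halfNorm_trace_le hΩ w) (halfNorm_nonneg _) (abs_nonneg C)
  · rw [LinearMap.mkContinuous_apply, LinearMap.comp_apply, traceHalf_apply]
  · rw [LinearMap.mkContinuous_apply, LinearMap.comp_apply]
    exact hg.const _ (traceOp_oneH1 hΩ)

theorem integral_bdryFun_trace (hΩ : IsLipschitzDomain Ω) (u : H1 Ω) :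
    ∫ x, bdryFun (trace u) x ∂(surface Ω) = bdryMean hΩ u := by
  rw [bdryMean_apply, bdryFun, coe_trace hΩ]

theorem IsConductivity.existsUnique_isState [NeZero d] (hΩ : IsLipschitzDomain Ω) {lam Λ : ℝ}
    (hlam : 0 < lam) {κ : E d → ℝ} (h : IsConductivity Ω lam Λ κ) {g : HHalf Ω →ₗ[ℝ] ℝ}
    (hg : MemHNegHalfZero g) (f : HHalf Ω) : ∃! u : H1 Ω, IsState κ g f u := by
  obtain ⟨l, hl, hl0⟩ := exists_state_functional hΩ hg
  have := h.existsUnique hΩ hlam hl0 (∫ x, bdryFun f x ∂(surface Ω))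
  simpa only [IsState, IsWeakNeumannSolution, integral_bdryFun_trace hΩ, hl] using this

theorem integral_sub_mul_bdryFun (hΩ : IsLipschitzDomain Ω) (f : HHalf Ω) (u w : H1 Ω) :
    ∫ x, (bdryFun f x - bdryFun (trace u) x) * bdryFun (trace w) x ∂(surface Ω)
      = inner ℝ ((f : Lp ℝ 2 (surface Ω)) - traceOp hΩ u) (traceOp hΩ w) := by
  rw [L2.inner_def]
  refine integral_congr_ae ?_
  filter_upwards [Lp.coeFn_sub (f : Lp ℝ 2 (surface Ω)) (traceOp hΩ u)] with x hx
  rw [hx, bdryFun, bdryFun, bdryFun, coe_trace hΩ, coe_trace hΩ, Pi.sub_apply]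
  exact mul_comm _ _

theorem inner_traceOp_oneH1 (hΩ : IsLipschitzDomain Ω) (T : Lp ℝ 2 (surface Ω)) :
    inner ℝ T (traceOp hΩ (oneH1 hΩ)) = ∫ x, T x ∂(surface Ω) := by
  rw [L2.inner_def]
  refine integral_congr_ae ?_
  filter_upwards [traceOp_oneH1 hΩ] with x hx
  rw [hx]
  simp

/-- The normalization of the state is the compatibility condition: it says that the flux `f - u` has
zero boundary mean. -/
theorem IsConductivity.existsUnique_isAdjoint [NeZero d] (hΩ : IsLipschitzDomain Ω) {lam Λ : ℝ}
    (hlam : 0 < lam) {κ : E d → ℝ} (h : IsConductivity Ω lam Λ κ) (f : HHalf Ω) {u : H1 Ω}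
    (hu : ∫ x, bdryFun (trace u) x ∂(surface Ω) = ∫ x, bdryFun f x ∂(surface Ω)) :
    ∃! z : H1 Ω, IsAdjoint κ f u z := by
  have hl : ((innerSL ℝ ((f : Lp ℝ 2 (surface Ω)) - traceOp hΩ u)).comp (traceOp hΩ))
      (oneH1 hΩ) = 0 := by
    rw [ContinuousLinearMap.comp_apply, innerSL_apply_apply, inner_sub_left,
      inner_traceOp_oneH1, inner_traceOp_oneH1, ← bdryMean_apply, ← integral_bdryFun_trace, hu]
    exact sub_self _
  have := h.existsUnique hΩ hlam hl (∫ x, bdryFun f x ∂(surface Ω))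
  simpa only [IsAdjoint, IsWeakNeumannSolution, integral_bdryFun_trace hΩ,
    integral_sub_mul_bdryFun hΩ, ContinuousLinearMap.comp_apply, innerSL_apply_apply] using this

theorem integral_abs_sub_sq (hΩ : IsLipschitzDomain Ω) (f : HHalf Ω) (u : H1 Ω) :
    ∫ x, |bdryFun (trace u) x - bdryFun f x| ^ 2 ∂(surface Ω)
      = ‖traceOp hΩ u - (f : Lp ℝ 2 (surface Ω))‖ ^ 2 := by
  rw [← real_inner_self_eq_norm_sq, L2.inner_def]
  refine integral_congr_ae ?_
  filter_upwards [Lp.coeFn_sub (traceOp hΩ u) (f : Lp ℝ 2 (surface Ω))] with x hx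
  rw [hx, bdryFun, bdryFun, coe_trace hΩ, Pi.sub_apply, real_inner_self_eq_norm_sq,
    Real.norm_eq_abs]

end Functionals

/-! ### The coefficient matrix of the pulled-back equation -/

theorem differentiable_det : Differentiable ℝ fun X : E d →L[ℝ] E d => X.det := by
  have e : (fun X : E d →L[ℝ] E d => X.det) = fun X => ∑ p : Equiv.Perm (Fin d),
      ((Equiv.Perm.sign p : ℤ) : ℝ) * ∏ i, X (EuclideanSpace.single i (1 : ℝ)) (p i) := by
    funext X
    rw [ContinuousLinearMap.det,
      ← LinearMap.det_toMatrix (EuclideanSpace.basisFun (Fin d) ℝ).toBasis, Matrix.det_apply']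
    simp [LinearMap.toMatrix_apply]
  rw [e]
  fun_prop

/-- As a polynomial in `t`, the determinant is one plus `t` times the trace plus a multiple of `t²`.
-/
theorem hasDerivAt_det_one_add_smul (X : E d →L[ℝ] E d) :
    HasDerivAt (fun t : ℝ => (1 + t • X).det) (LinearMap.trace ℝ (E d) (X : E d →ₗ[ℝ] E d)) 0 := by
  set b := (EuclideanSpace.basisFun (Fin d) ℝ).toBasis
  set Y := LinearMap.toMatrix b b (X : E d →ₗ[ℝ] E d) with hY
  have e : (fun t : ℝ => (1 + t • X).det) = fun t => 1 + Y.trace * t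
      + (Matrix.det (1 + (Polynomial.X : Polynomial ℝ) • Y.map Polynomial.C)).divX.divX.eval t
        * t ^ 2 := by
    funext t
    rw [← Matrix.det_one_add_smul, ContinuousLinearMap.det, ← LinearMap.det_toMatrix b]
    congr 1
    rw [ContinuousLinearMap.toLinearMap_add, ContinuousLinearMap.toLinearMap_smul, map_add,
      map_smul, ← hY, ContinuousLinearMap.toLinearMap_one, LinearMap.toMatrix_one]
  rw [e, LinearMap.trace_eq_matrix_trace ℝ b, ← hY]
  have h1 : HasDerivAt (fun t : ℝ => 1 + Y.trace * t) (Y.trace) 0 := by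
    simpa using ((hasDerivAt_id (0 : ℝ)).const_mul Y.trace).const_add 1
  have h2 := h1.add ((Polynomial.hasDerivAt
    (Matrix.det (1 + (Polynomial.X : Polynomial ℝ) • Y.map Polynomial.C)).divX.divX (0 : ℝ)).mul
    (hasDerivAt_pow 2 (0 : ℝ)))
  simp only [ne_eq, OfNat.ofNat_ne_zero, not_false_eq_true, zero_pow, mul_zero, Nat.cast_ofNat,
    Nat.add_one_sub_one, pow_one, add_zero] at h2
  exact h2

theorem hasFDerivAt_det_one_add : ∃ D : (E d →L[ℝ] E d) →L[ℝ] ℝ,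
    (∀ X, D X = LinearMap.trace ℝ (E d) (X : E d →ₗ[ℝ] E d)) ∧
    HasFDerivAt (fun X : E d →L[ℝ] E d => (1 + X).det) D 0 := by
  have hdiff : DifferentiableAt ℝ (fun X : E d →L[ℝ] E d => (1 + X).det) 0 :=
    (differentiable_det _).comp 0 ((differentiableAt_const _).add differentiableAt_id)
  refine ⟨_, fun X => ?_, hdiff.hasFDerivAt⟩
  have h1 : HasDerivAt (fun t : ℝ => t • X) X 0 := by
    simpa using (hasDerivAt_id (0 : ℝ)).smul_const X
  have h2 := hdiff.hasFDerivAt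
  rw [← zero_smul ℝ X] at h2
  have h3 := h2.comp_hasDerivAt (0 : ℝ) h1
  rw [zero_smul] at h3
  exact h3.unique (hasDerivAt_det_one_add_smul X)

/-- The product rule at `0`: `|δ|` has derivative `D` because `δ 0 = 1 > 0`, inversion at one has
derivative `-X`, and its adjoint contributes `-star X`. -/
theorem smul_inverse_mul_star_expansion {R : Type*} [NormedRing R] [NormedAlgebra ℝ R]
    [CompleteSpace R] [StarRing R] [ContinuousStar R] [StarModule ℝ R] {δ : R → ℝ}
    {D : R →L[ℝ] ℝ} (hδ0 : δ 0 = 1) (hδ : HasFDerivAt δ D 0) :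
    (fun X : R => |δ X| • (Ring.inverse (1 + X) * star (Ring.inverse (1 + X))) - 1
      - (D X • 1 - (X + star X))) =o[𝓝 0] fun X : R => X := by
  have habs : HasFDerivAt (fun X => |δ X|) D 0 := by
    have h := hasDerivAt_abs_pos (x := δ 0) (by rw [hδ0]; exact one_pos)
    have h1 := h.comp_hasFDerivAt (0 : R) hδ
    rwa [one_smul] at h1
  have hinv : HasFDerivAt (fun X : R => Ring.inverse (1 + X)) (-(ContinuousLinearMap.id ℝ R)) 0 := by
    have h1 := hasFDerivAt_ringInverse (𝕜 := ℝ) (1 : Rˣ)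
    have h2 : HasFDerivAt (fun X : R => 1 + X) (ContinuousLinearMap.id ℝ R) 0 :=
      (hasFDerivAt_id _).const_add 1
    rw [inv_one, Units.val_one] at h1
    rw [← add_zero (1 : R)] at h1
    refine (HasFDerivAt.comp (0 : R) h1 h2).congr_fderiv ?_
    ext X
    simp
  have hF := habs.smul (hinv.mul' hinv.star)
  have := hF.isLittleO
  refine (this.congr_left fun X => ?_).trans_isBigO ?_
  · simp only [Pi.mul_apply, Pi.smul_apply', sub_zero, add_zero, hδ0, abs_one, Ring.inverse_one,
      star_one, mul_one, one_smul]
    simp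
    abel
  · simpa using Asymptotics.isBigO_refl _ _

/-- The matrix `|det (1 + X)| (1 + X)⁻¹ (1 + X)⁻ᵀ`. -/
def pullCoeff (X : E d →L[ℝ] E d) : E d →L[ℝ] E d :=
  |(1 + X).det| • (Ring.inverse (1 + X) * star (Ring.inverse (1 + X)))

theorem pullCoeff_expansion : (fun X : E d →L[ℝ] E d => pullCoeff X - 1 - calA X) =o[𝓝 0]
    fun X : E d →L[ℝ] E d => X := by
  obtain ⟨D, hD, hdet⟩ := hasFDerivAt_det_one_add (d := d)
  have hdet0 : (1 + (0 : E d →L[ℝ] E d)).det = 1 := by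
    rw [add_zero]
    exact LinearMap.det_id
  refine (smul_inverse_mul_star_expansion hdet0 hdet).congr_left fun X => ?_
  rw [hD]
  rfl

/-! ### Piecewise constant conductivities -/

theorem IsOpenPolytope.isOpen {P : Set (E d)} (hP : IsOpenPolytope P) : IsOpen P :=
  hP.interior_closure ▸ isOpen_interior

/-- A closure point interior to one of the hulls is interior to the closure, hence in `P`. What
remains lies in frontiers of finitely many convex sets, which are null. -/
theorem IsOpenPolytope.volume_closure_diff {P : Set (E d)} (hP : IsOpenPolytope P) :
    volume (closure P \ P) = 0 := by
  obtain ⟨n, V, hV⟩ := hP.closure_eq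
  refine measure_mono_null (t := ⋃ i, frontier (convexHull ℝ (V i : Set (E d)))) ?_
    (measure_iUnion_null fun i => (convex_convexHull ℝ _).addHaar_frontier volume)
  rintro x ⟨hx, hxP⟩
  rw [← hP.interior_closure] at hxP
  rw [hV, mem_iUnion] at hx
  obtain ⟨i, hi⟩ := hx
  refine mem_iUnion.2 ⟨i, subset_closure hi, fun h => hxP ?_⟩
  rw [hV]
  exact interior_mono (subset_iUnion (fun i => convexHull ℝ (V i : Set (E d))) i) h

section Partition

variable {Ω : Set (E d)} {N : ℕ} {P : Fin N → Set (E d)}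

theorem IsPolytopalPartition.ae_mem (hP : IsPolytopalPartition Ω P) (hΩ : IsOpen Ω) :
    ∀ᵐ x ∂(volume.restrict Ω), ∃ i, x ∈ P i := by
  have h : ∀ᵐ x ∂(volume : Measure (E d)), ∀ i, x ∉ closure (P i) \ P i :=
    ae_all_iff.2 fun i => measure_eq_zero_iff_ae_notMem.1 (hP.polytope i).volume_closure_diff
  filter_upwards [ae_restrict_of_ae h, ae_restrict_mem hΩ.measurableSet] with x hx hxΩ
  have := subset_closure hxΩ
  rw [← hP.iUnion_closure, mem_iUnion] at this
  obtain ⟨i, hi⟩ := this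
  exact ⟨i, by_contra fun h => hx i ⟨hi, h⟩⟩

theorem IsPolytopalPartition.piecewiseConst_eq (hP : IsPolytopalPartition Ω P) (c : Fin N → ℝ)
    {i : Fin N} {x : E d} (hx : x ∈ P i) : piecewiseConst P c x = c i := by
  rw [piecewiseConst, Finset.sum_eq_single i, indicator_of_mem hx]
  · intro k _ hk
    refine indicator_of_notMem (fun hxk => ?_) _
    have : x ∈ P i ∩ P k := ⟨hx, hxk⟩
    rw [hP.disjoint i k hk.symm] at this
    exact this
  · exact fun h => absurd (Finset.mem_univ i) h

theorem IsPolytopalPartition.isConductivity (hP : IsPolytopalPartition Ω P) (hΩ : IsOpen Ω)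
    {c : Fin N → ℝ} {lam : ℝ} (hc : ∀ i, lam ≤ c i) :
    IsConductivity Ω lam (∑ i, |c i|) (piecewiseConst P c) where
  aestronglyMeasurable := by
    have : Measurable (piecewiseConst P c) := Finset.measurable_fun_sum _ fun i _ =>
      measurable_const.indicator (hP.polytope i).isOpen.measurableSet
    exact this.aestronglyMeasurable
  lower := by
    filter_upwards [hP.ae_mem hΩ] with x ⟨i, hi⟩
    rw [hP.piecewiseConst_eq c hi]
    exact hc i
  upper := by
    filter_upwards [hP.ae_mem hΩ] with x ⟨i, hi⟩
    rw [hP.piecewiseConst_eq c hi]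
    exact Finset.single_le_sum (f := fun i => |c i|) (fun i _ => abs_nonneg _) (Finset.mem_univ i)

end Partition

theorem IsDeformation.isConductivity_comp {Ω K : Set (E d)} {Ψ Ψ' : E d → E d} {lam Λ : ℝ}
    {κ : E d → ℝ} (h : IsDeformation Ω K Ψ Ψ') (hκ : IsConductivity Ω lam Λ κ) :
    IsConductivity Ω lam Λ (κ ∘ Ψ) where
  aestronglyMeasurable :=
    hκ.aestronglyMeasurable.comp_quasiMeasurePreserving h.quasiMeasurePreserving
  lower := h.quasiMeasurePreserving.ae hκ.lower
  upper := h.quasiMeasurePreserving.ae hκ.upper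

/-! ### The pulled-back equation -/

/-- With `B` the derivative of the deformation, gradients pull back by `Bᵀ`; the factors `B⁻ᵀ` and
`B⁻¹` of the coefficient cancel it on either side, leaving the Jacobian. -/
theorem inner_pullCoeff {B : E d →L[ℝ] E d} (hB : IsUnit B) (a b : E d) :
    inner ℝ (pullCoeff (B - 1) (ContinuousLinearMap.adjoint B a))
      (ContinuousLinearMap.adjoint B b) = |B.det| * inner ℝ a b := by
  have h1 : star (Ring.inverse B) * star B = 1 := by
    rw [← star_mul, Ring.mul_inverse_cancel _ hB, star_one]
  have h2 : star (Ring.inverse B) (ContinuousLinearMap.adjoint B a) = a := by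
    have := DFunLike.congr_fun h1 a
    simpa [ContinuousLinearMap.star_eq_adjoint] using this
  have h3 : B (Ring.inverse B a) = a := by
    have := DFunLike.congr_fun (Ring.mul_inverse_cancel _ hB) a
    simpa using this
  rw [pullCoeff, add_sub_cancel, smul_apply, real_inner_smul_left,
    mul_apply_eq_comp, h2, ContinuousLinearMap.adjoint_inner_right, h3]

namespace IsDeformation

variable {Ω K : Set (E d)} {Ψ Ψ' : E d → E d}

/-- Every element of `H¹(Ω)` arises by composition with a given deformation. -/
theorem exists_eq_comp (hΩ : IsLipschitzDomain Ω) (h : IsDeformation Ω K Ψ Ψ') (w : H1 Ω) :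
    ∃ v : H1 Ω, grad w =ᵐ[volume.restrict Ω] pullGrad Ψ (grad v) ∧
      traceOp hΩ v = traceOp hΩ w := by
  obtain ⟨v, hv, -, hvt⟩ := h.symm.exists_comp hΩ w
  obtain ⟨w', hw', hg, -⟩ := h.exists_comp hΩ v
  have e : w' = w := by
    refine H1.ext hΩ.isOpen (hw'.trans ?_)
    refine (h.quasiMeasurePreserving.ae_eq_comp hv).trans (Eventually.of_forall fun x => ?_)
    simp only [Function.comp_apply]
    rw [h.left_inv x]
  exact ⟨v, e ▸ hg, hvt⟩

/-- After the change of variables the conductivity is again `κ` in its reference position, and the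
deformation survives only in the matrix `pullCoeff (B x)`. -/
theorem setIntegral_transported (hΩ : IsOpen Ω) (h : IsDeformation Ω K Ψ Ψ') (κ : E d → ℝ)
    {B : E d → E d →L[ℝ] E d} (hB : ∀ᵐ x ∂(volume.restrict Ω), fderiv ℝ Ψ x = 1 + B x)
    (hunit : ∀ᵐ x ∂(volume.restrict Ω), IsUnit (1 + B x)) {u v w y : H1 Ω}
    (hv : grad v =ᵐ[volume.restrict Ω] pullGrad Ψ (grad u))
    (hy : grad y =ᵐ[volume.restrict Ω] pullGrad Ψ (grad w)) :
    ∫ x in Ω, (κ ∘ Ψ') x * inner ℝ (grad u x) (grad w x)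
      = ∫ x in Ω, inner ℝ ((κ x • pullCoeff (B x)) (grad v x)) (grad y x) := by
  rw [h.setIntegral_eq hΩ]
  refine integral_congr_ae ?_
  filter_upwards [hB, hunit, hv, hy] with x h1 h2 h3 h4
  rw [h3, h4, smul_apply, real_inner_smul_left, pullGrad, pullGrad, h1, Function.comp_apply,
    h.left_inv x]
  have := inner_pullCoeff h2 (grad u (Ψ x)) (grad w (Ψ x))
  rw [add_sub_cancel_left] at this
  rw [this]
  ring

end IsDeformation

/-! ### The coefficient fields -/

theorem calA_add (X Y : E d →L[ℝ] E d) : calA (X + Y) = calA X + calA Y := by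
  ext v i
  simp [calA]
  ring

theorem calA_smul (t : ℝ) (X : E d →L[ℝ] E d) : calA (t • X) = t • calA X := by
  simp only [calA, ContinuousLinearMap.toLinearMap_smul, map_smul, smul_sub, smul_add,
    smul_smul, smul_eq_mul]

/-- The linear map `B ↦ 𝒜`. -/
def calALinear : (E d →L[ℝ] E d) →L[ℝ] (E d →L[ℝ] E d) :=
  LinearMap.toContinuousLinearMap
    { toFun := calA, map_add' := calA_add, map_smul' := calA_smul }

theorem calALinear_apply (X : E d →L[ℝ] E d) : calALinear X = calA X := rfl

theorem isUnit_one_add {X : E d →L[ℝ] E d} (hX : ‖X‖ < 1) : IsUnit (1 + X) := by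
  have := isUnit_one_sub_of_norm_lt_one (x := -X) (by rwa [norm_neg])
  rwa [sub_neg_eq_add] at this

theorem continuousAt_inverse_mul_star {R : Type*} [NormedRing R] [CompleteSpace R] [StarRing R]
    [ContinuousStar R] {X : R} (hX : IsUnit (1 + X)) :
    ContinuousAt (fun X : R => Ring.inverse (1 + X) * star (Ring.inverse (1 + X))) X := by
  obtain ⟨y, hy⟩ := hX
  have h1 : ContinuousAt (fun X : R => Ring.inverse (1 + X)) X := by
    refine ContinuousAt.comp (g := Ring.inverse) (f := fun X : R => 1 + X) ?_ (by fun_prop)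
    rw [← hy]
    exact NormedRing.inverse_continuousAt y
  exact h1.mul h1.star

theorem continuousOn_pullCoeff :
    ContinuousOn (pullCoeff : (E d →L[ℝ] E d) → E d →L[ℝ] E d) (Metric.ball 0 1) := by
  intro X hX
  have hX' : IsUnit (1 + X) := isUnit_one_add (by simpa using hX)
  have h2 : ContinuousAt (fun X : E d →L[ℝ] E d => |(1 + X).det|) X :=
    (differentiable_det.continuous.comp (by fun_prop : Continuous fun X : E d →L[ℝ] E d =>
      1 + X)).abs.continuousAt
  exact (h2.smul (continuousAt_inverse_mul_star hX')).continuousWithinAt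

/-- Continuity is available on the unit ball, where `1 + X` is invertible by the Neumann series; the
coefficient is replaced by zero outside it. -/
theorem aestronglyMeasurable_pullCoeff {μ : Measure (E d)} {B : E d → E d →L[ℝ] E d}
    (hB : AEStronglyMeasurable B μ) (hb : ∀ᵐ x ∂μ, ‖B x‖ < 1) :
    AEStronglyMeasurable (fun x => pullCoeff (B x)) μ := by
  classical
  have h1 : Measurable ((Metric.ball (0 : E d →L[ℝ] E d) 1).piecewise pullCoeff 0) :=
    continuousOn_pullCoeff.measurable_piecewise continuous_zero.continuousOn
      Metric.isOpen_ball.measurableSet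
  refine ((h1.comp_aemeasurable hB.aemeasurable).aestronglyMeasurable).congr ?_
  filter_upwards [hb] with x hx
  exact piecewise_eq_of_mem _ _ _ (by simpa using hx)

/-! ### The shape derivative -/

section ShapeDerivative

variable {Ω : Set (E d)} {lam Λ : ℝ} {κ : E d → ℝ} {U : E d → E d}
  {DU : E d → E d →L[ℝ] E d}

/-- The matrix field `κ 𝒜`. -/
def shapeField (κ : E d → ℝ) (DU : E d → E d →L[ℝ] E d) (x : E d) : E d →L[ℝ] E d :=
  κ x • calA (DU x)

theorem IsConductivity.aestronglyMeasurable_shapeField (h : IsConductivity Ω lam Λ κ)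
    (hU : IsW1Infty U DU) : AEStronglyMeasurable (shapeField κ DU) (volume.restrict Ω) :=
  h.aestronglyMeasurable.smul
    (calALinear.continuous.comp_aestronglyMeasurable hU.memLp_deriv.1.restrict)

theorem IsConductivity.exists_norm_shapeField_le (h : IsConductivity Ω lam Λ κ)
    (hU : IsW1Infty U DU) : ∃ Λ', ∀ᵐ x ∂(volume.restrict Ω), ‖shapeField κ DU x‖ ≤ Λ' := by
  obtain ⟨L, hL⟩ := hU.exists_ae_bound
  refine ⟨Λ * (‖calALinear (d := d)‖ * L), ?_⟩
  filter_upwards [h.upper, ae_restrict_of_ae hL] with x h1 h2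
  rw [shapeField, norm_smul, Real.norm_eq_abs, ← calALinear_apply]
  have h3 : ‖calALinear (DU x)‖ ≤ ‖calALinear (d := d)‖ * L :=
    (ContinuousLinearMap.le_opNorm _ _).trans (mul_le_mul_of_nonneg_left h2 (norm_nonneg _))
  exact mul_le_mul h1 h3 (norm_nonneg _) ((abs_nonneg _).trans h1)

theorem eventually_abs_mul_le (L : ℝ) {a : ℝ} (ha : 0 < a) :
    ∀ᶠ t in 𝓝 (0 : ℝ), |t| * L ≤ a := by
  have h : Tendsto (fun t : ℝ => |t| * L) (𝓝 0) (𝓝 0) := by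
    have : Continuous fun t : ℝ => |t| * L := by fun_prop
    simpa using this.tendsto 0
  exact (h.eventually_lt_const ha).mono fun t ht => ht.le

/-- The coefficient operators of the pulled-back equations are differentiable at `t = 0`. -/
theorem IsConductivity.exists_pulledBack_op (h : IsConductivity Ω lam Λ κ) (hU : IsW1Infty U DU)
    {Λ' : ℝ} (hΛ' : ∀ᵐ x ∂(volume.restrict Ω), ‖shapeField κ DU x‖ ≤ Λ') {ε : ℝ} (hε : 0 < ε) :
    ∀ᶠ t in 𝓝 (0 : ℝ), ∃ S : Lp (E d) 2 (volume.restrict Ω) →L[ℝ] Lp (E d) 2 (volume.restrict Ω),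
      ‖S - h.op - t • mulL2 (h.aestronglyMeasurable_shapeField hU) hΛ'‖ ≤ ε * |t| ∧
      ∀ G H : Lp (E d) 2 (volume.restrict Ω), inner ℝ (S G) H
        = ∫ x in Ω, inner ℝ ((κ x • pullCoeff (t • DU x)) (G x)) (H x) := by
  obtain ⟨L, hL⟩ := hU.exists_ae_bound
  -- Tuned so that the factors `|κ| ≤ |Λ| + 1` and `‖t • DU‖ ≤ |t| (L + 1)` combine to `ε * |t|`;
  -- the added ones keep the denominator positive.
  have hη : 0 < ε / ((|Λ| + 1) * (L + 1)) := by positivity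
  obtain ⟨r, hr, hexp⟩ := Metric.eventually_nhds_iff.1
    ((Asymptotics.isLittleO_iff.1 (pullCoeff_expansion (d := d))) hη)
  filter_upwards [eventually_abs_mul_le L (half_pos hr),
    eventually_abs_mul_le L (half_pos one_pos)] with t ht1 ht2
  have hbd : ∀ᵐ x ∂(volume.restrict Ω), ‖t • DU x‖ ≤ |t| * L := by
    filter_upwards [ae_restrict_of_ae hL] with x hx
    rw [norm_smul, Real.norm_eq_abs]
    exact mul_le_mul_of_nonneg_left hx (abs_nonneg _)
  have hm : AEStronglyMeasurable (fun x => κ x • pullCoeff (t • DU x)) (volume.restrict Ω) := by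
    refine h.aestronglyMeasurable.smul (aestronglyMeasurable_pullCoeff
      (hU.memLp_deriv.1.restrict.const_smul t) ?_)
    filter_upwards [hbd] with x hx
    exact (hx.trans ht2).trans_lt (by norm_num)
  have hdiff : ∀ᵐ x ∂(volume.restrict Ω), ‖κ x • pullCoeff (t • DU x) - scalarField κ x
      - t • shapeField κ DU x‖ ≤ ε * |t| := by
    filter_upwards [hbd, h.upper] with x hx hκ
    have e : κ x • pullCoeff (t • DU x) - scalarField κ x - t • shapeField κ DU x
        = κ x • (pullCoeff (t • DU x) - 1 - calA (t • DU x)) := by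
      rw [calA_smul, smul_sub, smul_sub, smul_comm (κ x) t]
      rfl
    rw [e, norm_smul, Real.norm_eq_abs]
    have h1 := hexp (y := t • DU x) (by
      rw [dist_zero_right]
      exact (hx.trans ht1).trans_lt (half_lt_self hr))
    have h2 : |κ x| ≤ |Λ| + 1 := hκ.trans ((le_abs_self Λ).trans (by linarith))
    calc _ ≤ (|Λ| + 1) * (ε / ((|Λ| + 1) * (L + 1)) * (|t| * (L + 1))) := by
          refine mul_le_mul h2 (h1.trans ?_) (norm_nonneg _) (by positivity)
          refine mul_le_mul_of_nonneg_left (hx.trans ?_) hη.le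
          exact mul_le_mul_of_nonneg_left (by linarith) (abs_nonneg t)
      _ = ε * |t| := by field_simp
  have hb : ∀ᵐ x ∂(volume.restrict Ω), ‖κ x • pullCoeff (t • DU x)‖
      ≤ ε * |t| + Λ + |t| * Λ' := by
    filter_upwards [hdiff, h.norm_scalarField_le, hΛ'] with x h1 h2 h3
    have e : κ x • pullCoeff (t • DU x) = (κ x • pullCoeff (t • DU x) - scalarField κ x
      - t • shapeField κ DU x) + scalarField κ x + t • shapeField κ DU x := by abel
    rw [e]
    refine (norm_add₃_le).trans (add_le_add (add_le_add h1 h2) ?_)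
    rw [norm_smul, Real.norm_eq_abs]
    exact mul_le_mul_of_nonneg_left h3 (abs_nonneg t)
  exact ⟨mulL2 hm hb, norm_mulL2_sub_sub_le hm hb _ _ _ _ t (by positivity) hdiff,
    inner_mulL2 hm hb⟩

theorem IsConductivity.integrableOn_shapeField (h : IsConductivity Ω lam Λ κ)
    (hU : IsW1Infty U DU) (u z : H1 Ω) :
    IntegrableOn (fun x => κ x * inner ℝ (calA (DU x) (grad u x)) (grad z x)) Ω volume := by
  obtain ⟨Λ', hΛ'⟩ := h.exists_norm_shapeField_le hU
  have h1 := L2.integrable_inner (𝕜 := ℝ)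
    (mulL2 (h.aestronglyMeasurable_shapeField hU) hΛ' (gradL Ω u)) (gradL Ω z)
  refine h1.congr ?_
  filter_upwards [coeFn_mulL2 (h.aestronglyMeasurable_shapeField hU) hΛ' (gradL Ω u)] with x hx
  rw [hx, shapeField, smul_apply, real_inner_smul_left]
  rfl

/-- The states for the transported conductivities, pulled back to the reference configuration,
solve an equation with the coefficient matrix `κ pullCoeff (t DU)`. -/
theorem IsDeformation.exists_pulledBack_state (hΩ : IsLipschitzDomain Ω) {L : ℝ≥0}
    (hL : LipschitzWith L U) (hU : IsW1Infty U DU) {K : Set (E d)} {t : ℝ}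
    (hdef : IsDeformation Ω K (Phi U t) (Function.invFun (Phi U t)))
    (ht : ∀ᵐ x, ‖t • DU x‖ < 1) {g : HHalf Ω →ₗ[ℝ] ℝ} {f : HHalf Ω} {y : H1 Ω}
    (hy : IsState (transported U κ t) g f y) :
    ∃ v : H1 Ω, traceOp hΩ v = traceOp hΩ y ∧ ∀ w : H1 Ω,
      ∫ x in Ω, inner ℝ ((κ x • pullCoeff (t • DU x)) (grad v x)) (grad w x) = g (trace w) := by
  obtain ⟨v, -, hv, hvt⟩ := hdef.exists_comp hΩ y
  refine ⟨v, hvt, fun w => ?_⟩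
  -- Every test function `w` is the pull-back of some `w'` with the same trace, so testing the
  -- perturbed equation with `w'` leaves the boundary term unchanged.
  obtain ⟨w', hw', hwt⟩ := hdef.exists_eq_comp hΩ w
  have hB : ∀ᵐ x ∂(volume.restrict Ω), fderiv ℝ (Phi U t) x = 1 + t • DU x := by
    filter_upwards [ae_restrict_of_ae (hU.ae_hasFDerivAt hL)] with x hx
    exact ((hasFDerivAt_id x).add (hx.const_smul t)).fderiv
  rw [← hdef.setIntegral_transported hΩ.isOpen κ hB
    ((ae_restrict_of_ae ht).mono fun x hx => isUnit_one_add hx) hv hw']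
  have htr : trace w' = trace w := Subtype.ext (by rw [coe_trace hΩ, coe_trace hΩ, hwt])
  rw [← htr]
  exact hy.1 w'

theorem eventually_isDeformation_Phi (hΩ : IsLipschitzDomain Ω) {L : ℝ≥0}
    (hL : LipschitzWith L U) (hU0 : ∀ᶠ x in 𝓝ˢ (frontier Ω), U x = 0) :
    ∃ K, ∀ᶠ t in 𝓝 (0 : ℝ), IsDeformation Ω K (Phi U t) (Function.invFun (Phi U t)) := by
  obtain ⟨K, hK⟩ := exists_isDeformation_Phi hΩ hL hU0
  exact ⟨K, (eventually_abs_mul_le L (half_pos one_pos)).mono fun t ht => hK t ht⟩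

theorem isState_state_of_existsUnique {σ : E d → ℝ} {g : HHalf Ω →ₗ[ℝ] ℝ} {f : HHalf Ω}
    (h : ∃! u : H1 Ω, IsState σ g f u) : IsState σ g f (state σ g f) :=
  Classical.epsilon_spec h.exists

/-- The derivative of a single misfit term. -/
theorem IsConductivity.hasDerivAt_misfit [NeZero d] (hΩ : IsLipschitzDomain Ω) (hlam : 0 < lam)
    (h : IsConductivity Ω lam Λ κ) {g : HHalf Ω →ₗ[ℝ] ℝ} (hg : MemHNegHalfZero g) {f : HHalf Ω}
    (hUc : Continuous U) (hU : IsW1Infty U DU) (hU0 : ∀ᶠ x in 𝓝ˢ (frontier Ω), U x = 0)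
    {u z : H1 Ω} (hu : IsState κ g f u) (hz : IsAdjoint κ f u z) :
    HasDerivAt (fun t : ℝ => 1 / 2 * ∫ x, |bdryFun (trace (state (transported U κ t) g f)) x
        - bdryFun f x| ^ 2 ∂(surface Ω))
      (∫ x in Ω, κ x * inner ℝ (calA (DU x) (grad u x)) (grad z x)) 0 := by
  obtain ⟨L, hL⟩ := hU.lipschitzWith hUc
  obtain ⟨L', hL'⟩ := hU.exists_ae_bound
  obtain ⟨K, hK⟩ := eventually_isDeformation_Phi hΩ hL hU0
  obtain ⟨Λ', hΛ'⟩ := h.exists_norm_shapeField_le hU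
  obtain ⟨C, hC, hp⟩ := hΩ.norm_le_gradL_add_bdryMean
  have hv : ∀ᶠ t in 𝓝 (0 : ℝ), ∃ v : H1 Ω,
      traceOp hΩ v = traceOp hΩ (state (transported U κ t) g f) ∧ bdryMean hΩ v = bdryMean hΩ u ∧
      ∀ w : H1 Ω, ∫ x in Ω, inner ℝ ((κ x • pullCoeff (t • DU x)) (grad v x)) (grad w x)
        = g (trace w) := by
    filter_upwards [hK, eventually_abs_mul_le L' (half_pos one_pos)] with t hdef ht
    -- The transported conductivity is `κ` composed with the inverse deformation and inherits the
    -- bounds of `κ`.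
    have hst := isState_state_of_existsUnique
      ((hdef.symm.isConductivity_comp h).existsUnique_isState hΩ hlam hg f)
    have ht' : ∀ᵐ x, ‖t • DU x‖ < 1 := by
      filter_upwards [hL'] with x hx
      rw [norm_smul, Real.norm_eq_abs]
      exact ((mul_le_mul_of_nonneg_left hx (abs_nonneg t)).trans ht).trans_lt (by norm_num)
    obtain ⟨v, hvt, hvw⟩ := hdef.exists_pulledBack_state hΩ hL hU ht' hst
    refine ⟨v, hvt, ?_, hvw⟩
    rw [bdryMean_apply, hvt, ← bdryMean_apply, ← integral_bdryFun_trace, ← integral_bdryFun_trace,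
      hu.2]
    exact hst.2
  obtain ⟨v, hv'⟩ := hv.choice
  have key := ShapeEIT.hasDerivAt_misfit (G := gradL Ω) (m := bdryMean hΩ) hC hp hlam
    h.le_inner_op h.inner_op_comm (τ := traceOp hΩ) (f := (f : Lp ℝ 2 (surface Ω))) (u := u)
    (z := z) (v := v) (D := mulL2 (h.aestronglyMeasurable_shapeField hU) hΛ') ?_ ?_
  · have e : inner ℝ (mulL2 (h.aestronglyMeasurable_shapeField hU) hΛ' (gradL Ω u)) (gradL Ω z)
        = ∫ x in Ω, κ x * inner ℝ (calA (DU x) (grad u x)) (grad z x) := by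
      rw [inner_mulL2]
      refine integral_congr_ae (Eventually.of_forall fun x => ?_)
      simp only [shapeField, smul_apply, real_inner_smul_left]
      rfl
    rw [← e]
    refine key.congr_of_eventuallyEq ?_
    filter_upwards [hv'] with t ht
    rw [integral_abs_sub_sq hΩ, ← ht.1]
  · intro ε hε
    filter_upwards [hv', h.exists_pulledBack_op hU hΛ' hε] with t ht hS
    obtain ⟨S, hS1, hS2⟩ := hS
    refine ⟨ht.2.1, S, hS1, fun w => ?_⟩
    exact (hS2 (gradL Ω (v t)) (gradL Ω w)).trans ((ht.2.2 w).trans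
      ((h.inner_op_gradL u w).trans (hu.1 w)).symm)
  · intro w
    exact (h.inner_op_gradL z w).trans ((hz.1 w).trans (integral_sub_mul_bdryFun hΩ f u w))

end ShapeDerivative

end ShapeEIT

end

/-! ### Well-posedness and shape derivative of the least-squares functional -/

theorem mainTheorem1 {d : ℕ} (hd : d = 2 ∨ d = 3)
    {Ω : Set (ShapeEIT.E d)} (hΩ : ShapeEIT.IsLipschitzDomain Ω)
    {N : ℕ} (P : Fin N → Set (ShapeEIT.E d)) (hP : ShapeEIT.IsPolytopalPartition Ω P)
    (c : Fin N → ℝ) (lam : ℝ) (hlam : 0 < lam) (hc : ∀ i, lam ≤ c i)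
    (σ : ShapeEIT.E d → ℝ) (hσ : σ = ShapeEIT.piecewiseConst P c)
    {M : ℕ} (g : Fin M → ShapeEIT.HHalf Ω →ₗ[ℝ] ℝ) (hg : ∀ j, ShapeEIT.MemHNegHalfZero (g j))
    (f : Fin M → ShapeEIT.HHalf Ω)
    (U : ShapeEIT.E d → ShapeEIT.E d) (DU : ShapeEIT.E d → ShapeEIT.E d →L[ℝ] ShapeEIT.E d)
    (hUc : Continuous U) (hU : ShapeEIT.IsW1Infty U DU)
    (hU0 : ∀ᶠ x in 𝓝ˢ (frontier Ω), U x = 0) :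
    -- for small `t` the map `Φ_t` is invertible and the state problems for `σ_t` are well posed
    (∀ᶠ t in 𝓝 (0 : ℝ), Function.Bijective (ShapeEIT.Phi U t) ∧
      ∀ j, ∃! u : ShapeEIT.H1 Ω,
        ShapeEIT.IsState (ShapeEIT.transported U σ t) (g j) (f j) u) ∧
    -- the state problems and the adjoint problems for `σ` are well posed
    (∀ j, ∃! u : ShapeEIT.H1 Ω, ShapeEIT.IsState σ (g j) (f j) u) ∧
    (∀ j, ∀ u : ShapeEIT.H1 Ω, ShapeEIT.IsState σ (g j) (f j) u →
      ∃! z : ShapeEIT.H1 Ω, ShapeEIT.IsAdjoint σ (f j) u z) ∧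
    -- the shape derivative exists and is given by the distributed formula
    ∀ u z : Fin M → ShapeEIT.H1 Ω,
      (∀ j, ShapeEIT.IsState σ (g j) (f j) (u j)) →
      (∀ j, ShapeEIT.IsAdjoint σ (f j) (u j) (z j)) →
      (∀ j, IntegrableOn (fun x => σ x * inner ℝ
        (ShapeEIT.calA (DU x) (ShapeEIT.grad (u j) x)) (ShapeEIT.grad (z j) x)) Ω volume) ∧
      HasDerivAt (fun t : ℝ => ShapeEIT.costJ g f (ShapeEIT.transported U σ t))
        (∑ j, ∫ x in Ω, σ x * inner ℝ
          (ShapeEIT.calA (DU x) (ShapeEIT.grad (u j) x)) (ShapeEIT.grad (z j) x)) 0 := by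
  -- Positive dimension gives a bounded domain a nonempty boundary of positive surface measure, so
  -- the boundary mean of the constant one is nonzero.
  have : NeZero d := ⟨by rcases hd with rfl | rfl <;> norm_num⟩
  have hcond : ShapeEIT.IsConductivity Ω lam (∑ i, |c i|) σ := by
    rw [hσ]
    exact hP.isConductivity hΩ.isOpen hc
  obtain ⟨L, hL⟩ := hU.lipschitzWith hUc
  obtain ⟨K, hK⟩ := ShapeEIT.eventually_isDeformation_Phi hΩ hL hU0
  refine ⟨?_, fun j => hcond.existsUnique_isState hΩ hlam (hg j) (f j),
    fun j u hu => hcond.existsUnique_isAdjoint hΩ hlam (f j) hu.2, fun u z hu hz => ⟨fun j =>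
      hcond.integrableOn_shapeField hU (u j) (z j), ?_⟩⟩
  · filter_upwards [hK] with t ht
    exact ⟨⟨ht.left_inv.injective, ht.right_inv.surjective⟩, fun j =>
      (ht.symm.isConductivity_comp hcond).existsUnique_isState hΩ hlam (hg j) (f j)⟩
  · simp only [ShapeEIT.costJ, Finset.mul_sum]
    exact HasDerivAt.fun_sum fun j _ =>
      hcond.hasDerivAt_misfit hΩ hlam (hg j) hUc hU hU0 (hu j) (hz j)
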